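/- Theorem. Let $n \ge 2$ and let $g$ be a smooth Riemannian metric on $S^{n+1}$ that is rotationally symmetric, i.e., after pulling back by a diffeomorphism of $S^{n+1}$ it is invariant under all rotations of $\mathbb{R}^{n+2}$ fixing a coordinate axis (equivalently, away from two points $g$ is a warped product $dr^2+\omega(r)^2\,g_{S^n}$). Suppose that $(S^{n+1},g)$ is a shrinking gradient Ricci soliton, i.e., there are a function $f\in C^\infty(S^{n+1})$ and a constant $\lambda>0$ with $$\mathrm{Rc}(g)+\nabla\nabla f-\lambda g=0 .$$ Then $g$ has positive curvature operator: at every point of $S^{n+1}$ the curvature operator $\mathrm{Rm}(g):\wedge^2\to\wedge^2$ is positive definite. -/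

import Mathlib

open scoped Manifold ContDiff

noncomputable section

/-! ### Riemannian geometry of a matrix-valued metric on coordinate space

Below `G y` is the matrix `(g_ij(y))` of a metric in local coordinates `y ∈ ℝᵐ`. -/

namespace LocalGeometry

variable {m : ℕ}

/-- The partial derivative `∂ᵢ F` of a function on coordinate space. -/
def partialDeriv (i : Fin m) (F : EuclideanSpace ℝ (Fin m) → ℝ)
    (y : EuclideanSpace ℝ (Fin m)) : ℝ :=
  fderiv ℝ F y (EuclideanSpace.single i 1)

/-- The Christoffel symbol
`Γᵏᵢⱼ = ½ ∑ₗ gᵏˡ (∂ᵢ gⱼₗ + ∂ⱼ gᵢₗ - ∂ₗ gᵢⱼ)` of the Levi-Civita connection. -/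
def christoffel (G : EuclideanSpace ℝ (Fin m) → Matrix (Fin m) (Fin m) ℝ)
    (k i j : Fin m) (y : EuclideanSpace ℝ (Fin m)) : ℝ :=
  (1 / 2) * ∑ l, (G y)⁻¹ k l *
    (partialDeriv i (fun z => G z j l) y + partialDeriv j (fun z => G z i l) y
      - partialDeriv l (fun z => G z i j) y)

/-- The components `Rᵢⱼₖˡ` of the Riemann curvature tensor, `R(∂ᵢ, ∂ⱼ)∂ₖ = ∑ₗ Rᵢⱼₖˡ ∂ₗ` with
`R(X, Y)Z = ∇_X ∇_Y Z - ∇_Y ∇_X Z - ∇_[X, Y] Z`. -/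
def riemannUp (G : EuclideanSpace ℝ (Fin m) → Matrix (Fin m) (Fin m) ℝ)
    (i j k l : Fin m) (y : EuclideanSpace ℝ (Fin m)) : ℝ :=
  partialDeriv i (christoffel G l j k) y - partialDeriv j (christoffel G l i k) y
    + ∑ q, (christoffel G l i q y * christoffel G q j k y
      - christoffel G l j q y * christoffel G q i k y)

/-- The components `Rᵢⱼₖₗ = g(R(∂ᵢ, ∂ⱼ)∂ₖ, ∂ₗ)`; for the unit sphere
`Rᵢⱼₖₗ = gᵢₗ gⱼₖ - gᵢₖ gⱼₗ`. -/
def riemann (G : EuclideanSpace ℝ (Fin m) → Matrix (Fin m) (Fin m) ℝ)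
    (i j k l : Fin m) (y : EuclideanSpace ℝ (Fin m)) : ℝ :=
  ∑ q, G y l q * riemannUp G i j k q y

/-- The Ricci tensor `Rcⱼₖ = ∑ᵢ Rᵢⱼₖⁱ`. -/
def ricci (G : EuclideanSpace ℝ (Fin m) → Matrix (Fin m) (Fin m) ℝ)
    (j k : Fin m) (y : EuclideanSpace ℝ (Fin m)) : ℝ :=
  ∑ i, riemannUp G i j k i y

/-- The Hessian `(∇∇F)ᵢⱼ = ∂ᵢ∂ⱼF - ∑ₖ Γᵏᵢⱼ ∂ₖF`. -/
def hessian (G : EuclideanSpace ℝ (Fin m) → Matrix (Fin m) (Fin m) ℝ)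
    (F : EuclideanSpace ℝ (Fin m) → ℝ) (i j : Fin m) (y : EuclideanSpace ℝ (Fin m)) : ℝ :=
  partialDeriv i (partialDeriv j F) y - ∑ k, christoffel G k i j y * partialDeriv k F y

/-- The quadratic form `⟨Rm(η), η⟩` of the curvature operator `Rm : ⋀² → ⋀²`, on a bivector `η`
with (antisymmetric) components `ηⁱʲ`, up to the conventional positive factor: on a simple bivector
`η = u ∧ v`, `ηⁱʲ = uⁱvʲ - uʲvⁱ`, its value is `4 g(R(u, v)v, u)`. -/
def curvatureForm (G : EuclideanSpace ℝ (Fin m) → Matrix (Fin m) (Fin m) ℝ)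
    (η : Matrix (Fin m) (Fin m) ℝ) (y : EuclideanSpace ℝ (Fin m)) : ℝ :=
  ∑ i, ∑ j, ∑ k, ∑ l, riemann G i j k l y * η i j * η l k

end LocalGeometry

/-! ### Riemannian manifolds -/

section Manifolds

variable {m : ℕ} {M : Type*} [TopologicalSpace M] [ChartedSpace (EuclideanSpace ℝ (Fin m)) M]
  [IsManifold (𝓡 m) ∞ M]

/-- Smooth Riemannian metrics on the manifold `M` of dimension `m`. -/
abbrev SmoothMetric (m : ℕ) (M : Type*) [TopologicalSpace M]
    [ChartedSpace (EuclideanSpace ℝ (Fin m)) M] [IsManifold (𝓡 m) ∞ M] :=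
  Bundle.ContMDiffRiemannianMetric (𝓡 m) ∞ (EuclideanSpace ℝ (Fin m))
    (fun p : M => TangentSpace (𝓡 m) p)

/-- The matrix `gᵢⱼ = g(∂ᵢ, ∂ⱼ)` of the metric in the local coordinates given by a chart `e`. -/
def metricInChart (g : SmoothMetric m M) (e : OpenPartialHomeomorph M (EuclideanSpace ℝ (Fin m)))
    (y : EuclideanSpace ℝ (Fin m)) : Matrix (Fin m) (Fin m) ℝ :=
  Matrix.of fun i j => g.inner (e.symm y)
    (mfderiv (𝓡 m) (𝓡 m) e.symm y (EuclideanSpace.single i (1 : ℝ)))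
    (mfderiv (𝓡 m) (𝓡 m) e.symm y (EuclideanSpace.single j (1 : ℝ)))

/-- The tensor equation `Rc(g) + ∇∇f - c g = 0`, in all smooth local coordinates. -/
def GradientSolitonEquation (g : SmoothMetric m M) (f : M → ℝ) (c : ℝ) : Prop :=
  ∀ e ∈ IsManifold.maximalAtlas (𝓡 m) ∞ M, ∀ y ∈ e.target, ∀ i j : Fin m,
    LocalGeometry.ricci (metricInChart g e) i j y
      + LocalGeometry.hessian (metricInChart g e) (fun z => f (e.symm z)) i j y
      - c * metricInChart g e y i j = 0

/-- `(M, g)` is a shrinking gradient Ricci soliton: `Rc(g) + ∇∇f - c g = 0` for some smooth `f`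
and some constant `c > 0`. -/
def IsShrinkingSoliton (g : SmoothMetric m M) : Prop :=
  ∃ f : M → ℝ, ContMDiff (𝓡 m) 𝓘(ℝ, ℝ) ∞ f ∧ ∃ c : ℝ, 0 < c ∧ GradientSolitonEquation g f c

/-- The curvature operator of `g` is positive definite on bivectors at every point. -/
def HasPositiveCurvatureOperator (g : SmoothMetric m M) : Prop :=
  ∀ e ∈ IsManifold.maximalAtlas (𝓡 m) ∞ M, ∀ y ∈ e.target,
    ∀ η : Matrix (Fin m) (Fin m) ℝ, η.transpose = -η → η ≠ 0 →
      0 < LocalGeometry.curvatureForm (metricInChart g e) η y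

/-- The pullback `(φ^* g)(u, v)` of `g` under a map `φ`. -/
def pullbackForm (g : SmoothMetric m M) (φ : M → M) (p : M) (u v : TangentSpace (𝓡 m) p) : ℝ :=
  g.inner (φ p) (mfderiv (𝓡 m) (𝓡 m) φ p u) (mfderiv (𝓡 m) (𝓡 m) φ p v)

end Manifolds

/-! ### Rotational symmetry on the sphere -/

/-- The unit sphere `Sⁿ⁺¹ ⊂ ℝⁿ⁺²`. -/
abbrev UnitSphere (n : ℕ) : Type :=
  Metric.sphere (0 : EuclideanSpace ℝ (Fin (n + 1 + 1))) 1

/-- The map of the sphere induced by a linear isometry of the ambient space. -/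
def sphereMap {n : ℕ}
    (A : EuclideanSpace ℝ (Fin (n + 1 + 1)) ≃ₗᵢ[ℝ] EuclideanSpace ℝ (Fin (n + 1 + 1)))
    (p : UnitSphere n) : UnitSphere n :=
  ⟨A p, by simp⟩

/-- `g` is rotationally symmetric: up to a diffeomorphism `Φ` of the sphere, it is invariant under
the group `SO(n+1)` of all rotations of `ℝⁿ⁺²` which fix the axis spanned by the first
basis vector. -/
def IsRotationallySymmetric {n : ℕ} (g : SmoothMetric (n + 1) (UnitSphere n)) : Prop :=
  ∃ Φ : UnitSphere n ≃ₘ^∞⟮𝓡 (n + 1), 𝓡 (n + 1)⟯ UnitSphere n,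
    ∀ A : EuclideanSpace ℝ (Fin (n + 1 + 1)) ≃ₗᵢ[ℝ] EuclideanSpace ℝ (Fin (n + 1 + 1)),
      LinearMap.det (A.toLinearEquiv : EuclideanSpace ℝ (Fin (n + 1 + 1)) →ₗ[ℝ]
        EuclideanSpace ℝ (Fin (n + 1 + 1))) = 1 →
      A (EuclideanSpace.single 0 1) = EuclideanSpace.single 0 1 →
      ∀ (p : UnitSphere n) (u v : TangentSpace (𝓡 (n + 1)) p),
        pullbackForm g (fun q => Φ (sphereMap A q)) p u v = pullbackForm g Φ p u v

end

/-!
A rotationally symmetric metric is a warped product `dr² + w(r)² g` over the unit sphere, whose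
sectional curvatures are `K₀ = -w'' / w` for the planes containing the radial direction and
`K₁ = (1 - w'²) / w²` for those orthogonal to it. Its curvature operator is positive if and only if
both are. For a soliton the two curvatures and `φ = f'` satisfy a system of ordinary differential
equations, and the positivity follows from it by maximum principle arguments
(`WarpedSoliton.curvature_pos`):

* At the poles the two curvatures have a common limit `k`. If `k < 0`, the slope `w'` would grow
  beyond one and never return to zero; if `k = 0`, uniqueness for the system would make the metric
  flat. So `k > 0`, and both curvatures are positive from each pole to the first critical point of
  `w` (`WarpedSoliton.pos_of_tendsto_atBot`).
* Between the first and the last critical point of `w`, the slope stays below one, because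
  otherwise it has a maximum at which the system gives a contradiction, so `K₁ > 0`
  (`WarpedSoliton.lt_one_of_mem_Icc`). The quotient `K₀ / K₁` has no negative interior minimum
  (`WarpedSoliton.K₀_nonneg_of_mem_Icc`), which uses that the scalar curvature is positive where
  `K₀ < 0` (`WarpedSoliton.scalar_pos`). Hence `K₀ ≥ 0`, so `w` is concave there, and the first
  critical point is the last one.

To reach this system, the metric is written in two stereographic charts, composed with the given
diffeomorphism, whose transition map is the inversion. In them the rotations about the axis become
compositions of two reflections of coordinate space, and the metric takes the form
`α(|z|²) ⟨u, v⟩ + β(|z|²) ⟨z, u⟩ ⟨z, v⟩` (`IsInvariantSoliton.isRotMetric`), whose curvature and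
Hessians are computed directly (`IsRotMetric.curvatureTensor_eq`, `IsRotMetric.warpedSoliton`). The
potential is not assumed to be invariant. It is, because the soliton equation holds in all
charts: the difference between the potential and its composition with a rotation has vanishing
Hessian and, by compactness, a critical point, so it is constant (`IsInvariantSoliton.comp_eq`). The
limits at the poles exist because the components of the metric are smooth at the origin of the
charts (`IsInvariantSoliton.tendsto_pole`).

Positivity of the curvature operator is transported to an arbitrary chart by the transformation law
of the Levi-Civita connection and of its curvature, which is derived from the uniqueness of the
solution of the Koszul formula (`HasPosCurvatureAt.of_pullback`).
-/

noncomputable section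

set_option maxSynthPendingDepth 3

open scoped RealInnerProductSpace EuclideanSpace

/-! ### Real functions on an interval -/

theorem exists_first_zero {u : ℝ → ℝ} {s t : ℝ} (hst : s ≤ t) (hu : ContinuousOn u (Set.Icc s t))
    (hs : 0 < u s) (ht : u t ≤ 0) :
    ∃ r ∈ Set.Ioc s t, u r = 0 ∧ ∀ y ∈ Set.Ico s r, 0 < u y := by
  have hne : (Set.Icc s t ∩ u ⁻¹' Set.Iic 0).Nonempty := ⟨t, ⟨hst, le_rfl⟩, ht⟩
  have hcl : IsCompact (Set.Icc s t ∩ u ⁻¹' Set.Iic 0) :=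
    isCompact_Icc.of_isClosed_subset (hu.preimage_isClosed_of_isClosed isClosed_Icc isClosed_Iic)
      Set.inter_subset_left
  obtain ⟨r, ⟨⟨hsr, hrt⟩, hr0⟩, hmin⟩ := hcl.exists_isLeast hne
  have hr0 : u r ≤ 0 := hr0
  have hpos : ∀ y ∈ Set.Ico s r, 0 < u y := by
    intro y hy
    by_contra h
    have := hmin ⟨⟨hy.1, hy.2.le.trans hrt⟩, not_lt.mp h⟩
    exact absurd hy.2 (not_lt.mpr this)
  have hsr' : s < r := by
    rcases hsr.lt_or_eq with h | h
    · exact h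
    · rw [← h] at hr0; linarith
  refine ⟨r, ⟨hsr', hrt⟩, ?_, hpos⟩
  obtain ⟨z, hz, hz0⟩ := intermediate_value_Icc' hsr (hu.mono (Set.Icc_subset_Icc_right hrt))
    (show (0 : ℝ) ∈ Set.Icc (u r) (u s) from ⟨hr0, hs.le⟩)
  rcases hz.2.lt_or_eq with h | h
  · have := hpos z ⟨hz.1, h⟩
    linarith
  · rw [← h]; exact hz0

theorem exists_last_zero {u : ℝ → ℝ} {s t : ℝ} (hst : s ≤ t) (hu : ContinuousOn u (Set.Icc s t))
    (ht : 0 < u t) (hs : u s ≤ 0) :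
    ∃ r ∈ Set.Ico s t, u r = 0 ∧ ∀ y ∈ Set.Ioc r t, 0 < u y := by
  obtain ⟨r, hr, h0, hp⟩ := exists_first_zero (u := fun y => u (-y)) (s := -t) (t := -s)
    (by linarith) (hu.comp continuous_neg.continuousOn (by
      intro y hy; exact ⟨by linarith [hy.2], by linarith [hy.1]⟩)) (by simpa using ht)
    (by simpa using hs)
  refine ⟨-r, ⟨by linarith [hr.2], by linarith [hr.1]⟩, h0, ?_⟩
  intro y hy
  have := hp (-y) ⟨by linarith [hy.2], by linarith [hy.1]⟩
  simpa using this

/-- A function that starts positive and satisfies `u' ≥ -C u` for as long as it has stayed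
nonnegative stays positive. -/
theorem pos_of_neg_mul_le_deriv {u u' : ℝ → ℝ} {s a C : ℝ}
    (hu : ∀ t ∈ Set.Icc s a, HasDerivAt u (u' t) t) (h0 : 0 < u s)
    (h : ∀ t ∈ Set.Icc s a, (∀ r ∈ Set.Icc s t, 0 ≤ u r) → -C * u t ≤ u' t) :
    ∀ t ∈ Set.Icc s a, 0 < u t := by
  intro t ht
  by_contra hneg
  obtain ⟨r, hr, hr0, hpos⟩ := exists_first_zero ht.1
    (fun y hy => (hu y ⟨hy.1, hy.2.trans ht.2⟩).continuousAt.continuousWithinAt) h0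
    (not_lt.mp hneg)
  have hnn : ∀ y ∈ Set.Icc s r, 0 ≤ u y := by
    intro y hy
    rcases hy.2.lt_or_eq with hlt | heq
    · exact (hpos y ⟨hy.1, hlt⟩).le
    · rw [heq, hr0]
  have hra : r ≤ a := hr.2.trans ht.2
  have hv : ∀ y ∈ Set.Icc s r, HasDerivAt (fun z => u z * Real.exp (C * z))
      (u' y * Real.exp (C * y) + u y * (Real.exp (C * y) * C)) y := by
    intro y hy
    have h1 : HasDerivAt (fun z : ℝ => C * z) C y := by
      simpa using (hasDerivAt_id y).const_mul C
    exact (hu y ⟨hy.1, hy.2.trans hra⟩).mul h1.exp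
  have hmono : MonotoneOn (fun z => u z * Real.exp (C * z)) (Set.Icc s r) := by
    refine monotoneOn_of_deriv_nonneg (convex_Icc s r)
      (fun y hy => (hv y hy).continuousAt.continuousWithinAt)
      (fun y hy => (hv y (interior_subset hy)).differentiableAt.differentiableWithinAt) ?_
    intro y hy
    have hy' := interior_subset hy
    rw [(hv y hy').deriv]
    have h1 := h y ⟨hy'.1, hy'.2.trans hra⟩ (fun z hz => hnn z ⟨hz.1, hz.2.trans hy'.2⟩)
    have h2 := Real.exp_pos (C * y)
    nlinarith
  have h3 := hmono ⟨le_rfl, hr.1.le⟩ ⟨hr.1.le, le_rfl⟩ hr.1.le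
  simp only [hr0, zero_mul] at h3
  have := mul_pos h0 (Real.exp_pos (C * s))
  linarith

theorem eventually_gt_nhdsLT_of_deriv_neg {u : ℝ → ℝ} {u' s : ℝ} (h : HasDerivAt u u' s)
    (hneg : u' < 0) : ∀ᶠ y in nhdsWithin s (Set.Iio s), u s < u y := by
  have h1 := (hasDerivAt_iff_tendsto_slope.mp h).eventually (gt_mem_nhds hneg)
  have h2 : ∀ᶠ y in nhdsWithin s (Set.Iio s), slope u s y < 0 :=
    h1.filter_mono (nhdsWithin_mono s fun y hy => ne_of_lt hy)
  filter_upwards [h2, self_mem_nhdsWithin] with y hy hys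
  have hys : y < s := hys
  rw [slope_def_field, div_neg_iff] at hy
  rcases hy with hy | hy <;> linarith [hy.1, hy.2]

theorem eventually_lt_nhdsGT_of_deriv_neg {u : ℝ → ℝ} {u' s : ℝ} (h : HasDerivAt u u' s)
    (hneg : u' < 0) : ∀ᶠ y in nhdsWithin s (Set.Ioi s), u y < u s := by
  have h1 := (hasDerivAt_iff_tendsto_slope.mp h).eventually (gt_mem_nhds hneg)
  have h2 : ∀ᶠ y in nhdsWithin s (Set.Ioi s), slope u s y < 0 :=
    h1.filter_mono (nhdsWithin_mono s fun y hy => ne_of_gt hy)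
  filter_upwards [h2, self_mem_nhdsWithin] with y hy hys
  have hys : s < y := hys
  rw [slope_def_field, div_neg_iff] at hy
  rcases hy with hy | hy <;> linarith [hy.1, hy.2]

/-- If the derivative of `u` is positive just to the left of `s`, then `s` is not a minimum. -/
theorem exists_lt_of_deriv_pos_left {u u' : ℝ → ℝ} {p s : ℝ} (hps : p < s)
    (hu : ∀ y ∈ Set.Icc p s, HasDerivAt u (u' y) y)
    (h : ∀ᶠ y in nhdsWithin s (Set.Iio s), 0 < u' y) : ∃ y ∈ Set.Ico p s, u y < u s := by
  obtain ⟨l, hl, hls⟩ := (mem_nhdsLT_iff_exists_Ioo_subset' hps).mp h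
  set y := max l p with hy
  have hys : y < s := max_lt hl hps
  have hpy : p ≤ y := le_max_right _ _
  refine ⟨y, ⟨hpy, hys⟩, ?_⟩
  have hmono : StrictMonoOn u (Set.Icc y s) := by
    refine strictMonoOn_of_deriv_pos (convex_Icc y s)
      (fun z hz => (hu z ⟨hpy.trans hz.1, hz.2⟩).continuousAt.continuousWithinAt) ?_
    intro z hz
    rw [interior_Icc] at hz
    rw [(hu z ⟨hpy.trans hz.1.le, hz.2.le⟩).deriv]
    exact hls ⟨(le_max_left _ _).trans_lt hz.1, hz.2⟩
  exact hmono ⟨le_rfl, hys.le⟩ ⟨hys.le, le_rfl⟩ hys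

theorem exists_lt_of_deriv_neg_right {u u' : ℝ → ℝ} {p s : ℝ} (hps : s < p)
    (hu : ∀ y ∈ Set.Icc s p, HasDerivAt u (u' y) y)
    (h : ∀ᶠ y in nhdsWithin s (Set.Ioi s), u' y < 0) : ∃ y ∈ Set.Ioc s p, u y < u s := by
  obtain ⟨l, hl, hls⟩ := (mem_nhdsGT_iff_exists_Ioo_subset' hps).mp h
  set y := min l p with hy
  have hys : s < y := lt_min hl hps
  have hpy : y ≤ p := min_le_right _ _
  refine ⟨y, ⟨hys, hpy⟩, ?_⟩
  have hmono : StrictAntiOn u (Set.Icc s y) := by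
    refine strictAntiOn_of_deriv_neg (convex_Icc s y)
      (fun z hz => (hu z ⟨hz.1, hz.2.trans hpy⟩).continuousAt.continuousWithinAt) ?_
    intro z hz
    rw [interior_Icc] at hz
    rw [(hu z ⟨hz.1.le, hz.2.le.trans hpy⟩).deriv]
    exact hls ⟨hz.1, hz.2.trans_le (min_le_left _ _)⟩
  exact hmono ⟨le_rfl, hys.le⟩ ⟨hys.le, le_rfl⟩ hys

/-! ### The soliton equation for warped products -/

/-- The equation of a gradient Ricci soliton for a warped product `dr² + w² g` over a unit
sphere of dimension `n`, written along a meridian with an arbitrary parameter `t` of speed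
`N = dr/dt`: here `x = dw/dr`, `φ = df/dr`, and `K₀`, `K₁` are the sectional curvatures of the
planes that contain, respectively are orthogonal to, the radial direction. -/
structure WarpedSoliton (n lam : ℝ) (w x K₀ K₁ φ N : ℝ → ℝ) : Prop where
  one_lt : 1 < n
  w_pos : ∀ t, 0 < w t
  N_pos : ∀ t, 0 < N t
  N_cont : Continuous N
  hasDerivAt_w : ∀ t, HasDerivAt w (N t * x t) t
  hasDerivAt_x : ∀ t, HasDerivAt x (-(N t * (K₀ t * w t))) t
  hasDerivAt_φ : ∀ t, HasDerivAt φ (N t * (lam - n * K₀ t)) t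
  K₁_eq : ∀ t, K₁ t = (1 - x t ^ 2) / w t ^ 2
  tangential : ∀ t, x t * φ t / w t = lam - K₀ t - (n - 1) * K₁ t

namespace WarpedSoliton

variable {n lam : ℝ} {w x K₀ K₁ φ N : ℝ → ℝ}

/-- Traversing a meridian backwards. -/
theorem reverse (S : WarpedSoliton n lam w x K₀ K₁ φ N) :
    WarpedSoliton n lam (fun t => w (-t)) (fun t => -x (-t)) (fun t => K₀ (-t))
      (fun t => K₁ (-t)) (fun t => -φ (-t)) (fun t => N (-t)) where
  one_lt := S.one_lt
  w_pos t := S.w_pos _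
  N_pos t := S.N_pos _
  N_cont := S.N_cont.comp continuous_neg
  hasDerivAt_w t := by
    have h := (S.hasDerivAt_w (-t)).scomp t (hasDerivAt_neg t)
    exact h.congr_deriv (by simp)
  hasDerivAt_x t := by
    have h := ((S.hasDerivAt_x (-t)).scomp t (hasDerivAt_neg t)).neg
    exact h.congr_deriv (by simp)
  hasDerivAt_φ t := by
    have h := ((S.hasDerivAt_φ (-t)).scomp t (hasDerivAt_neg t)).neg
    exact h.congr_deriv (by simp)
  K₁_eq t := by rw [S.K₁_eq]; ring
  tangential t := by rw [← S.tangential]; ring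

theorem hasDerivAt_K₁ (S : WarpedSoliton n lam w x K₀ K₁ φ N) (t : ℝ) :
    HasDerivAt K₁ (N t * (2 * (x t / w t) * (K₀ t - K₁ t))) t := by
  have h := (((S.hasDerivAt_x t).pow 2).const_sub 1).div ((S.hasDerivAt_w t).pow 2)
    (pow_ne_zero 2 (S.w_pos t).ne')
  have e : K₁ = fun t => (1 - x t ^ 2) / w t ^ 2 := funext S.K₁_eq
  have hw := (S.w_pos t).ne'
  rw [S.K₁_eq t, e]
  refine h.congr_deriv ?_
  simp only [Pi.pow_apply]
  field_simp
  ring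

theorem hasDerivAt_div (S : WarpedSoliton n lam w x K₀ K₁ φ N) (t : ℝ) :
    HasDerivAt (fun y => x y / w y) (N t * (-K₀ t - (x t / w t) ^ 2)) t := by
  have h := (S.hasDerivAt_x t).div (S.hasDerivAt_w t) (S.w_pos t).ne'
  have hw := (S.w_pos t).ne'
  refine h.congr_deriv ?_
  field_simp

theorem hasDerivAt_K₀ (S : WarpedSoliton n lam w x K₀ K₁ φ N) (t : ℝ) :
    HasDerivAt K₀ (N t * (φ t * K₀ t - (n - 1) * (x t / w t) * (K₀ t - K₁ t))) t := by
  have e : K₀ = fun t => lam - (n - 1) * K₁ t - x t / w t * φ t := by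
    funext t
    linear_combination S.tangential t
  have h := (((S.hasDerivAt_K₁ t).const_mul (n - 1)).const_sub lam).sub
    ((S.hasDerivAt_div t).mul (S.hasDerivAt_φ t))
  have ht : x t / w t * φ t = lam - K₀ t - (n - 1) * K₁ t := by
    rw [← S.tangential t]; ring
  have h' := h.congr_of_eventuallyEq (Filter.Eventually.of_forall (congrFun e))
  refine h'.congr_deriv ?_
  linear_combination (N t * (x t / w t)) * ht

theorem continuous_x (S : WarpedSoliton n lam w x K₀ K₁ φ N) : Continuous x :=
  continuous_iff_continuousAt.mpr fun t => (S.hasDerivAt_x t).continuousAt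

theorem continuous_w (S : WarpedSoliton n lam w x K₀ K₁ φ N) : Continuous w :=
  continuous_iff_continuousAt.mpr fun t => (S.hasDerivAt_w t).continuousAt

theorem continuous_φ (S : WarpedSoliton n lam w x K₀ K₁ φ N) : Continuous φ :=
  continuous_iff_continuousAt.mpr fun t => (S.hasDerivAt_φ t).continuousAt

theorem continuous_K₀ (S : WarpedSoliton n lam w x K₀ K₁ φ N) : Continuous K₀ :=
  continuous_iff_continuousAt.mpr fun t => (S.hasDerivAt_K₀ t).continuousAt

theorem continuous_div (S : WarpedSoliton n lam w x K₀ K₁ φ N) : Continuous fun t => x t / w t :=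
  S.continuous_x.div S.continuous_w fun t => (S.w_pos t).ne'

theorem K₁_pos_iff (S : WarpedSoliton n lam w x K₀ K₁ φ N) {t : ℝ} : 0 < K₁ t ↔ x t ^ 2 < 1 := by
  rw [S.K₁_eq, lt_div_iff₀ (pow_pos (S.w_pos t) 2), zero_mul, sub_pos]

theorem K₁_neg_iff (S : WarpedSoliton n lam w x K₀ K₁ φ N) {t : ℝ} : K₁ t < 0 ↔ 1 < x t ^ 2 := by
  rw [S.K₁_eq, div_lt_iff₀ (pow_pos (S.w_pos t) 2), zero_mul, sub_neg]

/-- The coefficients of the linear system for `K₀`, `K₁` are bounded on bounded intervals. -/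
theorem exists_bound (S : WarpedSoliton n lam w x K₀ K₁ φ N) (s a : ℝ) : ∃ C, ∀ t ∈ Set.Icc s a,
    |N t * (φ t - (n - 1) * (x t / w t))| ≤ C ∧ |N t * φ t| ≤ C ∧ |N t * (x t / w t)| ≤ C := by
  have h1 : Continuous fun t => N t * (φ t - (n - 1) * (x t / w t)) :=
    S.N_cont.mul (S.continuous_φ.sub (continuous_const.mul S.continuous_div))
  have h2 : Continuous fun t => N t * φ t := S.N_cont.mul S.continuous_φ
  have h3 : Continuous fun t => N t * (x t / w t) := S.N_cont.mul S.continuous_div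
  obtain ⟨C1, hC1⟩ := isCompact_Icc.exists_bound_of_continuousOn (s := Set.Icc s a) h1.continuousOn
  obtain ⟨C2, hC2⟩ := isCompact_Icc.exists_bound_of_continuousOn (s := Set.Icc s a) h2.continuousOn
  obtain ⟨C3, hC3⟩ := isCompact_Icc.exists_bound_of_continuousOn (s := Set.Icc s a) h3.continuousOn
  refine ⟨max C1 (max C2 C3), fun t ht => ⟨?_, ?_, ?_⟩⟩
  · exact (hC1 t ht).trans (le_max_left _ _)
  · exact (hC2 t ht).trans ((le_max_left _ _).trans (le_max_right _ _))
  · exact (hC3 t ht).trans ((le_max_right _ _).trans (le_max_right _ _))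

/-- Where the warping function increases with slope less than one, `K₀` stays positive. -/
theorem K₀_pos_of_nonneg (S : WarpedSoliton n lam w x K₀ K₁ φ N) {s a : ℝ}
    (hs : 0 < K₀ s) (hs1 : x s ≤ 1)
    (hx : ∀ t ∈ Set.Icc s a, 0 ≤ x t) : ∀ t ∈ Set.Icc s a, 0 < K₀ t := by
  obtain ⟨C, hC⟩ := S.exists_bound s a
  refine pos_of_neg_mul_le_deriv (C := C) (fun t _ => S.hasDerivAt_K₀ t) hs ?_
  intro t ht hnn
  have hanti : AntitoneOn x (Set.Icc s t) := by
    refine antitoneOn_of_deriv_nonpos (convex_Icc s t) S.continuous_x.continuousOn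
      (fun y _ => (S.hasDerivAt_x y).differentiableAt.differentiableWithinAt) fun y hy => ?_
    rw [(S.hasDerivAt_x y).deriv]
    have := mul_nonneg (S.N_pos y).le (mul_nonneg (hnn y (interior_subset hy)) (S.w_pos y).le)
    linarith
  have hxt : x t ≤ 1 := (hanti ⟨le_rfl, ht.1⟩ ⟨ht.1, le_rfl⟩ ht.1).trans hs1
  have hx0 := hx t ht
  have hK1 : 0 ≤ K₁ t := by
    rw [S.K₁_eq]
    exact div_nonneg (by nlinarith) (sq_nonneg _)
  have h1 := (abs_le.mp (hC t ht).1).1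
  have h2 : 0 ≤ N t * ((n - 1) * (x t / w t) * K₁ t) :=
    mul_nonneg (S.N_pos t).le (mul_nonneg (mul_nonneg (by linarith [S.one_lt])
      (div_nonneg hx0 (S.w_pos t).le)) hK1)
  have h3 := hnn t ⟨ht.1, le_rfl⟩
  nlinarith

/-- Where the warping function has slope at least one and `K₀ < 0`, both persist. -/
theorem one_le_of_K₀_neg (S : WarpedSoliton n lam w x K₀ K₁ φ N)
    {s a : ℝ} (hs : K₀ s < 0) (hs1 : 1 ≤ x s) (hsa : s ≤ a) : 1 ≤ x a := by
  obtain ⟨C, hC⟩ := S.exists_bound s a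
  have hmono : ∀ t ∈ Set.Icc s a, (∀ r ∈ Set.Icc s t, 0 ≤ -K₀ r) → 1 ≤ x t := by
    intro t ht hnn
    have hmono : MonotoneOn x (Set.Icc s t) := by
      refine monotoneOn_of_deriv_nonneg (convex_Icc s t) S.continuous_x.continuousOn
        (fun y _ => (S.hasDerivAt_x y).differentiableAt.differentiableWithinAt) fun y hy => ?_
      rw [(S.hasDerivAt_x y).deriv]
      have := mul_nonneg (S.N_pos y).le (mul_nonneg (hnn y (interior_subset hy)) (S.w_pos y).le)
      linarith
    exact hs1.trans (hmono ⟨le_rfl, ht.1⟩ ⟨ht.1, le_rfl⟩ ht.1)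
  have hpos := pos_of_neg_mul_le_deriv (C := C) (u := fun t => -K₀ t) (s := s) (a := a)
    (fun t _ => (S.hasDerivAt_K₀ t).neg) (by linarith) (by
      intro t ht hnn
      have hxt := hmono t ht hnn
      have hK1 : K₁ t ≤ 0 := by
        rw [S.K₁_eq]
        exact div_nonpos_of_nonpos_of_nonneg (by nlinarith) (sq_nonneg _)
      have h1 := (abs_le.mp (hC t ht).1).1
      have h2 : 0 ≤ N t * ((n - 1) * (x t / w t) * (-K₁ t)) :=
        mul_nonneg (S.N_pos t).le (mul_nonneg (mul_nonneg (by linarith [S.one_lt])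
          (div_nonneg (by linarith) (S.w_pos t).le)) (by linarith))
      have h3 := hnn t ⟨ht.1, le_rfl⟩
      nlinarith)
  exact hmono a ⟨hsa, le_rfl⟩ fun r hr => (hpos r hr).le

/-- The curvatures solve a linear system, so they do not both vanish at a point unless they vanish
identically; this is the quantitative form of it that is used. -/
theorem curvature_ne_zero (S : WarpedSoliton n lam w x K₀ K₁ φ N)
    {s a : ℝ} (hsa : a ≤ s) (ha : K₀ a ≠ 0) : K₀ s ≠ 0 ∨ K₁ s ≠ 0 := by
  obtain ⟨C, hC⟩ := S.exists_bound a s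
  have hn := S.one_lt
  have hpos := pos_of_neg_mul_le_deriv (C := 4 * (n - 1) * C + 2 * C + 8 * C)
    (u := fun t => K₀ t ^ 2 + (n - 1) / 2 * K₁ t ^ 2)
    (u' := fun t => -(2 * (n - 1) * (N t * (x t / w t)) * (K₀ t - K₁ t) ^ 2)
      + 2 * (N t * φ t) * K₀ t ^ 2) (s := a) (a := s)
    (fun t _ => by
      have h := ((S.hasDerivAt_K₀ t).pow 2).add
        (((S.hasDerivAt_K₁ t).pow 2).const_mul ((n - 1) / 2))
      exact h.congr_deriv (by ring))
    (by
      have := pow_pos (abs_pos.mpr ha) 2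
      rw [sq_abs] at this
      have h2 : 0 ≤ (n - 1) / 2 * K₁ a ^ 2 := mul_nonneg (by linarith) (sq_nonneg _)
      linarith)
    (by
      intro t ht _
      have h2 := (abs_le.mp (hC t ht).2.1).1
      have h3 := (abs_le.mp (hC t ht).2.2).2
      have hC0 : 0 ≤ C := (abs_nonneg _).trans (hC t ht).2.1
      have e1 : N t * (x t / w t) * ((n - 1) * (K₀ t - K₁ t) ^ 2)
          ≤ C * ((n - 1) * (K₀ t - K₁ t) ^ 2) :=
        mul_le_mul_of_nonneg_right h3 (mul_nonneg (by linarith) (sq_nonneg _))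
      have e2 : -C * K₀ t ^ 2 ≤ N t * φ t * K₀ t ^ 2 :=
        mul_le_mul_of_nonneg_right h2 (sq_nonneg _)
      have e3 : (K₀ t - K₁ t) ^ 2 ≤ 2 * K₀ t ^ 2 + 2 * K₁ t ^ 2 := by
        nlinarith [sq_nonneg (K₀ t + K₁ t)]
      have e4 : C * (n - 1) * (K₀ t - K₁ t) ^ 2 ≤ C * (n - 1) * (2 * K₀ t ^ 2 + 2 * K₁ t ^ 2) :=
        mul_le_mul_of_nonneg_left e3 (mul_nonneg hC0 (by linarith))
      have e5 : 0 ≤ (n - 1) * C * ((n - 1) * K₁ t ^ 2) :=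
        mul_nonneg (mul_nonneg (by linarith) hC0) (mul_nonneg (by linarith) (sq_nonneg _))
      have e6 : 0 ≤ C * ((n - 1) * K₁ t ^ 2) :=
        mul_nonneg hC0 (mul_nonneg (by linarith) (sq_nonneg _))
      have e7 : 0 ≤ C * K₀ t ^ 2 := mul_nonneg hC0 (sq_nonneg _)
      linarith) s ⟨hsa, le_rfl⟩
  by_contra hcon
  push Not at hcon
  simp only [hcon.1, hcon.2] at hpos
  norm_num at hpos

/-- Near a pole the common limit `k` of the two curvatures is positive, and up to the first critical
point `a` of the warping function both curvatures are positive. -/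
theorem pos_of_tendsto_atBot (S : WarpedSoliton n lam w x K₀ K₁ φ N) {k C : ℝ}
    (hx : Filter.Tendsto x Filter.atBot (nhds 1)) (h0 : Filter.Tendsto K₀ Filter.atBot (nhds k))
    (h1 : Filter.Tendsto K₁ Filter.atBot (nhds k)) (hφ : ∀ᶠ t in Filter.atBot, |φ t| ≤ C)
    {b : ℝ} (hb : x b ≤ 0) :
    0 < k ∧ ∃ a, x a = 0 ∧ (∀ t < a, 0 < x t) ∧ ∀ t ≤ a, 0 < K₀ t ∧ 0 < K₁ t := by
  have hn := S.one_lt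
  have hx2 : ∀ᶠ t in Filter.atBot, 1 / 2 < x t := hx.eventually (lt_mem_nhds (by norm_num))
  obtain ⟨s, hs⟩ := Filter.eventually_atBot.mp hx2
  have hsb : s ≤ b := by
    by_contra h
    have := hs b (by linarith)
    linarith
  obtain ⟨a, ha, hxa, hpos⟩ := exists_first_zero hsb S.continuous_x.continuousOn
    (by linarith [hs s le_rfl]) hb
  have hxpos : ∀ t < a, 0 < x t := by
    intro t hta
    rcases le_total t s with h | h
    · linarith [hs t h]
    · exact hpos t ⟨h, hta⟩
  have hlt : ∀ᶠ t in Filter.atBot, t < a := Filter.eventually_lt_atBot a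
  rcases lt_trichotomy k 0 with hk | hk | hk
  · -- If `k < 0`, the slope `x` exceeds one near the pole and never comes back to zero.
    exfalso
    obtain ⟨r, h0r, h1r, hra⟩ := ((h0.eventually (gt_mem_nhds hk)).and
      ((h1.eventually (gt_mem_nhds hk)).and hlt)).exists
    have h1x : 1 ≤ x r := by
      have := S.K₁_neg_iff.mp h1r
      nlinarith [hxpos r hra]
    have := S.one_le_of_K₀_neg h0r h1x hra.le
    linarith
  · -- If `k = 0`, the energy `E = K₀² + (n - 1) / 2 K₁²` tends to zero at the pole, and
    -- `E' ≤ 2 N φ K₀² ≤ 2 C N E ≤ 4 C w' E` as soon as `x ≥ 1 / 2`; hence `E` vanishes near the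
    -- pole, the curvatures vanish identically, and `x` is constant.
    exfalso
    subst hk
    have hEt : Filter.Tendsto (fun t => K₀ t ^ 2 + (n - 1) / 2 * K₁ t ^ 2) Filter.atBot
        (nhds 0) := by
      have := (h0.pow 2).add ((h1.pow 2).const_mul ((n - 1) / 2))
      simpa using this
    obtain ⟨r, hr⟩ := Filter.eventually_atBot.mp (hx2.and (hφ.and hlt))
    have hC : 0 ≤ C := (abs_nonneg _).trans (hr r le_rfl).2.1
    set E : ℝ → ℝ := fun t => K₀ t ^ 2 + (n - 1) / 2 * K₁ t ^ 2 with hE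
    have hE0 : ∀ t, 0 ≤ E t := fun t => by
      have : 0 ≤ (n - 1) / 2 * K₁ t ^ 2 := mul_nonneg (by linarith) (sq_nonneg _)
      have h2 := sq_nonneg (K₀ t)
      simp only [hE]; linarith
    have hE' : ∀ t, HasDerivAt E (-(2 * (n - 1) * (N t * (x t / w t)) * (K₀ t - K₁ t) ^ 2)
        + 2 * (N t * φ t) * K₀ t ^ 2) t := fun t => by
      have h := ((S.hasDerivAt_K₀ t).pow 2).add
        (((S.hasDerivAt_K₁ t).pow 2).const_mul ((n - 1) / 2))
      exact h.congr_deriv (by ring)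
    have hF' : ∀ t, HasDerivAt (fun y => E y * Real.exp (-(4 * C) * w y)) _ t := fun t =>
      (hE' t).mul ((S.hasDerivAt_w t).const_mul (-(4 * C))).exp
    have hanti : AntitoneOn (fun y => E y * Real.exp (-(4 * C) * w y)) (Set.Iic r) := by
      refine antitoneOn_of_deriv_nonpos (convex_Iic r)
        (fun y _ => (hF' y).continuousAt.continuousWithinAt)
        (fun y _ => (hF' y).differentiableAt.differentiableWithinAt) fun y hy => ?_
      rw [(hF' y).deriv]
      obtain ⟨hy1, hy2, hy3⟩ := hr y (interior_subset (s := Set.Iic r) hy)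
      have hN := S.N_pos y
      have e1 : 0 ≤ (n - 1) * (N y * (x y / w y)) * (K₀ y - K₁ y) ^ 2 :=
        mul_nonneg (mul_nonneg (by linarith) (mul_nonneg hN.le
          (div_nonneg (by linarith) (S.w_pos y).le))) (sq_nonneg _)
      have e2 : N y * (φ y * K₀ y ^ 2) ≤ N y * (C * E y) := by
        refine mul_le_mul_of_nonneg_left ?_ hN.le
        have i1 : φ y * K₀ y ^ 2 ≤ C * K₀ y ^ 2 :=
          mul_le_mul_of_nonneg_right (abs_le.mp hy2).2 (sq_nonneg _)
        have i2 : C * K₀ y ^ 2 ≤ C * E y := by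
          refine mul_le_mul_of_nonneg_left ?_ hC
          have : 0 ≤ (n - 1) / 2 * K₁ y ^ 2 := mul_nonneg (by linarith) (sq_nonneg _)
          simp only [hE]; linarith
        exact i1.trans i2
      have e3 : 0 ≤ C * N y * E y * (x y - 1 / 2) :=
        mul_nonneg (mul_nonneg (mul_nonneg hC hN.le) (hE0 y)) (by linarith)
      have e4 := Real.exp_pos (-(4 * C) * w y)
      have e5 : -(2 * (n - 1) * (N y * (x y / w y)) * (K₀ y - K₁ y) ^ 2)
          + 2 * (N y * φ y) * K₀ y ^ 2 + E y * (-(4 * C) * (N y * x y)) ≤ 0 := by linarith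
      have e6 := mul_nonneg (neg_nonneg.mpr e5) e4.le
      linarith
    have hEr : ∀ t ≤ r, E t = 0 := by
      intro t ht
      have hle : E t * Real.exp (-(4 * C) * w t) ≤ 0 := by
        refine ge_of_tendsto hEt ?_
        filter_upwards [Filter.eventually_le_atBot t] with y hy
        refine (hanti (hy.trans ht) ht hy).trans ?_
        have : Real.exp (-(4 * C) * w y) ≤ 1 := by
          rw [Real.exp_le_one_iff]
          have := mul_nonneg hC (S.w_pos y).le
          linarith
        simpa using mul_le_mul_of_nonneg_left this (hE0 y)
      have := hE0 t
      by_contra hne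
      have := mul_pos (lt_of_le_of_ne this (Ne.symm hne)) (Real.exp_pos (-(4 * C) * w t))
      linarith
    have hK : ∀ t ≤ r, K₀ t = 0 ∧ K₁ t = 0 := by
      intro t ht
      have h2 := hEr t ht
      have i1 : 0 ≤ (n - 1) / 2 * K₁ t ^ 2 := mul_nonneg (by linarith) (sq_nonneg _)
      have i2 := sq_nonneg (K₀ t)
      simp only [hE] at h2
      constructor
      · exact pow_eq_zero_iff two_ne_zero |>.mp (by linarith)
      · have : (n - 1) / 2 * K₁ t ^ 2 = 0 := by linarith
        rcases mul_eq_zero.mp this with h3 | h3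
        · linarith
        · exact pow_eq_zero_iff two_ne_zero |>.mp h3
    have hK0 : ∀ t, K₀ t = 0 := by
      intro t
      rcases le_total t r with h | h
      · exact (hK t h).1
      · by_contra hne
        have := S.reverse.curvature_ne_zero (s := -r) (a := -t) (by linarith) (by simpa using hne)
        simp [hK r le_rfl] at this
    have hconst := is_const_of_deriv_eq_zero (f := x)
      (fun t => (S.hasDerivAt_x t).differentiableAt)
      (fun t => by rw [(S.hasDerivAt_x t).deriv, hK0 t]; simp) r a
    have := (hr r le_rfl).1
    linarith
  · -- If `k > 0`, then `K₀` stays positive up to `a`, so `x` decreases and `K₁` stays positive too.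
    refine ⟨hk, a, hxa, hxpos, ?_⟩
    obtain ⟨r, hr⟩ := Filter.eventually_atBot.mp ((h0.eventually (lt_mem_nhds hk)).and
      ((h1.eventually (lt_mem_nhds hk)).and hlt))
    have hx0 : ∀ t ∈ Set.Icc r a, 0 ≤ x t := by
      intro t ht
      rcases ht.2.lt_or_eq with h | h
      · exact (hxpos t h).le
      · rw [h, hxa]
    have hxr : x r < 1 := by
      have := S.K₁_pos_iff.mp (hr r le_rfl).2.1
      nlinarith
    have hK := S.K₀_pos_of_nonneg (hr r le_rfl).1 hxr.le hx0
    intro t hta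
    rcases le_total t r with h | h
    · exact ⟨(hr t h).1, (hr t h).2.1⟩
    · refine ⟨hK t ⟨h, hta⟩, S.K₁_pos_iff.mpr ?_⟩
      have hanti : AntitoneOn x (Set.Icc r a) := by
        refine antitoneOn_of_deriv_nonpos (convex_Icc r a) S.continuous_x.continuousOn
          (fun y _ => (S.hasDerivAt_x y).differentiableAt.differentiableWithinAt) fun y hy => ?_
        rw [(S.hasDerivAt_x y).deriv]
        have := mul_pos (S.N_pos y) (mul_pos (hK y (interior_subset hy)) (S.w_pos y))
        linarith
      have := hanti ⟨le_rfl, h.trans hta⟩ ⟨h, hta⟩ h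
      nlinarith [hx0 t ⟨h, hta⟩]

/-- Between two critical points of the warping function its slope stays below one. -/
theorem lt_one_of_mem_Icc (S : WarpedSoliton n lam w x K₀ K₁ φ N) {a b : ℝ} (ha : x a = 0)
    (hb : x b = 0) (hK : 0 < K₀ a) : ∀ s ∈ Set.Icc a b, x s < 1 := by
  intro s hs
  by_contra hcon
  obtain ⟨m, hm, hmax⟩ := isCompact_Icc.exists_isMaxOn ⟨s, hs⟩ S.continuous_x.continuousOn
  have hm1 : 1 ≤ x m := (not_lt.mp hcon).trans (hmax hs)
  have ham : a < m := lt_of_le_of_ne hm.1 (by rintro rfl; linarith)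
  have hmb : m < b := lt_of_le_of_ne hm.2 (by rintro rfl; linarith)
  have hderiv := (hmax.isLocalMax (Icc_mem_nhds ham hmb)).hasDerivAt_eq_zero (S.hasDerivAt_x m)
  have hK0 : K₀ m = 0 := by
    have hN := (S.N_pos m).ne'
    have hw := (S.w_pos m).ne'
    simpa [hN, hw] using hderiv
  rcases hm1.lt_or_eq with h | h
  · -- At a maximal slope above one, `K₀` decreases through zero, so the slope has a minimum there.
    have hK1 : K₁ m < 0 := S.K₁_neg_iff.mpr (by nlinarith)
    have hd : N m * (φ m * K₀ m - (n - 1) * (x m / w m) * (K₀ m - K₁ m)) < 0 := by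
      have := mul_pos (S.N_pos m) (mul_pos (mul_pos (sub_pos.mpr S.one_lt)
        (div_pos (by linarith : 0 < x m) (S.w_pos m))) (neg_pos.mpr hK1))
      rw [hK0]
      linarith
    have hleft := eventually_lt_nhdsGT_of_deriv_neg (S.hasDerivAt_K₀ m) hd
    obtain ⟨y, hy, hlt⟩ := exists_lt_of_deriv_neg_right (u := fun t => -x t)
      (u' := fun t => N t * (K₀ t * w t)) hmb
      (fun y _ => (S.hasDerivAt_x y).neg.congr_deriv (by ring)) (by
        filter_upwards [hleft] with y hy
        exact mul_neg_of_pos_of_neg (S.N_pos y) (mul_neg_of_neg_of_pos (hK0 ▸ hy) (S.w_pos y)))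
    have := hmax ⟨hm.1.trans hy.1.le, hy.2⟩
    simp only [Set.mem_ofPred_eq] at this
    linarith
  · -- At a maximal slope equal to one, both curvatures vanish.
    rcases S.curvature_ne_zero hm.1 hK.ne' with h2 | h2
    · exact h2 hK0
    · exact h2 (by rw [S.K₁_eq, ← h]; simp)

/-- Where `K₀` is negative, the quantity `2 K₀ + (n - 1) K₁`, which is the scalar curvature up to a
factor `n`, is positive. Its derivative is `2 K₀ φ`, and `φ` increases there, so that it cannot have
an interior minimum. -/
theorem scalar_pos (S : WarpedSoliton n lam w x K₀ K₁ φ N) (hlam : 0 < lam) {p q : ℝ}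
    (hp : K₀ p = 0) (hq : K₀ q = 0) (hneg : ∀ t ∈ Set.Ioo p q, K₀ t < 0)
    (hK₁ : ∀ t ∈ Set.Icc p q, 0 < K₁ t) :
    ∀ t ∈ Set.Icc p q, 0 < 2 * K₀ t + (n - 1) * K₁ t := by
  intro t ht
  have hn := S.one_lt
  have hR : ∀ y, HasDerivAt (fun z => 2 * K₀ z + (n - 1) * K₁ z) (N y * (2 * K₀ y * φ y)) y := by
    intro y
    have h := ((S.hasDerivAt_K₀ y).const_mul 2).add ((S.hasDerivAt_K₁ y).const_mul (n - 1))
    exact h.congr_deriv (by ring)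
  obtain ⟨m, hm, hmin⟩ := isCompact_Icc.exists_isMinOn ⟨t, ht⟩
    (fun y _ => (hR y).continuousAt.continuousWithinAt :
      ContinuousOn (fun z => 2 * K₀ z + (n - 1) * K₁ z) (Set.Icc p q))
  have hmt : 2 * K₀ m + (n - 1) * K₁ m ≤ 2 * K₀ t + (n - 1) * K₁ t := hmin ht
  have hK1m := mul_pos (sub_pos.mpr hn) (hK₁ m hm)
  rcases hm.1.lt_or_eq with h1 | h1
  swap
  · rw [← h1] at hmt hK1m
    linarith
  rcases hm.2.lt_or_eq with h2 | h2
  swap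
  · rw [h2] at hmt hK1m
    linarith
  -- An interior minimum is impossible: `φ` vanishes there and increases.
  exfalso
  have hderiv := (hmin.isLocalMin (Icc_mem_nhds h1 h2)).hasDerivAt_eq_zero (hR m)
  have hKm := hneg m ⟨h1, h2⟩
  have hφm : φ m = 0 := by
    have hN := (S.N_pos m).ne'
    simpa [hN, hKm.ne] using hderiv
  have hφ : StrictMonoOn φ (Set.Icc m q) := by
    refine strictMonoOn_of_deriv_pos (convex_Icc m q) S.continuous_φ.continuousOn fun y hy => ?_
    rw [interior_Icc] at hy
    rw [(S.hasDerivAt_φ y).deriv]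
    have := hneg y ⟨h1.trans hy.1, hy.2⟩
    exact mul_pos (S.N_pos y) (by nlinarith)
  obtain ⟨y, hy, hlt⟩ := exists_lt_of_deriv_neg_right h2 (fun y _ => hR y) (by
    filter_upwards [Ioo_mem_nhdsGT h2] with y hy
    have e1 := hneg y ⟨h1.trans hy.1, hy.2⟩
    have e2 := hφ ⟨le_rfl, h2.le⟩ ⟨hy.1.le, hy.2.le⟩ hy.1
    rw [hφm] at e2
    exact mul_neg_of_pos_of_neg (S.N_pos y) (by nlinarith))
  have := hmin ⟨h1.le.trans hy.1.le, hy.2⟩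
  simp only [Set.mem_ofPred_eq] at this
  linarith

/-- The ratio `K₀ / K₁` has no negative minimum: at such a point the second derivative would be
negative, because the scalar curvature is positive. -/
theorem K₀_nonneg_of_mem_Icc (S : WarpedSoliton n lam w x K₀ K₁ φ N) (hlam : 0 < lam) {a b : ℝ}
    (ha : 0 < K₀ a) (hb : 0 < K₀ b) (hK₁ : ∀ t ∈ Set.Icc a b, 0 < K₁ t) :
    ∀ t ∈ Set.Icc a b, 0 ≤ K₀ t := by
  intro c hc
  by_contra hcon
  have hcon := not_le.mp hcon
  have hn := S.one_lt
  obtain ⟨q, hq, hq0, hqneg⟩ := exists_first_zero (u := fun t => -K₀ t) hc.2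
    S.continuous_K₀.neg.continuousOn (by linarith) (by linarith)
  obtain ⟨p, hp, hp0, hpneg⟩ := exists_last_zero (u := fun t => -K₀ t) hc.1
    S.continuous_K₀.neg.continuousOn (by linarith) (by linarith)
  have hneg : ∀ t ∈ Set.Ioo p q, K₀ t < 0 := by
    intro t ht
    rcases le_total t c with h | h
    · linarith [hpneg t ⟨ht.1, h⟩]
    · linarith [hqneg t ⟨h, ht.2⟩]
  have hsub : ∀ t ∈ Set.Icc p q, 0 < K₁ t := fun t ht =>
    hK₁ t ⟨hp.1.trans ht.1, ht.2.trans hq.2⟩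
  have hR := S.scalar_pos hlam (by linarith) (by linarith) hneg hsub
  -- The derivative of `K₀ / K₁` is `N Z`, and the one of `Z` at a critical point has the sign of
  -- `-2 K₀ (K₀ / K₁) (1 - K₀ / K₁)` because of the bound on the scalar curvature.
  set Z : ℝ → ℝ := fun t => φ t * (K₀ t / K₁ t)
    + x t / w t * ((1 - K₀ t / K₁ t) * (n - 1 + 2 * (K₀ t / K₁ t))) with hZ
  have hρ : ∀ y ∈ Set.Icc p q, HasDerivAt (fun t => K₀ t / K₁ t) (N y * Z y) y := by
    intro y hy
    have hK := (hsub y hy).ne'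
    have hw := (S.w_pos y).ne'
    refine ((S.hasDerivAt_K₀ y).div (S.hasDerivAt_K₁ y) hK).congr_deriv ?_
    simp only [hZ]
    field_simp
    ring
  obtain ⟨m, hm, hmin⟩ := isCompact_Icc.exists_isMinOn ⟨c, hp.2.le, hq.1.le⟩
    (fun y hy => (hρ y hy).continuousAt.continuousWithinAt :
      ContinuousOn (fun t => K₀ t / K₁ t) (Set.Icc p q))
  have hmc : K₀ m / K₁ m ≤ K₀ c / K₁ c := hmin ⟨hp.2.le, hq.1.le⟩
  have hρc : K₀ c / K₁ c < 0 := div_neg_of_neg_of_pos hcon (hsub c ⟨hp.2.le, hq.1.le⟩)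
  have hρm : K₀ m / K₁ m < 0 := hmc.trans_lt hρc
  have hpm : p < m := lt_of_le_of_ne hm.1 (by
    rintro rfl
    have : K₀ p = 0 := by linarith
    simp [this] at hρm)
  have hmq : m < q := lt_of_le_of_ne hm.2 (by
    rintro rfl
    have : K₀ m = 0 := by linarith
    simp [this] at hρm)
  have hZm : Z m = 0 := by
    have := (hmin.isLocalMin (Icc_mem_nhds hpm hmq)).hasDerivAt_eq_zero (hρ m hm)
    simpa [(S.N_pos m).ne'] using this
  have hK1m := hsub m hm
  have hK0m := hneg m ⟨hpm, hmq⟩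
  have hRm := hR m hm
  have hZ' : HasDerivAt Z (N m * (-(2 * (x m / w m) ^ 2 * ((1 - K₀ m / K₁ m)
      * (n - 1 + 2 * (K₀ m / K₁ m)))) - 2 * K₀ m * (K₀ m / K₁ m) * (1 - K₀ m / K₁ m))) m := by
    have hρ' := hρ m hm
    rw [hZm, mul_zero] at hρ'
    have h := ((S.hasDerivAt_φ m).mul hρ').add ((S.hasDerivAt_div m).mul
      ((hρ'.const_sub 1).mul ((hρ'.const_mul 2).const_add (n - 1))))
    refine h.congr_deriv ?_
    have ht := S.tangential m
    have e1 : x m / w m * φ m = lam - K₀ m - (n - 1) * K₁ m := by rw [← ht]; ring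
    have e2 : K₀ m / K₁ m * K₁ m = K₀ m := div_mul_cancel₀ _ hK1m.ne'
    simp only [hZ] at hZm
    simp only [Pi.mul_apply]
    generalize K₀ m / K₁ m = ρ at hZm e2 ⊢
    generalize x m / w m = η at hZm e1 ⊢
    linear_combination (N m * η) * hZm - (N m * ρ) * e1 + N m * (n - 1) * e2
  have hneg' : N m * (-(2 * (x m / w m) ^ 2 * ((1 - K₀ m / K₁ m)
      * (n - 1 + 2 * (K₀ m / K₁ m)))) - 2 * K₀ m * (K₀ m / K₁ m) * (1 - K₀ m / K₁ m)) < 0 := by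
    refine mul_neg_of_pos_of_neg (S.N_pos m) ?_
    have e2 : K₀ m / K₁ m * K₁ m = K₀ m := div_mul_cancel₀ _ hK1m.ne'
    have e3 : 0 < n - 1 + 2 * (K₀ m / K₁ m) := by
      have : 0 < (n - 1 + 2 * (K₀ m / K₁ m)) * K₁ m := by nlinarith
      exact pos_of_mul_pos_left this hK1m.le
    have e4 : 0 < K₀ m * (K₀ m / K₁ m) := mul_pos_of_neg_of_neg hK0m hρm
    have e5 : 0 ≤ (x m / w m) ^ 2 * ((1 - K₀ m / K₁ m) * (n - 1 + 2 * (K₀ m / K₁ m))) :=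
      mul_nonneg (sq_nonneg _) (mul_nonneg (by linarith) e3.le)
    have e6 : 0 < K₀ m * (K₀ m / K₁ m) * (1 - K₀ m / K₁ m) := mul_pos e4 (by linarith)
    linarith
  obtain ⟨y, hy, hlt⟩ := exists_lt_of_deriv_pos_left hpm
    (fun y hy => hρ y ⟨hy.1, hy.2.trans hm.2⟩) (by
      filter_upwards [eventually_gt_nhdsLT_of_deriv_neg hZ' hneg'] with y hy
      exact mul_pos (S.N_pos y) (hZm ▸ hy))
  have := hmin ⟨hy.1, hy.2.le.trans hm.2⟩
  simp only [Set.mem_ofPred_eq] at this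
  linarith

/-- A warped product soliton which closes up smoothly at both ends has positive curvature,
including the limits `k`, `l` of the curvature at the two poles. -/
theorem curvature_pos (S : WarpedSoliton n lam w x K₀ K₁ φ N) (hlam : 0 < lam) {k l C : ℝ}
    (hx : Filter.Tendsto x Filter.atBot (nhds 1)) (h0 : Filter.Tendsto K₀ Filter.atBot (nhds k))
    (h1 : Filter.Tendsto K₁ Filter.atBot (nhds k)) (hφ : ∀ᶠ t in Filter.atBot, |φ t| ≤ C)
    (hx' : Filter.Tendsto x Filter.atTop (nhds (-1)))
    (h0' : Filter.Tendsto K₀ Filter.atTop (nhds l))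
    (h1' : Filter.Tendsto K₁ Filter.atTop (nhds l)) (hφ' : ∀ᶠ t in Filter.atTop, |φ t| ≤ C) :
    0 < k ∧ ∀ t, 0 < K₀ t ∧ 0 < K₁ t := by
  obtain ⟨t₀, ht₀⟩ := (hx.eventually (lt_mem_nhds (show (0 : ℝ) < 1 by norm_num))).exists
  obtain ⟨t₁, ht₁⟩ := (hx'.eventually (gt_mem_nhds (show (-1 : ℝ) < 0 by norm_num))).exists
  obtain ⟨hk, a, hxa, hxpos, hKa⟩ := S.pos_of_tendsto_atBot hx h0 h1 hφ ht₁.le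
  have hneg := Filter.tendsto_neg_atBot_atTop (G := ℝ)
  obtain ⟨-, b', hxb, hxneg, hKb⟩ := S.reverse.pos_of_tendsto_atBot (b := -t₀)
    (by simpa using (hx'.comp hneg).neg) (h0'.comp hneg) (h1'.comp hneg)
    (by simpa using hneg.eventually hφ') (by simpa using ht₀.le)
  set b := -b' with hbdef
  have hxb : x b = 0 := by simpa using hxb
  have hxneg : ∀ t, b < t → x t < 0 := fun t ht => by
    have := hxneg (-t) (by linarith)
    simpa using this
  have hKb : ∀ t, b ≤ t → 0 < K₀ t ∧ 0 < K₁ t := fun t ht => by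
    have := hKb (-t) (by linarith)
    simpa using this
  have hab : a ≤ b := by
    by_contra h
    have := hxneg a (not_le.mp h)
    linarith
  have hK1 : ∀ t ∈ Set.Icc a b, 0 < K₁ t := by
    intro t ht
    have i1 := S.lt_one_of_mem_Icc hxa hxb (hKa a le_rfl).1 t ht
    have i2 := S.reverse.lt_one_of_mem_Icc (a := -b) (b := -a) (by simpa using hxb)
      (by simpa using hxa) (by simpa using (hKb b le_rfl).1) (-t)
      ⟨by linarith [ht.2], by linarith [ht.1]⟩
    simp only [neg_neg] at i2
    exact S.K₁_pos_iff.mpr (by nlinarith)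
  have hK0 := S.K₀_nonneg_of_mem_Icc hlam (hKa a le_rfl).1 (hKb b le_rfl).1 hK1
  -- Otherwise `x` would decrease strictly from zero at `a` and could not return to zero at `b`.
  have hab' : a = b := by
    by_contra hne
    have hlt : a < b := lt_of_le_of_ne hab hne
    have hanti : AntitoneOn x (Set.Icc a b) := by
      refine antitoneOn_of_deriv_nonpos (convex_Icc a b) S.continuous_x.continuousOn
        (fun y _ => (S.hasDerivAt_x y).differentiableAt.differentiableWithinAt) fun y hy => ?_
      rw [(S.hasDerivAt_x y).deriv]
      have := mul_nonneg (S.N_pos y).le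
        (mul_nonneg (hK0 y (interior_subset hy)) (S.w_pos y).le)
      linarith
    have hd : -(N a * (K₀ a * w a)) < 0 :=
      neg_neg_of_pos (mul_pos (S.N_pos a) (mul_pos (hKa a le_rfl).1 (S.w_pos a)))
    obtain ⟨y, hy, hyab⟩ := ((eventually_lt_nhdsGT_of_deriv_neg (S.hasDerivAt_x a) hd).and
      (Ioo_mem_nhdsGT hlt)).exists
    have := hanti ⟨hyab.1.le, hyab.2.le⟩ ⟨hab, le_rfl⟩ hyab.2.le
    linarith
  refine ⟨hk, fun t => ?_⟩
  rcases le_total t a with h | h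
  · exact hKa t h
  · exact hKb t (hab' ▸ h)

/-- A warped product soliton is determined by its warping function and its radial parameter. -/
theorem eq_of_eq {x' K₀' K₁' φ' : ℝ → ℝ} (S : WarpedSoliton n lam w x K₀ K₁ φ N)
    (S' : WarpedSoliton n lam w x' K₀' K₁' φ' N) :
    x = x' ∧ K₀ = K₀' ∧ K₁ = K₁' ∧ ∀ t, x t ≠ 0 → φ t = φ' t := by
  have hx : x = x' := funext fun t =>
    mul_left_cancel₀ (S.N_pos t).ne' ((S.hasDerivAt_w t).unique (S'.hasDerivAt_w t))
  subst hx
  have h0 : K₀ = K₀' := funext fun t => mul_right_cancel₀ (S.w_pos t).ne'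
    (mul_left_cancel₀ (S.N_pos t).ne'
      (neg_injective ((S.hasDerivAt_x t).unique (S'.hasDerivAt_x t))))
  have h1 : K₁ = K₁' := funext fun t => (S.K₁_eq t).trans (S'.K₁_eq t).symm
  subst h0 h1
  refine ⟨rfl, rfl, rfl, fun t ht => ?_⟩
  have h2 := (S.tangential t).trans (S'.tangential t).symm
  exact mul_left_cancel₀ ht ((div_left_inj' (S.w_pos t).ne').mp h2)

end WarpedSoliton

/-! ### Connections and curvature under a change of coordinates -/

namespace LocalGeometry

section Abstract

variable {E : Type*} [NormedAddCommGroup E] [NormedSpace ℝ E]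

/-- The defining property of the Levi-Civita connection at the point `y`: the Koszul formula for
the constant vector fields `u`, `v`, `w`. -/
def IsKoszulAt (g : E → E →L[ℝ] E →L[ℝ] ℝ) (Γ : E →L[ℝ] E →L[ℝ] E) (y : E) : Prop :=
  ∀ u v w, 2 * g y (Γ u v) w = fderiv ℝ g y u v w + fderiv ℝ g y v u w - fderiv ℝ g y w u v

/-- The curvature `R(u, v)w` of the connection `∇_u v = D_u v + Γ(u, v)`. -/
def connectionCurvature (Γ : E → E →L[ℝ] E →L[ℝ] E) (y u v w : E) : E :=
  fderiv ℝ Γ y u v w - fderiv ℝ Γ y v u w + Γ y u (Γ y v w) - Γ y v (Γ y u w)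

/-- The pullback of a bilinear form under a linear map. -/
def pullbackBilin (B : E →L[ℝ] E →L[ℝ] ℝ) (A : E →L[ℝ] E) : E →L[ℝ] E →L[ℝ] ℝ :=
  B.bilinearComp A A

theorem IsKoszulAt.unique {g : E → E →L[ℝ] E →L[ℝ] ℝ} {Γ Γ' : E →L[ℝ] E →L[ℝ] E} {y : E}
    (h : IsKoszulAt g Γ y) (h' : IsKoszulAt g Γ' y) (hnd : ∀ a, (∀ b, g y a b = 0) → a = 0) :
    Γ = Γ' := by
  ext u v : 2
  rw [← sub_eq_zero]
  refine hnd _ fun b => ?_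
  have h1 := h u v b
  have h2 := h' u v b
  rw [map_sub, sub_apply]
  linarith

/-- The transformation law of the Levi-Civita connection. -/
theorem fderiv_connection_eq {g g' : E → E →L[ℝ] E →L[ℝ] ℝ} {Γ Γ' : E →L[ℝ] E →L[ℝ] E}
    {ψ : E → E} {y : E} (hψ : ContDiffAt ℝ 2 ψ y)
    (hg : g =ᶠ[nhds y] fun z => pullbackBilin (g' (ψ z)) (fderiv ℝ ψ z))
    (hg' : DifferentiableAt ℝ g' (ψ y)) (hsymm : ∀ a b, g' (ψ y) a b = g' (ψ y) b a)
    (hnd : ∀ a, (∀ b, g' (ψ y) a b = 0) → a = 0) (hsurj : Function.Surjective (fderiv ℝ ψ y))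
    (hΓ : IsKoszulAt g Γ y) (hΓ' : IsKoszulAt g' Γ' (ψ y)) (u v : E) :
    fderiv ℝ ψ y (Γ u v) = fderiv ℝ (fderiv ℝ ψ) y u v
      + Γ' (fderiv ℝ ψ y u) (fderiv ℝ ψ y v) := by
  have hψ1 : DifferentiableAt ℝ ψ y := hψ.differentiableAt (by norm_num)
  have hψ2 : DifferentiableAt ℝ (fderiv ℝ ψ) y :=
    (hψ.fderiv_right (m := 1) (by norm_num)).differentiableAt (by norm_num)
  have hB : ∀ a b, fderiv ℝ (fderiv ℝ ψ) y a b = fderiv ℝ (fderiv ℝ ψ) y b a :=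
    fun a b => (hψ.isSymmSndFDerivAt (by simp)).eq a b
  have hdiff : DifferentiableAt ℝ g y := by
    refine DifferentiableAt.congr_of_eventuallyEq ?_ hg
    have h1 : DifferentiableAt ℝ (fun z => g' (ψ z)) y :=
      (hg'.hasFDerivAt.comp y hψ1.hasFDerivAt).differentiableAt
    have : (fun z => pullbackBilin (g' (ψ z)) (fderiv ℝ ψ z)) = fun z =>
        ((ContinuousLinearMap.compL ℝ E E ℝ).flip (fderiv ℝ ψ z)).comp
          ((g' (ψ z)).comp (fderiv ℝ ψ z)) := by
      funext z; ext a b; rfl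
    rw [this]
    exact (((ContinuousLinearMap.compL ℝ E E ℝ).flip.differentiableAt).comp y hψ2).clm_comp
      (h1.clm_comp hψ2)
  have hD : ∀ a b c, fderiv ℝ g y a b c =
      fderiv ℝ g' (ψ y) (fderiv ℝ ψ y a) (fderiv ℝ ψ y b) (fderiv ℝ ψ y c)
        + g' (ψ y) (fderiv ℝ (fderiv ℝ ψ) y a b) (fderiv ℝ ψ y c)
        + g' (ψ y) (fderiv ℝ ψ y b) (fderiv ℝ (fderiv ℝ ψ) y a c) := by
    intro a b c
    have h1 : HasFDerivAt (fun z => g z b c) _ y :=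
      (hdiff.hasFDerivAt.clm_apply (hasFDerivAt_const b y)).clm_apply (hasFDerivAt_const c y)
    have h2 : HasFDerivAt (fun z => g' (ψ z) (fderiv ℝ ψ z b) (fderiv ℝ ψ z c)) _ y :=
      ((hg'.hasFDerivAt.comp y hψ1.hasFDerivAt).clm_apply
        (hψ2.hasFDerivAt.clm_apply (hasFDerivAt_const b y))).clm_apply
        (hψ2.hasFDerivAt.clm_apply (hasFDerivAt_const c y))
    have heq : (fun z => g z b c) =ᶠ[nhds y]
        fun z => g' (ψ z) (fderiv ℝ ψ z b) (fderiv ℝ ψ z c) := by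
      filter_upwards [hg] with z hz
      rw [hz]
      rfl
    have h3 := congrArg (fun L : E →L[ℝ] ℝ => L a) (h1.unique (h2.congr_of_eventuallyEq heq))
    simp at h3
    linarith
  have hgy := hg.eq_of_nhds
  rw [← sub_eq_zero]
  refine hnd _ fun b => ?_
  obtain ⟨w, rfl⟩ := hsurj b
  have h1 := hΓ u v w
  have h2 := hΓ' (fderiv ℝ ψ y u) (fderiv ℝ ψ y v) (fderiv ℝ ψ y w)
  have h3 : g y (Γ u v) w = g' (ψ y) (fderiv ℝ ψ y (Γ u v)) (fderiv ℝ ψ y w) := by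
    rw [hgy]; rfl
  rw [h3, hD, hD, hD, hB v u, hB w u, hB w v, hsymm (fderiv ℝ ψ y v),
    hsymm (fderiv ℝ ψ y u) (fderiv ℝ (fderiv ℝ ψ) y v w)] at h1
  simp only [map_sub, map_add, sub_apply, add_apply]
  linarith

/-- Curvature is tensorial: connections that are related by the transformation law under `ψ` have
curvatures that correspond under the derivative of `ψ`. -/
theorem fderiv_connectionCurvature {Γ Γ' : E → E →L[ℝ] E →L[ℝ] E} {ψ : E → E} {y : E}
    (hψ : ContDiffAt ℝ 3 ψ y) (hΓ : DifferentiableAt ℝ Γ y) (hΓ' : DifferentiableAt ℝ Γ' (ψ y))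
    (h : ∀ᶠ z in nhds y, ∀ u v, fderiv ℝ ψ z (Γ z u v) = fderiv ℝ (fderiv ℝ ψ) z u v
      + Γ' (ψ z) (fderiv ℝ ψ z u) (fderiv ℝ ψ z v)) (u v w : E) :
    fderiv ℝ ψ y (connectionCurvature Γ y u v w) = connectionCurvature Γ' (ψ y)
      (fderiv ℝ ψ y u) (fderiv ℝ ψ y v) (fderiv ℝ ψ y w) := by
  have hψ1 : DifferentiableAt ℝ ψ y := hψ.differentiableAt (by norm_num)
  have hψ' : ContDiffAt ℝ 2 (fderiv ℝ ψ) y := hψ.fderiv_right (m := 2) (by norm_num)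
  have hψ2 : DifferentiableAt ℝ (fderiv ℝ ψ) y := hψ'.differentiableAt (by norm_num)
  have hψ3 : DifferentiableAt ℝ (fderiv ℝ (fderiv ℝ ψ)) y :=
    (hψ'.fderiv_right (m := 1) (by norm_num)).differentiableAt (by norm_num)
  have hB : ∀ a b, fderiv ℝ (fderiv ℝ ψ) y a b = fderiv ℝ (fderiv ℝ ψ) y b a :=
    fun a b => ((hψ.of_le (by norm_num)).isSymmSndFDerivAt (n := 2) (by simp)).eq a b
  have hC : ∀ a b, fderiv ℝ (fderiv ℝ (fderiv ℝ ψ)) y a b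
      = fderiv ℝ (fderiv ℝ (fderiv ℝ ψ)) y b a :=
    fun a b => (hψ'.isSymmSndFDerivAt (by simp)).eq a b
  have key : ∀ a b c, fderiv ℝ (fderiv ℝ ψ) y a (Γ y b c) + fderiv ℝ ψ y (fderiv ℝ Γ y a b c)
      = fderiv ℝ (fderiv ℝ (fderiv ℝ ψ)) y a b c
        + (fderiv ℝ Γ' (ψ y) (fderiv ℝ ψ y a) (fderiv ℝ ψ y b) (fderiv ℝ ψ y c)
          + Γ' (ψ y) (fderiv ℝ (fderiv ℝ ψ) y a b) (fderiv ℝ ψ y c)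
          + Γ' (ψ y) (fderiv ℝ ψ y b) (fderiv ℝ (fderiv ℝ ψ) y a c)) := by
    intro a b c
    have h1 : HasFDerivAt (fun z => fderiv ℝ ψ z (Γ z b c)) _ y :=
      hψ2.hasFDerivAt.clm_apply
        ((hΓ.hasFDerivAt.clm_apply (hasFDerivAt_const b y)).clm_apply (hasFDerivAt_const c y))
    have h2 : HasFDerivAt (fun z => fderiv ℝ (fderiv ℝ ψ) z b c
        + Γ' (ψ z) (fderiv ℝ ψ z b) (fderiv ℝ ψ z c)) _ y :=
      ((hψ3.hasFDerivAt.clm_apply (hasFDerivAt_const b y)).clm_apply (hasFDerivAt_const c y)).add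
        (((hΓ'.hasFDerivAt.comp y hψ1.hasFDerivAt).clm_apply
          (hψ2.hasFDerivAt.clm_apply (hasFDerivAt_const b y))).clm_apply
          (hψ2.hasFDerivAt.clm_apply (hasFDerivAt_const c y)))
    have heq : (fun z => fderiv ℝ ψ z (Γ z b c)) =ᶠ[nhds y] fun z =>
        fderiv ℝ (fderiv ℝ ψ) z b c + Γ' (ψ z) (fderiv ℝ ψ z b) (fderiv ℝ ψ z c) := by
      filter_upwards [h] with z hz
      exact hz b c
    have h3 := congrArg (fun L : E →L[ℝ] E => L a) (h1.unique (h2.congr_of_eventuallyEq heq))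
    simp at h3
    rw [add_comm, h3]
    abel
  have hy := h.self_of_nhds
  have k1 := key u v w
  have k2 := key v u w
  simp only [connectionCurvature, map_add, map_sub]
  rw [hy u, hy v, hy v, hy u]
  simp only [map_add]
  rw [hB v u, hC v u] at k2
  linear_combination (norm := module) k1 - k2

end Abstract

/-! ### The connection and the curvature in terms of their components -/

variable {m : ℕ}

theorem sum_apply_smul_single (v : EuclideanSpace ℝ (Fin m)) :
    ∑ i, v i • EuclideanSpace.single i (1 : ℝ) = v := by
  ext j
  simp [Pi.single_apply]

/-- The bilinear form with matrix `A`. -/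
def matrixForm (A : Matrix (Fin m) (Fin m) ℝ) :
    EuclideanSpace ℝ (Fin m) →L[ℝ] EuclideanSpace ℝ (Fin m) →L[ℝ] ℝ :=
  ∑ i, ∑ j, A i j • (EuclideanSpace.proj (𝕜 := ℝ) i : EuclideanSpace ℝ (Fin m) →L[ℝ] ℝ).smulRight
    (EuclideanSpace.proj (𝕜 := ℝ) j : EuclideanSpace ℝ (Fin m) →L[ℝ] ℝ)

theorem matrixForm_apply (A : Matrix (Fin m) (Fin m) ℝ) (u v : EuclideanSpace ℝ (Fin m)) :
    matrixForm A u v = ∑ i, ∑ j, A i j * (u i * v j) := by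
  simp [matrixForm]

theorem matrixForm_single (A : Matrix (Fin m) (Fin m) ℝ) (i j : Fin m) :
    matrixForm A (EuclideanSpace.single i 1) (EuclideanSpace.single j 1) = A i j := by
  simp [matrixForm_apply]

theorem matrixForm_apply_single (A : Matrix (Fin m) (Fin m) ℝ) (u : EuclideanSpace ℝ (Fin m))
    (j : Fin m) : matrixForm A u (EuclideanSpace.single j 1) = ∑ i, A i j * u i := by
  simp [matrixForm_apply]

theorem matrixForm_self_pos {A : Matrix (Fin m) (Fin m) ℝ} (hA : A.PosDef)
    {u : EuclideanSpace ℝ (Fin m)} (hu : u ≠ 0) : 0 < matrixForm A u u := by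
  have h := hA.dotProduct_mulVec_pos (x := (u : Fin m → ℝ))
    (fun h => hu (by ext i; exact congrFun h i))
  refine h.trans_eq ?_
  simp only [matrixForm_apply, dotProduct, Matrix.mulVec, Finset.mul_sum]
  refine Finset.sum_congr rfl fun i _ => Finset.sum_congr rfl fun j _ => ?_
  simp
  ring

theorem matrixForm_nondegenerate {A : Matrix (Fin m) (Fin m) ℝ} (hA : A.PosDef)
    (u : EuclideanSpace ℝ (Fin m)) (hu : ∀ v, matrixForm A u v = 0) : u = 0 := by
  by_contra h
  exact (matrixForm_self_pos hA h).ne' (hu u)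

theorem matrixForm_symm {A : Matrix (Fin m) (Fin m) ℝ} (hA : A.PosDef)
    (u v : EuclideanSpace ℝ (Fin m)) : matrixForm A u v = matrixForm A v u := by
  have h : ∀ i j, A i j = A j i := fun i j => by simpa using (hA.1.apply i j).symm
  rw [matrixForm_apply, matrixForm_apply, Finset.sum_comm]
  refine Finset.sum_congr rfl fun i _ => Finset.sum_congr rfl fun j _ => ?_
  rw [h]; ring

/-- Two bilinear forms with the same values on the standard basis agree. -/
theorem bilin_ext {B B' : EuclideanSpace ℝ (Fin m) →L[ℝ] EuclideanSpace ℝ (Fin m) →L[ℝ] ℝ}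
    (h : ∀ i j, B (EuclideanSpace.single i 1) (EuclideanSpace.single j 1)
      = B' (EuclideanSpace.single i 1) (EuclideanSpace.single j 1)) : B = B' := by
  ext u v
  rw [← sum_apply_smul_single u, ← sum_apply_smul_single v]
  simp only [map_sum, map_smul, sum_apply, smul_apply, h]

/-- Two trilinear forms with the same values on the standard basis agree. -/
theorem trilin_ext {T T' : EuclideanSpace ℝ (Fin m) →L[ℝ] EuclideanSpace ℝ (Fin m) →L[ℝ]
    EuclideanSpace ℝ (Fin m) →L[ℝ] ℝ}
    (h : ∀ i j k, T (EuclideanSpace.single i 1) (EuclideanSpace.single j 1)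
      (EuclideanSpace.single k 1) = T' (EuclideanSpace.single i 1) (EuclideanSpace.single j 1)
      (EuclideanSpace.single k 1)) : T = T' := by
  ext u : 1
  refine bilin_ext fun i j => ?_
  rw [← sum_apply_smul_single u]
  simp only [map_sum, map_smul, sum_apply, smul_apply, h]

/-- The entries of `G` are smooth at `y`, and `G y` is positive definite. -/
def IsMetricAt (G : EuclideanSpace ℝ (Fin m) → Matrix (Fin m) (Fin m) ℝ)
    (y : EuclideanSpace ℝ (Fin m)) : Prop :=
  (∀ i j, ContDiffAt ℝ ∞ (fun z => G z i j) y) ∧ (G y).PosDef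

/-- The connection with the Christoffel symbols of `G` as components. -/
def connection (G : EuclideanSpace ℝ (Fin m) → Matrix (Fin m) (Fin m) ℝ)
    (y : EuclideanSpace ℝ (Fin m)) : EuclideanSpace ℝ (Fin m) →L[ℝ]
      EuclideanSpace ℝ (Fin m) →L[ℝ] EuclideanSpace ℝ (Fin m) :=
  ∑ i, ∑ j, ∑ k, christoffel G k i j y •
    (EuclideanSpace.proj (𝕜 := ℝ) i : EuclideanSpace ℝ (Fin m) →L[ℝ] ℝ).smulRight
      ((EuclideanSpace.proj (𝕜 := ℝ) j : EuclideanSpace ℝ (Fin m) →L[ℝ] ℝ).smulRight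
        (EuclideanSpace.single k (1 : ℝ)))

theorem connection_apply (G : EuclideanSpace ℝ (Fin m) → Matrix (Fin m) (Fin m) ℝ)
    (y u v : EuclideanSpace ℝ (Fin m)) : connection G y u v =
      ∑ i, ∑ j, ∑ k, christoffel G k i j y • u i • v j • EuclideanSpace.single k (1 : ℝ) := by
  simp [connection]

theorem connection_single (G : EuclideanSpace ℝ (Fin m) → Matrix (Fin m) (Fin m) ℝ)
    (y : EuclideanSpace ℝ (Fin m)) (i j k : Fin m) :
    connection G y (EuclideanSpace.single i 1) (EuclideanSpace.single j 1) k
      = christoffel G k i j y := by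
  rw [connection_apply]
  simp [Pi.single_apply]

theorem contDiffAt_matrixForm {G : EuclideanSpace ℝ (Fin m) → Matrix (Fin m) (Fin m) ℝ}
    {y : EuclideanSpace ℝ (Fin m)} (h : ∀ i j, ContDiffAt ℝ ∞ (fun z => G z i j) y) :
    ContDiffAt ℝ ∞ (fun z => matrixForm (G z)) y := by
  unfold matrixForm
  exact ContDiffAt.sum fun i _ => ContDiffAt.sum fun j _ => (h i j).smul contDiffAt_const

theorem contDiffAt_det {k : ℕ} {A : EuclideanSpace ℝ (Fin m) → Matrix (Fin k) (Fin k) ℝ}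
    {y : EuclideanSpace ℝ (Fin m)} (h : ∀ i j, ContDiffAt ℝ ∞ (fun z => A z i j) y) :
    ContDiffAt ℝ ∞ (fun z => (A z).det) y := by
  simp only [Matrix.det_apply']
  exact ContDiffAt.sum fun σ _ => contDiffAt_const.mul (contDiffAt_prod fun i _ => h _ _)

theorem contDiffAt_inv {G : EuclideanSpace ℝ (Fin m) → Matrix (Fin m) (Fin m) ℝ}
    {y : EuclideanSpace ℝ (Fin m)} (h : IsMetricAt G y) (k l : Fin m) :
    ContDiffAt ℝ ∞ (fun z => (G z)⁻¹ k l) y := by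
  have hdet : (G y).det ≠ 0 := h.2.det_pos.ne'
  have e : (fun z => (G z)⁻¹ k l) = fun z => ((G z).det)⁻¹ * (G z).adjugate k l := by
    funext z
    rw [Matrix.inv_def]
    simp [Ring.inverse_eq_inv']
  rw [e]
  refine ((contDiffAt_det h.1).inv hdet).mul ?_
  simp only [Matrix.adjugate_apply]
  refine contDiffAt_det fun i j => ?_
  by_cases hi : i = l
  · subst hi
    simpa using contDiffAt_const
  · simpa [Matrix.updateRow_ne hi] using h.1 i j

theorem contDiffAt_partialDeriv {F : EuclideanSpace ℝ (Fin m) → ℝ} {y : EuclideanSpace ℝ (Fin m)}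
    (h : ContDiffAt ℝ ∞ F y) (i : Fin m) : ContDiffAt ℝ ∞ (partialDeriv i F) y :=
  (h.fderiv_right (m := ∞) (by simp)).clm_apply contDiffAt_const

theorem contDiffAt_christoffel {G : EuclideanSpace ℝ (Fin m) → Matrix (Fin m) (Fin m) ℝ}
    {y : EuclideanSpace ℝ (Fin m)} (h : IsMetricAt G y) (k i j : Fin m) :
    ContDiffAt ℝ ∞ (christoffel G k i j) y := by
  refine contDiffAt_const.mul (ContDiffAt.sum fun l _ => (contDiffAt_inv h k l).mul ?_)
  exact ((contDiffAt_partialDeriv (h.1 j l) i).add (contDiffAt_partialDeriv (h.1 i l) j)).sub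
    (contDiffAt_partialDeriv (h.1 i j) l)

theorem contDiffAt_connection {G : EuclideanSpace ℝ (Fin m) → Matrix (Fin m) (Fin m) ℝ}
    {y : EuclideanSpace ℝ (Fin m)} (h : IsMetricAt G y) : ContDiffAt ℝ ∞ (connection G) y := by
  unfold connection
  exact ContDiffAt.sum fun i _ => ContDiffAt.sum fun j _ => ContDiffAt.sum fun k _ =>
    (contDiffAt_christoffel h k i j).smul contDiffAt_const

theorem fderiv_matrixForm_single {G : EuclideanSpace ℝ (Fin m) → Matrix (Fin m) (Fin m) ℝ}
    {y : EuclideanSpace ℝ (Fin m)} (h : IsMetricAt G y) (l i j : Fin m) :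
    fderiv ℝ (fun z => matrixForm (G z)) y (EuclideanSpace.single l 1) (EuclideanSpace.single i 1)
      (EuclideanSpace.single j 1) = partialDeriv l (fun z => G z i j) y := by
  have hd := (contDiffAt_matrixForm h.1).differentiableAt (by simp)
  have h1 : HasFDerivAt (fun z => matrixForm (G z) (EuclideanSpace.single i 1)
      (EuclideanSpace.single j 1)) _ y :=
    (hd.hasFDerivAt.clm_apply (hasFDerivAt_const _ y)).clm_apply (hasFDerivAt_const _ y)
  simp only [matrixForm_single] at h1
  rw [partialDeriv, h1.fderiv]
  simp

theorem isKoszulAt_connection {G : EuclideanSpace ℝ (Fin m) → Matrix (Fin m) (Fin m) ℝ}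
    {y : EuclideanSpace ℝ (Fin m)} (h : IsMetricAt G y) :
    IsKoszulAt (fun z => matrixForm (G z)) (connection G y) y := by
  have hdet : IsUnit (G y).det := h.2.det_pos.ne'.isUnit
  have hsym : ∀ i j, G y i j = G y j i := fun i j => by simpa using (h.2.1.apply i j).symm
  -- It suffices to treat the standard basis vectors.
  have key : ∀ i j l, 2 * matrixForm (G y) (connection G y (EuclideanSpace.single i 1)
      (EuclideanSpace.single j 1)) (EuclideanSpace.single l 1)
      = partialDeriv i (fun z => G z j l) y + partialDeriv j (fun z => G z i l) y
        - partialDeriv l (fun z => G z i j) y := by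
    intro i j l
    rw [matrixForm_apply_single]
    simp only [connection_single, christoffel]
    set b : Fin m → ℝ := fun l => partialDeriv i (fun z => G z j l) y
      + partialDeriv j (fun z => G z i l) y - partialDeriv l (fun z => G z i j) y with hb
    have h1 : (G y).mulVec ((G y)⁻¹.mulVec b) l = b l := by
      rw [Matrix.mulVec_mulVec, Matrix.mul_nonsing_inv _ hdet, Matrix.one_mulVec]
    simp only [Matrix.mulVec, dotProduct] at h1
    change _ = b l
    rw [← h1, Finset.mul_sum]
    refine Finset.sum_congr rfl fun k _ => ?_
    rw [hsym k l]
    ring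
  set D := fderiv ℝ (fun z => matrixForm (G z)) y with hD
  have hT : (2 : ℝ) • (ContinuousLinearMap.compL ℝ _ _ _ (matrixForm (G y))).comp (connection G y)
      = D + D.flip - (ContinuousLinearMap.flipₗᵢ ℝ _ _ _).toContinuousLinearEquiv.toContinuousLinearMap.comp
        D.flip := by
    refine trilin_ext fun i j l => ?_
    have h1 := key i j l
    rw [← fderiv_matrixForm_single h, ← fderiv_matrixForm_single h,
      ← fderiv_matrixForm_single h] at h1
    simpa using h1
  intro u v w
  have := congrArg (fun T => T u v w) hT
  simpa using this

theorem riemannUp_eq {G : EuclideanSpace ℝ (Fin m) → Matrix (Fin m) (Fin m) ℝ}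
    {y : EuclideanSpace ℝ (Fin m)} (h : IsMetricAt G y) (i j k l : Fin m) :
    riemannUp G i j k l y = connectionCurvature (connection G) y (EuclideanSpace.single i 1)
      (EuclideanSpace.single j 1) (EuclideanSpace.single k 1) l := by
  have hd := (contDiffAt_connection h).differentiableAt (by simp)
  have h1 : ∀ i j k, fderiv ℝ (connection G) y (EuclideanSpace.single i 1)
      (EuclideanSpace.single j 1) (EuclideanSpace.single k 1) l
      = partialDeriv i (christoffel G l j k) y := by
    intro i j k
    have h2 := (EuclideanSpace.proj (𝕜 := ℝ) l : EuclideanSpace ℝ (Fin m) →L[ℝ] ℝ).hasFDerivAt.comp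
      y
      ((hd.hasFDerivAt.clm_apply (hasFDerivAt_const (EuclideanSpace.single j 1) y)).clm_apply
        (hasFDerivAt_const (EuclideanSpace.single k 1) y))
    have e : (⇑(EuclideanSpace.proj (𝕜 := ℝ) l : EuclideanSpace ℝ (Fin m) →L[ℝ] ℝ) ∘ fun z =>
        connection G z (EuclideanSpace.single j 1) (EuclideanSpace.single k 1))
        = christoffel G l j k := by
      funext z
      exact connection_single G z j k l
    rw [e] at h2
    rw [partialDeriv, h2.fderiv]
    simp
  have h2 : ∀ i j k, connection G y (EuclideanSpace.single i 1)
      (connection G y (EuclideanSpace.single j 1) (EuclideanSpace.single k 1)) l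
      = ∑ q, christoffel G l i q y * christoffel G q j k y := by
    intro i j k
    conv_lhs => rw [← sum_apply_smul_single (connection G y (EuclideanSpace.single j 1)
      (EuclideanSpace.single k 1))]
    simp only [map_sum, map_smul, connection_single]
    simp [connection_single, mul_comm]
  simp only [riemannUp, connectionCurvature, PiLp.add_apply, PiLp.sub_apply, h1, h2,
    Finset.sum_sub_distrib]
  ring

/-- The curvature tensor `g(R(u, v)w, z)`. -/
def curvatureTensor (G : EuclideanSpace ℝ (Fin m) → Matrix (Fin m) (Fin m) ℝ)
    (y u v w z : EuclideanSpace ℝ (Fin m)) : ℝ :=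
  matrixForm (G y) (connectionCurvature (connection G) y u v w) z

theorem riemann_eq {G : EuclideanSpace ℝ (Fin m) → Matrix (Fin m) (Fin m) ℝ}
    {y : EuclideanSpace ℝ (Fin m)} (h : IsMetricAt G y) (i j k l : Fin m) :
    riemann G i j k l y = curvatureTensor G y (EuclideanSpace.single i 1)
      (EuclideanSpace.single j 1) (EuclideanSpace.single k 1) (EuclideanSpace.single l 1) := by
  have hsym : ∀ i j, G y i j = G y j i := fun i j => by simpa using (h.2.1.apply i j).symm
  rw [curvatureTensor, matrixForm_apply_single]
  simp only [riemann, riemannUp_eq h, hsym l]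

theorem hessian_eq {G : EuclideanSpace ℝ (Fin m) → Matrix (Fin m) (Fin m) ℝ}
    {F : EuclideanSpace ℝ (Fin m) → ℝ} {y : EuclideanSpace ℝ (Fin m)} (hF : ContDiffAt ℝ ∞ F y)
    (i j : Fin m) :
    hessian G F i j y = fderiv ℝ (fderiv ℝ F) y (EuclideanSpace.single i 1)
      (EuclideanSpace.single j 1) - fderiv ℝ F y (connection G y (EuclideanSpace.single i 1)
      (EuclideanSpace.single j 1)) := by
  have hd : DifferentiableAt ℝ (fderiv ℝ F) y :=
    (hF.fderiv_right (m := ∞) (by simp)).differentiableAt (by simp)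
  have h1 : partialDeriv i (partialDeriv j F) y = fderiv ℝ (fderiv ℝ F) y
      (EuclideanSpace.single i 1) (EuclideanSpace.single j 1) := by
    have h2 := hd.hasFDerivAt.clm_apply (hasFDerivAt_const (EuclideanSpace.single j (1 : ℝ)) y)
    change fderiv ℝ (fun z => fderiv ℝ F z (EuclideanSpace.single j 1)) y _ = _
    rw [h2.fderiv]
    simp
  rw [hessian, h1]
  conv_rhs => rw [← sum_apply_smul_single (connection G y (EuclideanSpace.single i 1)
    (EuclideanSpace.single j 1))]
  simp [connection_single, partialDeriv]

/-- The curvature tensor is natural under local isometries. -/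
theorem curvatureTensor_pullback {G G' : EuclideanSpace ℝ (Fin m) → Matrix (Fin m) (Fin m) ℝ}
    {ψ : EuclideanSpace ℝ (Fin m) → EuclideanSpace ℝ (Fin m)} {y : EuclideanSpace ℝ (Fin m)}
    (hG : ∀ᶠ z in nhds y, IsMetricAt G z) (hG' : ∀ᶠ z in nhds (ψ y), IsMetricAt G' z)
    (hψ : ∀ᶠ z in nhds y, ContDiffAt ℝ ∞ ψ z)
    (hg : ∀ᶠ z in nhds y, matrixForm (G z) = pullbackBilin (matrixForm (G' (ψ z))) (fderiv ℝ ψ z))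
    (a b c d : EuclideanSpace ℝ (Fin m)) :
    curvatureTensor G y a b c d = curvatureTensor G' (ψ y) (fderiv ℝ ψ y a) (fderiv ℝ ψ y b)
      (fderiv ℝ ψ y c) (fderiv ℝ ψ y d) := by
  have hψy := hψ.self_of_nhds
  have hlaw : ∀ᶠ z in nhds y, ∀ u v, fderiv ℝ ψ z (connection G z u v)
      = fderiv ℝ (fderiv ℝ ψ) z u v
        + connection G' (ψ z) (fderiv ℝ ψ z u) (fderiv ℝ ψ z v) := by
    filter_upwards [hG, hψy.continuousAt.eventually hG', hψ, hg.eventually_nhds]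
      with z hz hz' hψz hgz u v
    have hinj : Function.Injective (fderiv ℝ ψ z) := by
      rw [injective_iff_map_eq_zero]
      intro u hu
      refine matrixForm_nondegenerate hz.2 u fun v => ?_
      rw [hgz.self_of_nhds]
      change matrixForm (G' (ψ z)) (fderiv ℝ ψ z u) (fderiv ℝ ψ z v) = 0
      rw [hu]
      simp
    exact fderiv_connection_eq (g := fun z => matrixForm (G z)) (g' := fun z => matrixForm (G' z))
      (hψz.of_le ENat.LEInfty.out) hgz
      ((contDiffAt_matrixForm hz'.1).differentiableAt (by simp)) (matrixForm_symm hz'.2)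
      (matrixForm_nondegenerate hz'.2)
      ((fderiv ℝ ψ z : EuclideanSpace ℝ (Fin m) →ₗ[ℝ] EuclideanSpace ℝ (Fin m)).surjective_of_injective
        hinj)
      (isKoszulAt_connection hz) (isKoszulAt_connection hz') u v
  have h1 := fderiv_connectionCurvature (hψy.of_le ENat.LEInfty.out)
    ((contDiffAt_connection hG.self_of_nhds).differentiableAt (by simp))
    ((contDiffAt_connection hG'.self_of_nhds).differentiableAt (by simp)) hlaw a b c
  rw [curvatureTensor, hg.self_of_nhds, curvatureTensor, ← h1]
  rfl

theorem sum_bilin_mul (B : EuclideanSpace ℝ (Fin m) →ₗ[ℝ] EuclideanSpace ℝ (Fin m) →ₗ[ℝ] ℝ)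
    (A : EuclideanSpace ℝ (Fin m) →L[ℝ] EuclideanSpace ℝ (Fin m)) (J η : Matrix (Fin m) (Fin m) ℝ)
    (hJ : ∀ i j, J i j = A (EuclideanSpace.single j 1) i) :
    ∑ i, ∑ j, B (A (EuclideanSpace.single i 1)) (A (EuclideanSpace.single j 1)) * η i j
      = ∑ i, ∑ j, B (EuclideanSpace.single i 1) (EuclideanSpace.single j 1)
        * (J * η * J.transpose) i j := by
  set M : Matrix (Fin m) (Fin m) ℝ :=
    Matrix.of fun i j => B (EuclideanSpace.single i 1) (EuclideanSpace.single j 1) with hM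
  have h1 : ∀ i j, B (A (EuclideanSpace.single i 1)) (A (EuclideanSpace.single j 1))
      = (J.transpose * M * J) i j := by
    intro i j
    rw [← sum_apply_smul_single (A (EuclideanSpace.single i 1)),
      ← sum_apply_smul_single (A (EuclideanSpace.single j 1))]
    simp only [map_sum, map_smul, LinearMap.sum_apply, LinearMap.smul_apply, Matrix.mul_apply,
      Finset.sum_mul, Finset.mul_sum, smul_eq_mul, Matrix.transpose_apply, hJ, hM, Matrix.of_apply]
    refine Finset.sum_congr rfl fun a _ => Finset.sum_congr rfl fun b _ => by ring
  have h2 : ∀ P Q : Matrix (Fin m) (Fin m) ℝ, ∑ i, ∑ j, P i j * Q i j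
      = (P.transpose * Q).trace := by
    intro P Q
    simp only [Matrix.trace, Matrix.diag, Matrix.mul_apply, Matrix.transpose_apply]
    exact Finset.sum_comm
  simp only [h1]
  change _ = ∑ i, ∑ j, M i j * _
  rw [h2, h2, Matrix.transpose_mul, Matrix.transpose_mul, Matrix.transpose_transpose,
    ← Matrix.mul_assoc, ← Matrix.mul_assoc, Matrix.mul_assoc, Matrix.mul_assoc,
    Matrix.trace_mul_comm]

/-- The curvature tensor as a bilinear form in its first two arguments. -/
def curvatureTensorFst (G : EuclideanSpace ℝ (Fin m) → Matrix (Fin m) (Fin m) ℝ)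
    (y w z : EuclideanSpace ℝ (Fin m)) :
    EuclideanSpace ℝ (Fin m) →ₗ[ℝ] EuclideanSpace ℝ (Fin m) →ₗ[ℝ] ℝ :=
  LinearMap.mk₂ ℝ (fun u v => curvatureTensor G y u v w z)
    (fun u u' v => by simp [curvatureTensor, connectionCurvature]; ring)
    (fun c u v => by simp [curvatureTensor, connectionCurvature]; ring)
    (fun u v v' => by simp [curvatureTensor, connectionCurvature]; ring)
    (fun c u v => by simp [curvatureTensor, connectionCurvature]; ring)

/-- The curvature tensor as a bilinear form in its last two arguments, in reversed order. -/
def curvatureTensorSnd (G : EuclideanSpace ℝ (Fin m) → Matrix (Fin m) (Fin m) ℝ)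
    (y u v : EuclideanSpace ℝ (Fin m)) :
    EuclideanSpace ℝ (Fin m) →ₗ[ℝ] EuclideanSpace ℝ (Fin m) →ₗ[ℝ] ℝ :=
  LinearMap.mk₂ ℝ (fun z w => curvatureTensor G y u v w z)
    (fun z z' w => by simp [curvatureTensor])
    (fun c z w => by simp [curvatureTensor])
    (fun z w w' => by simp [curvatureTensor, connectionCurvature]; ring)
    (fun c z w => by simp [curvatureTensor, connectionCurvature]; ring)

/-- The curvature form, grouped so that both pairs of arguments are contracted with `η`. -/
theorem curvatureForm_eq {G : EuclideanSpace ℝ (Fin m) → Matrix (Fin m) (Fin m) ℝ}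
    {y : EuclideanSpace ℝ (Fin m)} (h : IsMetricAt G y) (η : Matrix (Fin m) (Fin m) ℝ) :
    curvatureForm G η y = ∑ l, ∑ k, (∑ i, ∑ j, curvatureTensor G y (EuclideanSpace.single i 1)
      (EuclideanSpace.single j 1) (EuclideanSpace.single k 1) (EuclideanSpace.single l 1) * η i j)
        * η l k := by
  simp only [curvatureForm, riemann_eq h, Finset.sum_mul]
  refine Eq.trans ?_ Finset.sum_comm
  refine (Finset.sum_congr rfl fun i _ => (Finset.sum_comm.trans
    (Finset.sum_congr rfl fun k _ => Finset.sum_comm))).trans ?_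
  exact Finset.sum_comm.trans (Finset.sum_congr rfl fun k _ => Finset.sum_comm)

/-- The curvature operator of `G` at `y` is positive definite. -/
def HasPosCurvatureAt (G : EuclideanSpace ℝ (Fin m) → Matrix (Fin m) (Fin m) ℝ)
    (y : EuclideanSpace ℝ (Fin m)) : Prop :=
  ∀ η : Matrix (Fin m) (Fin m) ℝ, η.transpose = -η → η ≠ 0 → 0 < curvatureForm G η y

/-- Positivity of the curvature operator is invariant under local isometries. -/
theorem HasPosCurvatureAt.of_pullback
    {G G' : EuclideanSpace ℝ (Fin m) → Matrix (Fin m) (Fin m) ℝ}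
    {ψ : EuclideanSpace ℝ (Fin m) → EuclideanSpace ℝ (Fin m)} {y : EuclideanSpace ℝ (Fin m)}
    (hG : ∀ᶠ z in nhds y, IsMetricAt G z) (hG' : ∀ᶠ z in nhds (ψ y), IsMetricAt G' z)
    (hψ : ∀ᶠ z in nhds y, ContDiffAt ℝ ∞ ψ z)
    (hg : ∀ᶠ z in nhds y, matrixForm (G z) = pullbackBilin (matrixForm (G' (ψ z))) (fderiv ℝ ψ z))
    (h : HasPosCurvatureAt G' (ψ y)) : HasPosCurvatureAt G y := by
  intro η hη hη0
  set A := fderiv ℝ ψ y with hA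
  set J : Matrix (Fin m) (Fin m) ℝ := Matrix.of fun i j => A (EuclideanSpace.single j 1) i with hJ
  have hJA : ∀ i j, J i j = A (EuclideanSpace.single j 1) i := fun i j => rfl
  have hmul : ∀ v : Fin m → ℝ, J.mulVec v = (A (WithLp.toLp 2 v) : Fin m → ℝ) := by
    intro v
    have : WithLp.toLp 2 v = ∑ i, v i • EuclideanSpace.single i (1 : ℝ) :=
      (sum_apply_smul_single (WithLp.toLp 2 v)).symm
    rw [this]
    funext i
    simp [Matrix.mulVec, dotProduct, hJA, mul_comm]
  have hJu : IsUnit J := by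
    rw [← Matrix.mulVec_injective_iff_isUnit]
    intro a b hab
    have hab : J.mulVec a = J.mulVec b := hab
    rw [hmul, hmul] at hab
    have h1 : A (WithLp.toLp 2 a - WithLp.toLp 2 b) = 0 := by
      rw [map_sub, sub_eq_zero]
      ext i
      exact congrFun hab i
    have h2 := matrixForm_nondegenerate hG.self_of_nhds.2 (WithLp.toLp 2 a - WithLp.toLp 2 b)
      (fun v => by
        rw [hg.self_of_nhds]
        change matrixForm (G' (ψ y)) (A _) (A v) = 0
        rw [h1]
        simp)
    funext i
    have h3 := congrArg (fun v : EuclideanSpace ℝ (Fin m) => v i) h2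
    simp only [PiLp.sub_apply, PiLp.zero_apply] at h3
    linarith
  have hform : curvatureForm G η y = curvatureForm G' (J * η * J.transpose) (ψ y) := by
    rw [curvatureForm_eq hG.self_of_nhds, curvatureForm_eq hG'.self_of_nhds]
    simp only [curvatureTensor_pullback hG hG' hψ hg]
    rw [← hA]
    have e1 : ∀ w z, ∑ i, ∑ j, curvatureTensor G' (ψ y) (A (EuclideanSpace.single i 1))
        (A (EuclideanSpace.single j 1)) w z * η i j = ∑ i, ∑ j, curvatureTensor G' (ψ y)
        (EuclideanSpace.single i 1) (EuclideanSpace.single j 1) w z * (J * η * J.transpose) i j :=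
      fun w z => sum_bilin_mul (curvatureTensorFst G' (ψ y) w z) A J η hJA
    simp only [e1]
    have e2 := sum_bilin_mul (∑ i, ∑ j, (J * η * J.transpose) i j •
      curvatureTensorSnd G' (ψ y) (EuclideanSpace.single i 1) (EuclideanSpace.single j 1)) A J η hJA
    simp only [LinearMap.sum_apply, LinearMap.smul_apply, curvatureTensorSnd,
      smul_eq_mul] at e2
    simp only [mul_comm (curvatureTensor G' (ψ y) _ _ _ _)]
    exact e2
  rw [hform]
  refine h _ ?_ ?_
  · rw [Matrix.transpose_mul, Matrix.transpose_mul, Matrix.transpose_transpose, hη]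
    simp [Matrix.mul_assoc]
  · intro h0
    apply hη0
    have h1 : IsUnit J.transpose := (Matrix.isUnit_transpose J).mpr hJu
    have h2 := (h1.mul_left_eq_zero).mp h0
    exact (hJu.mul_right_eq_zero).mp h2

/-! ### Rotationally symmetric metrics in Cartesian coordinates -/

theorem hasFDerivAt_comp_normSq {E : Type*} [NormedAddCommGroup E] [InnerProductSpace ℝ E]
    {p : ℝ → ℝ} {p' : ℝ} {y : E} (hp : HasDerivAt p p' (‖y‖ ^ 2)) :
    HasFDerivAt (fun z : E => p (‖z‖ ^ 2)) (p' • (2 : ℝ) • innerSL ℝ y) y := by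
  have h := hp.comp_hasFDerivAt y (hasStrictFDerivAt_norm_sq y).hasFDerivAt
  exact h.congr_fderiv (by ext u; simp)

theorem hasFDerivAt_inner_left {E : Type*} [NormedAddCommGroup E] [InnerProductSpace ℝ E]
    (v y : E) : HasFDerivAt (fun z : E => ⟪z, v⟫) (innerSL ℝ v) y := by
  have h := (innerSL ℝ v).hasFDerivAt (x := y)
  refine h.congr_of_eventuallyEq (Filter.Eventually.of_forall fun z => ?_)
  simp [real_inner_comm]

/-- The metric `G` on coordinate space is rotationally symmetric: away from the origin it is
`α(|z|²) ⟨u, v⟩ + β(|z|²) ⟨z, u⟩ ⟨z, v⟩`. -/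
structure IsRotMetric (G : EuclideanSpace ℝ (Fin m) → Matrix (Fin m) (Fin m) ℝ)
    (α β : ℝ → ℝ) : Prop where
  isMetricAt : ∀ z, IsMetricAt G z
  smooth_α : ∀ s, 0 < s → ContDiffAt ℝ ∞ α s
  smooth_β : ∀ s, 0 < s → ContDiffAt ℝ ∞ β s
  form : ∀ z, z ≠ 0 → ∀ u v, matrixForm (G z) u v
    = α (‖z‖ ^ 2) * ⟪u, v⟫ + β (‖z‖ ^ 2) * (⟪z, u⟫ * ⟪z, v⟫)
  α_pos : ∀ s, 0 < s → 0 < α s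
  radial_pos : ∀ s, 0 < s → 0 < α s + s * β s

/-! The Levi-Civita connection of such a metric is
`p (⟨z, u⟩ v + ⟨z, v⟩ u) + (q ⟨u, v⟩ + h ⟨z, u⟩ ⟨z, v⟩) z` for the following functions `p`, `q`, `h`
of `|z|²`. -/

/-- The coefficient of `⟨z, u⟩ v + ⟨z, v⟩ u` in the connection of a rotationally symmetric
metric. -/
def rotP (α : ℝ → ℝ) (s : ℝ) : ℝ := deriv α s / α s

/-- The coefficient of `⟨u, v⟩ z` in the connection of a rotationally symmetric metric. -/
def rotQ (α β : ℝ → ℝ) (s : ℝ) : ℝ := (β s - deriv α s) / (α s + s * β s)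

/-- The coefficient of `⟨z, u⟩ ⟨z, v⟩ z` in the connection of a rotationally symmetric metric. -/
def rotH (α β : ℝ → ℝ) (s : ℝ) : ℝ :=
  (deriv β s - 2 * rotP α s * β s) / (α s + s * β s)

/-- The coefficient of `⟨v, w⟩ u - ⟨u, w⟩ v` in the curvature of a rotationally symmetric metric. -/
def rotA (α β : ℝ → ℝ) (s : ℝ) : ℝ := rotQ α β s - rotP α s + s * rotP α s * rotQ α β s

/-- The coefficient of `⟨z, w⟩ (⟨z, v⟩ u - ⟨z, u⟩ v)` in the curvature of a rotationally symmetric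
metric. -/
def rotB (α β : ℝ → ℝ) (s : ℝ) : ℝ :=
  rotH α β s - 2 * deriv (rotP α) s + rotP α s ^ 2 + s * rotP α s * rotH α β s

/-- The coefficient of `(⟨z, u⟩ ⟨v, w⟩ - ⟨z, v⟩ ⟨u, w⟩) z` in the curvature of a rotationally
symmetric metric. -/
def rotC (α β : ℝ → ℝ) (s : ℝ) : ℝ :=
  2 * deriv (rotQ α β) s - rotH α β s + rotQ α β s ^ 2 + s * rotH α β s * rotQ α β s

namespace IsRotMetric

variable {G : EuclideanSpace ℝ (Fin m) → Matrix (Fin m) (Fin m) ℝ} {α β : ℝ → ℝ}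

theorem hasDerivAt_α (h : IsRotMetric G α β) {s : ℝ} (hs : 0 < s) :
    HasDerivAt α (deriv α s) s :=
  ((h.smooth_α s hs).differentiableAt (by simp)).hasDerivAt

theorem hasDerivAt_β (h : IsRotMetric G α β) {s : ℝ} (hs : 0 < s) :
    HasDerivAt β (deriv β s) s :=
  ((h.smooth_β s hs).differentiableAt (by simp)).hasDerivAt

theorem contDiffAt_deriv {a : ℝ → ℝ} {s : ℝ} (h : ContDiffAt ℝ ∞ a s) :
    ContDiffAt ℝ ∞ (deriv a) s :=
  (h.fderiv_right (m := ∞) (by simp)).clm_apply contDiffAt_const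

theorem smooth_radial (h : IsRotMetric G α β) {s : ℝ} (hs : 0 < s) :
    ContDiffAt ℝ ∞ (fun s => α s + s * β s) s :=
  (h.smooth_α s hs).add (contDiffAt_id.mul (h.smooth_β s hs))

theorem smooth_rotP (h : IsRotMetric G α β) {s : ℝ} (hs : 0 < s) : ContDiffAt ℝ ∞ (rotP α) s :=
  (contDiffAt_deriv (h.smooth_α s hs)).div (h.smooth_α s hs) (h.α_pos s hs).ne'

theorem smooth_rotQ (h : IsRotMetric G α β) {s : ℝ} (hs : 0 < s) : ContDiffAt ℝ ∞ (rotQ α β) s :=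
  ((h.smooth_β s hs).sub (contDiffAt_deriv (h.smooth_α s hs))).div (h.smooth_radial hs)
    (h.radial_pos s hs).ne'

theorem smooth_rotH (h : IsRotMetric G α β) {s : ℝ} (hs : 0 < s) : ContDiffAt ℝ ∞ (rotH α β) s :=
  ((contDiffAt_deriv (h.smooth_β s hs)).sub ((contDiffAt_const.mul (h.smooth_rotP hs)).mul
    (h.smooth_β s hs))).div (h.smooth_radial hs) (h.radial_pos s hs).ne'

theorem rotP_mul (h : IsRotMetric G α β) {s : ℝ} (hs : 0 < s) : rotP α s * α s = deriv α s :=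
  div_mul_cancel₀ _ (h.α_pos s hs).ne'

theorem rotQ_mul (h : IsRotMetric G α β) {s : ℝ} (hs : 0 < s) :
    rotQ α β s * (α s + s * β s) = β s - deriv α s :=
  div_mul_cancel₀ _ (h.radial_pos s hs).ne'

theorem rotH_mul (h : IsRotMetric G α β) {s : ℝ} (hs : 0 < s) :
    rotH α β s * (α s + s * β s) = deriv β s - 2 * rotP α s * β s :=
  div_mul_cancel₀ _ (h.radial_pos s hs).ne'

theorem hasDerivAt_radial (h : IsRotMetric G α β) {s : ℝ} (hs : 0 < s) :
    HasDerivAt (fun s => α s + s * β s) (deriv α s + (β s + s * deriv β s)) s := by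
  refine ((h.hasDerivAt_α hs).add ((hasDerivAt_id s).mul (h.hasDerivAt_β hs))).congr_deriv ?_
  simp

theorem hasDerivAt_rotP (h : IsRotMetric G α β) {s : ℝ} (hs : 0 < s) :
    HasDerivAt (rotP α) (deriv (rotP α) s) s :=
  ((h.smooth_rotP hs).differentiableAt (by simp)).hasDerivAt

theorem hasDerivAt_rotQ (h : IsRotMetric G α β) {s : ℝ} (hs : 0 < s) :
    HasDerivAt (rotQ α β) (deriv (rotQ α β) s) s :=
  ((h.smooth_rotQ hs).differentiableAt (by simp)).hasDerivAt

theorem hasDerivAt_rotH (h : IsRotMetric G α β) {s : ℝ} (hs : 0 < s) :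
    HasDerivAt (rotH α β) (deriv (rotH α β) s) s :=
  ((h.smooth_rotH hs).differentiableAt (by simp)).hasDerivAt

theorem deriv_rotP_mul (h : IsRotMetric G α β) {s : ℝ} (hs : 0 < s) :
    deriv (rotP α) s * α s + rotP α s * deriv α s = deriv (deriv α) s := by
  have h1 := (h.hasDerivAt_rotP hs).mul (h.hasDerivAt_α hs)
  have h2 : (rotP α * α) =ᶠ[nhds s] deriv α := by
    filter_upwards [lt_mem_nhds hs] with r hr
    exact h.rotP_mul hr
  exact ((h1.congr_of_eventuallyEq h2.symm).deriv).symm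

theorem deriv_rotQ_mul (h : IsRotMetric G α β) {s : ℝ} (hs : 0 < s) :
    deriv (rotQ α β) s * (α s + s * β s) + rotQ α β s * (deriv α s + (β s + s * deriv β s))
      = deriv β s - deriv (deriv α) s := by
  have h1 := (h.hasDerivAt_rotQ hs).mul (h.hasDerivAt_radial hs)
  have h2 : (rotQ α β * fun s => α s + s * β s) =ᶠ[nhds s] fun s => β s - deriv α s := by
    filter_upwards [lt_mem_nhds hs] with r hr
    exact h.rotQ_mul hr
  have h3 := (h.hasDerivAt_β hs).sub
    ((contDiffAt_deriv (h.smooth_α s hs)).differentiableAt (by simp)).hasDerivAt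
  exact (h1.congr_of_eventuallyEq h2.symm).unique h3

/-- The identity between the coefficients which makes `g(R(u, v)w, z)` antisymmetric in
`w` and `z`. -/
theorem rotC_mul (h : IsRotMetric G α β) {s : ℝ} (hs : 0 < s) :
    rotC α β s * (α s + s * β s) = rotB α β s * α s - rotA α β s * β s := by
  have h1 := h.rotP_mul hs
  have h2 := h.rotQ_mul hs
  have h3 := h.rotH_mul hs
  have h4 := h.deriv_rotP_mul hs
  have h5 := h.deriv_rotQ_mul hs
  have hN := (h.radial_pos s hs).ne'
  have key : (rotC α β s * (α s + s * β s) - (rotB α β s * α s - rotA α β s * β s))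
      * (α s + s * β s) = 0 := by
    simp only [rotA, rotB, rotC]
    rw [← h1] at h2 h4 h5
    generalize deriv (rotP α) s = p1 at *
    generalize deriv (rotQ α β) s = q1 at *
    generalize rotP α s = p at *
    generalize rotQ α β s = q at *
    generalize rotH α β s = k at *
    generalize deriv (deriv α) s = a2 at *
    generalize deriv β s = b1 at *
    generalize deriv α s = a1 at *
    generalize α s = a at *
    generalize β s = b at *
    have e1 : a2 = p1 * a + p * (p * a) := h4.symm
    subst e1
    have e2 : b1 = k * (a + s * b) + 2 * p * b := by linarith
    subst e2
    linear_combination (2 * (a + s * b)) * h5 + (q * (a + s * b) + (b - p * a)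
      - 2 * (p * a + b + s * (k * (a + s * b) + 2 * p * b)) + s * k * (a + s * b) + b
      + s * p * b) * h2
  rcases mul_eq_zero.mp key with h6 | h6
  · linarith
  · exact absurd h6 hN

theorem fderiv_form (h : IsRotMetric G α β) {y : EuclideanSpace ℝ (Fin m)} (hy : y ≠ 0)
    (u v w : EuclideanSpace ℝ (Fin m)) :
    fderiv ℝ (fun z => matrixForm (G z)) y u v w = 2 * deriv α (‖y‖ ^ 2) * ⟪y, u⟫ * ⟪v, w⟫
      + 2 * deriv β (‖y‖ ^ 2) * ⟪y, u⟫ * (⟪y, v⟫ * ⟪y, w⟫)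
      + β (‖y‖ ^ 2) * (⟪u, v⟫ * ⟪y, w⟫ + ⟪y, v⟫ * ⟪u, w⟫) := by
  have hs : 0 < ‖y‖ ^ 2 := by positivity
  have h1 : HasFDerivAt (fun z => matrixForm (G z) v w) _ y :=
    ((((contDiffAt_matrixForm (h.isMetricAt y).1).differentiableAt
      (by simp)).hasFDerivAt.clm_apply (hasFDerivAt_const v y)).clm_apply (hasFDerivAt_const w y))
  have h2 := ((hasFDerivAt_comp_normSq (h.hasDerivAt_α hs)).mul_const (⟪v, w⟫)).add
    ((hasFDerivAt_comp_normSq (h.hasDerivAt_β hs)).mul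
      ((hasFDerivAt_inner_left v y).mul (hasFDerivAt_inner_left w y)))
  have heq : (fun z => matrixForm (G z) v w) =ᶠ[nhds y] fun z =>
      α (‖z‖ ^ 2) * ⟪v, w⟫ + β (‖z‖ ^ 2) * (⟪z, v⟫ * ⟪z, w⟫) := by
    filter_upwards [isOpen_ne.mem_nhds hy] with z hz
    exact h.form z hz v w
  have h3 := congrArg (fun L : EuclideanSpace ℝ (Fin m) →L[ℝ] ℝ => L u)
    (h1.unique (h2.congr_of_eventuallyEq heq))
  simp [innerSL_apply_apply] at h3
  rw [h3, real_inner_comm u v, real_inner_comm u w]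
  ring

theorem connection_eq (h : IsRotMetric G α β) {y : EuclideanSpace ℝ (Fin m)} (hy : y ≠ 0)
    (u v : EuclideanSpace ℝ (Fin m)) :
    connection G y u v = rotP α (‖y‖ ^ 2) • (⟪y, u⟫ • v + ⟪y, v⟫ • u)
      + (rotQ α β (‖y‖ ^ 2) * ⟪u, v⟫ + rotH α β (‖y‖ ^ 2) * (⟪y, u⟫ * ⟪y, v⟫)) • y := by
  have hs : 0 < ‖y‖ ^ 2 := by positivity
  rw [← sub_eq_zero]
  refine matrixForm_nondegenerate (h.isMetricAt y).2 _ fun w => ?_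
  have h1 := isKoszulAt_connection (h.isMetricAt y) u v w
  rw [h.fderiv_form hy, h.fderiv_form hy, h.fderiv_form hy] at h1
  rw [map_sub, sub_apply, h.form y hy (_ + _)]
  have h2 := h.rotP_mul hs
  have h3 := h.rotQ_mul hs
  have h4 := h.rotH_mul hs
  simp only [inner_add_left, inner_add_right, real_inner_smul_left, real_inner_smul_right,
    real_inner_self_eq_norm_sq]
  simp only at h1
  have e1 : ⟪v, u⟫ = ⟪u, v⟫ := real_inner_comm _ _
  have e2 : ⟪w, u⟫ = ⟪u, w⟫ := real_inner_comm _ _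
  have e3 : ⟪w, v⟫ = ⟪v, w⟫ := real_inner_comm _ _
  rw [e1, e2, e3] at h1
  linear_combination (1 / 2) * h1 - (⟪y, u⟫ * ⟪v, w⟫ + ⟪y, v⟫ * ⟪u, w⟫) * h2
    - (⟪u, v⟫ * ⟪y, w⟫) * h3 - (⟪y, u⟫ * ⟪y, v⟫ * ⟪y, w⟫) * h4

theorem connectionCurvature_eq (h : IsRotMetric G α β) {y : EuclideanSpace ℝ (Fin m)} (hy : y ≠ 0)
    (u v w : EuclideanSpace ℝ (Fin m)) :
    connectionCurvature (connection G) y u v w =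
      rotA α β (‖y‖ ^ 2) • (⟪v, w⟫ • u - ⟪u, w⟫ • v)
      + (rotB α β (‖y‖ ^ 2) * ⟪y, w⟫) • (⟪y, v⟫ • u - ⟪y, u⟫ • v)
      + (rotC α β (‖y‖ ^ 2) * (⟪y, u⟫ * ⟪v, w⟫ - ⟪y, v⟫ * ⟪u, w⟫)) • y := by
  have hs : 0 < ‖y‖ ^ 2 := by positivity
  have key : ∀ a b c : EuclideanSpace ℝ (Fin m), fderiv ℝ (connection G) y a b c =
      (2 * deriv (rotP α) (‖y‖ ^ 2) * ⟪y, a⟫) • (⟪y, b⟫ • c + ⟪y, c⟫ • b)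
      + rotP α (‖y‖ ^ 2) • (⟪a, b⟫ • c + ⟪a, c⟫ • b)
      + (2 * deriv (rotQ α β) (‖y‖ ^ 2) * ⟪y, a⟫ * ⟪b, c⟫
        + 2 * deriv (rotH α β) (‖y‖ ^ 2) * ⟪y, a⟫ * (⟪y, b⟫ * ⟪y, c⟫)
        + rotH α β (‖y‖ ^ 2) * (⟪a, b⟫ * ⟪y, c⟫ + ⟪y, b⟫ * ⟪a, c⟫)) • y
      + (rotQ α β (‖y‖ ^ 2) * ⟪b, c⟫ + rotH α β (‖y‖ ^ 2) * (⟪y, b⟫ * ⟪y, c⟫)) • a := by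
    intro a b c
    have h1 : HasFDerivAt (fun z => connection G z b c) _ y :=
      (((contDiffAt_connection (h.isMetricAt y)).differentiableAt
        (by simp)).hasFDerivAt.clm_apply (hasFDerivAt_const b y)).clm_apply (hasFDerivAt_const c y)
    have h2 := ((hasFDerivAt_comp_normSq (h.hasDerivAt_rotP hs)).smul
      (((hasFDerivAt_inner_left b y).smul_const c).add
        ((hasFDerivAt_inner_left c y).smul_const b))).add
      ((((hasFDerivAt_comp_normSq (h.hasDerivAt_rotQ hs)).mul_const (⟪b, c⟫)).add
        ((hasFDerivAt_comp_normSq (h.hasDerivAt_rotH hs)).mul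
          ((hasFDerivAt_inner_left b y).mul (hasFDerivAt_inner_left c y)))).smul (hasFDerivAt_id y))
    have heq : (fun z => connection G z b c) =ᶠ[nhds y] fun z =>
        rotP α (‖z‖ ^ 2) • (⟪z, b⟫ • c + ⟪z, c⟫ • b)
        + (rotQ α β (‖z‖ ^ 2) * ⟪b, c⟫ + rotH α β (‖z‖ ^ 2) * (⟪z, b⟫ * ⟪z, c⟫)) • z := by
      filter_upwards [isOpen_ne.mem_nhds hy] with z hz
      exact h.connection_eq hz b c
    have h3 := congrArg (fun L : EuclideanSpace ℝ (Fin m) →L[ℝ] EuclideanSpace ℝ (Fin m) => L a)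
      (h1.unique (h2.congr_of_eventuallyEq heq))
    simp [innerSL_apply_apply] at h3
    rw [h3, real_inner_comm a b, real_inner_comm a c]
    module
  rw [connectionCurvature, key, key]
  simp only [h.connection_eq hy, inner_add_right, real_inner_smul_right, real_inner_self_eq_norm_sq,
    rotA, rotB, rotC]
  rw [real_inner_comm u v, real_inner_comm u y, real_inner_comm v y]
  module

theorem curvatureTensor_eq (h : IsRotMetric G α β) {y : EuclideanSpace ℝ (Fin m)} (hy : y ≠ 0)
    (u v w z : EuclideanSpace ℝ (Fin m)) :
    curvatureTensor G y u v w z =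
      rotA α β (‖y‖ ^ 2) * α (‖y‖ ^ 2) * (⟪v, w⟫ * ⟪u, z⟫ - ⟪u, w⟫ * ⟪v, z⟫)
      + rotB α β (‖y‖ ^ 2) * α (‖y‖ ^ 2) * (⟪y, w⟫ * (⟪y, v⟫ * ⟪u, z⟫ - ⟪y, u⟫ * ⟪v, z⟫)
        + ⟪y, z⟫ * (⟪y, u⟫ * ⟪v, w⟫ - ⟪y, v⟫ * ⟪u, w⟫)) := by
  have hs : 0 < ‖y‖ ^ 2 := by positivity
  rw [curvatureTensor, h.form y hy, h.connectionCurvature_eq hy]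
  have h1 := h.rotC_mul hs
  simp only [inner_add_left, inner_add_right, inner_sub_left, inner_sub_right,
    real_inner_smul_left, real_inner_smul_right, real_inner_self_eq_norm_sq]
  linear_combination ((⟪y, u⟫ * ⟪v, w⟫ - ⟪y, v⟫ * ⟪u, w⟫) * ⟪y, z⟫) * h1

theorem riemannUp_eq (h : IsRotMetric G α β) {y : EuclideanSpace ℝ (Fin m)} (hy : y ≠ 0)
    (i j k l : Fin m) :
    riemannUp G i j k l y =
      rotA α β (‖y‖ ^ 2) * ((if j = k then 1 else 0) * (if i = l then 1 else 0)
        - (if i = k then 1 else 0) * (if j = l then 1 else 0))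
      + rotB α β (‖y‖ ^ 2) * y k * (y j * (if i = l then 1 else 0) - y i * (if j = l then 1 else 0))
      + rotC α β (‖y‖ ^ 2) * (y i * (if j = k then 1 else 0)
        - y j * (if i = k then 1 else 0)) * y l := by
  rw [LocalGeometry.riemannUp_eq (h.isMetricAt y), h.connectionCurvature_eq hy]
  have e1 : ∀ a b : Fin m, (EuclideanSpace.single a (1 : ℝ) : EuclideanSpace ℝ (Fin m)) b
      = if a = b then 1 else 0 := fun a b => by
    simp [eq_comm]
  have e2 : ∀ a b : Fin m, ⟪(EuclideanSpace.single a (1 : ℝ) : EuclideanSpace ℝ (Fin m)),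
      EuclideanSpace.single b 1⟫ = if a = b then 1 else 0 := fun a b => by
    rw [EuclideanSpace.inner_single_right, e1]
    simp
  have e3 : ∀ a : Fin m, ⟪y, EuclideanSpace.single a (1 : ℝ)⟫ = y a := fun a => by
    simp [EuclideanSpace.inner_single_right]
  simp only [PiLp.add_apply, PiLp.sub_apply, PiLp.smul_apply, smul_eq_mul, e1, e2, e3]

theorem ricci_eq (h : IsRotMetric G α β) {y : EuclideanSpace ℝ (Fin m)} (hy : y ≠ 0)
    (j k : Fin m) :
    ricci G j k y = (m - 1) * (rotA α β (‖y‖ ^ 2) * (if j = k then 1 else 0)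
        + rotB α β (‖y‖ ^ 2) * (y j * y k))
      + rotC α β (‖y‖ ^ 2) * (‖y‖ ^ 2 * (if j = k then 1 else 0) - y j * y k) := by
  have hs : ∑ i, y i * y i = ‖y‖ ^ 2 := by
    rw [EuclideanSpace.real_norm_sq_eq]
    exact Finset.sum_congr rfl fun i _ => by ring
  have h1 : ∀ i : Fin m, riemannUp G i j k i y =
      rotA α β (‖y‖ ^ 2) * (if j = k then 1 else 0)
        - rotA α β (‖y‖ ^ 2) * ((if i = k then 1 else 0) * (if i = j then 1 else 0))
      + rotB α β (‖y‖ ^ 2) * y k * y j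
      - rotB α β (‖y‖ ^ 2) * y k * (if i = j then y i else 0)
      + rotC α β (‖y‖ ^ 2) * (if j = k then 1 else 0) * (y i * y i)
      - rotC α β (‖y‖ ^ 2) * y j * (if i = k then y i else 0) := by
    intro i
    rw [h.riemannUp_eq hy]
    simp only [eq_comm (a := j) (b := i)]
    split_ifs <;> ring
  simp only [ricci, h1, Finset.sum_add_distrib, Finset.sum_sub_distrib, ← Finset.mul_sum, hs]
  simp [eq_comm (a := j) (b := k)]
  split_ifs <;> ring

/-- The Hessian of a radial function `P(|z|²)`. -/
theorem hessian_eq (h : IsRotMetric G α β) {y : EuclideanSpace ℝ (Fin m)} (hy : y ≠ 0)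
    {F : EuclideanSpace ℝ (Fin m) → ℝ} {P : ℝ → ℝ} (hP : ∀ s, 0 < s → ContDiffAt ℝ ∞ P s)
    (hF : ∀ z, z ≠ 0 → F z = P (‖z‖ ^ 2)) (i j : Fin m) :
    hessian G F i j y = 4 * deriv (deriv P) (‖y‖ ^ 2) * (y i * y j)
      + 2 * deriv P (‖y‖ ^ 2) * (if i = j then 1 else 0)
      - 2 * deriv P (‖y‖ ^ 2) * (2 * rotP α (‖y‖ ^ 2) * (y i * y j)
        + (rotQ α β (‖y‖ ^ 2) * (if i = j then 1 else 0)
          + rotH α β (‖y‖ ^ 2) * (y i * y j)) * ‖y‖ ^ 2) := by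
  have hs : 0 < ‖y‖ ^ 2 := by positivity
  have hFy : F =ᶠ[nhds y] fun z => P (‖z‖ ^ 2) := by
    filter_upwards [isOpen_ne.mem_nhds hy] with z hz
    exact hF z hz
  have hsmooth : ContDiffAt ℝ ∞ F y :=
    ((hP _ hs).comp y (contDiff_norm_sq ℝ).contDiffAt).congr_of_eventuallyEq hFy
  have hd : ∀ s, 0 < s → HasDerivAt P (deriv P s) s := fun s hs =>
    ((hP s hs).differentiableAt (by simp)).hasDerivAt
  have hd' : HasDerivAt (deriv P) (deriv (deriv P) (‖y‖ ^ 2)) (‖y‖ ^ 2) :=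
    ((contDiffAt_deriv (hP _ hs)).differentiableAt (by simp)).hasDerivAt
  have h1 : ∀ z, z ≠ 0 → fderiv ℝ F z = deriv P (‖z‖ ^ 2) • (2 : ℝ) • innerSL ℝ z := by
    intro z hz
    have hz' : F =ᶠ[nhds z] fun z => P (‖z‖ ^ 2) := by
      filter_upwards [isOpen_ne.mem_nhds hz] with x hx
      exact hF x hx
    exact ((hasFDerivAt_comp_normSq (hd _ (by positivity))).congr_of_eventuallyEq hz').fderiv
  have h2 : ∀ a b, fderiv ℝ (fderiv ℝ F) y a b = 4 * deriv (deriv P) (‖y‖ ^ 2) * ⟪y, a⟫ * ⟪y, b⟫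
      + 2 * deriv P (‖y‖ ^ 2) * ⟪a, b⟫ := by
    intro a b
    have hd2 : DifferentiableAt ℝ (fderiv ℝ F) y :=
      (hsmooth.fderiv_right (m := ∞) (by simp)).differentiableAt (by simp)
    have k1 : HasFDerivAt (fun z => fderiv ℝ F z b) _ y :=
      hd2.hasFDerivAt.clm_apply (hasFDerivAt_const b y)
    have k2 := ((hasFDerivAt_comp_normSq hd').mul (hasFDerivAt_inner_left b y)).const_mul 2
    have heq : (fun z => fderiv ℝ F z b) =ᶠ[nhds y]
        fun z => 2 * (deriv P (‖z‖ ^ 2) * ⟪z, b⟫) := by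
      filter_upwards [isOpen_ne.mem_nhds hy] with z hz
      rw [h1 z hz]
      simp [innerSL_apply_apply]
      ring
    have k3 := congrArg (fun L : EuclideanSpace ℝ (Fin m) →L[ℝ] ℝ => L a)
      (k1.unique (k2.congr_of_eventuallyEq heq))
    simp [innerSL_apply_apply] at k3
    rw [k3, real_inner_comm a b]
    ring
  rw [LocalGeometry.hessian_eq hsmooth, h2, h1 y hy, h.connection_eq hy]
  have e2 : ⟪(EuclideanSpace.single i (1 : ℝ) : EuclideanSpace ℝ (Fin m)),
      EuclideanSpace.single j 1⟫ = if i = j then 1 else 0 := by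
    rw [EuclideanSpace.inner_single_right]
    simp [eq_comm]
  have e3 : ∀ a : Fin m, ⟪y, EuclideanSpace.single a (1 : ℝ)⟫ = y a := fun a => by
    simp [EuclideanSpace.inner_single_right]
  simp only [smul_apply, innerSL_apply_apply, inner_add_right, real_inner_smul_right,
    real_inner_self_eq_norm_sq, e2, e3, smul_eq_mul]
  ring

theorem entry_eq (h : IsRotMetric G α β) {y : EuclideanSpace ℝ (Fin m)} (hy : y ≠ 0)
    (i j : Fin m) :
    G y i j = α (‖y‖ ^ 2) * (if i = j then 1 else 0) + β (‖y‖ ^ 2) * (y i * y j) := by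
  rw [← matrixForm_single (G y), h.form y hy]
  simp [EuclideanSpace.inner_single_right, eq_comm]

/-- The curvature form of a rotationally symmetric metric in terms of the norms of `η` and of its
contraction with the position vector. -/
theorem curvatureForm_eq (h : IsRotMetric G α β) {y : EuclideanSpace ℝ (Fin m)} (hy : y ≠ 0)
    {η : Matrix (Fin m) (Fin m) ℝ} (hη : η.transpose = -η) :
    curvatureForm G η y = 2 * (rotA α β (‖y‖ ^ 2) * α (‖y‖ ^ 2)) * ∑ i, ∑ j, η i j ^ 2
      + 4 * (rotB α β (‖y‖ ^ 2) * α (‖y‖ ^ 2)) * ∑ j, (∑ i, y i * η i j) ^ 2 := by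
  have hanti : ∀ i j, η i j = -η j i := fun i j => by
    have := congrFun (congrFun hη j) i
    simpa using this
  have e2 : ∀ i j : Fin m, ⟪(EuclideanSpace.single i (1 : ℝ) : EuclideanSpace ℝ (Fin m)),
      EuclideanSpace.single j 1⟫ = if i = j then 1 else 0 := fun i j => by
    rw [EuclideanSpace.inner_single_right]
    simp [eq_comm]
  have e3 : ∀ a : Fin m, ⟪y, EuclideanSpace.single a (1 : ℝ)⟫ = y a := fun a => by
    simp [EuclideanSpace.inner_single_right]
  have inner : ∀ k l, ∑ i, ∑ j, curvatureTensor G y (EuclideanSpace.single i 1)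
      (EuclideanSpace.single j 1) (EuclideanSpace.single k 1) (EuclideanSpace.single l 1) * η i j
      = 2 * (rotA α β (‖y‖ ^ 2) * α (‖y‖ ^ 2)) * η l k
        + 2 * (rotB α β (‖y‖ ^ 2) * α (‖y‖ ^ 2)) * (y l * (∑ i, y i * η i k)
          - y k * (∑ i, y i * η i l)) := by
    intro k l
    have hflip : ∀ l, ∑ i, y i * η l i = -∑ i, y i * η i l := fun l => by
      rw [← Finset.sum_neg_distrib]
      exact Finset.sum_congr rfl fun i _ => by rw [hanti l i]; ring
    have hterm : ∀ i j, curvatureTensor G y (EuclideanSpace.single i 1)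
        (EuclideanSpace.single j 1) (EuclideanSpace.single k 1) (EuclideanSpace.single l 1) * η i j
        = rotA α β (‖y‖ ^ 2) * α (‖y‖ ^ 2) * ((if j = k then (if i = l then η i j else 0) else 0)
          - (if i = k then (if j = l then η i j else 0) else 0))
        + rotB α β (‖y‖ ^ 2) * α (‖y‖ ^ 2) * (y k * ((if i = l then y j * η i j else 0)
            - (if j = l then y i * η i j else 0))
          + y l * ((if j = k then y i * η i j else 0) - (if i = k then y j * η i j else 0))) := by
      intro i j
      rw [h.curvatureTensor_eq hy]
      simp only [e2, e3]
      split_ifs <;> ring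
    simp only [hterm, Finset.sum_add_distrib, ← Finset.mul_sum, Finset.sum_sub_distrib]
    simp
    rw [hflip l, hflip k, hanti k l]
    ring
  rw [LocalGeometry.curvatureForm_eq (h.isMetricAt y)]
  simp only [inner]
  have h1 : ∀ l k, (2 * (rotA α β (‖y‖ ^ 2) * α (‖y‖ ^ 2)) * η l k
        + 2 * (rotB α β (‖y‖ ^ 2) * α (‖y‖ ^ 2)) * (y l * (∑ i, y i * η i k)
          - y k * (∑ i, y i * η i l))) * η l k
      = 2 * (rotA α β (‖y‖ ^ 2) * α (‖y‖ ^ 2)) * η l k ^ 2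
        + 2 * (rotB α β (‖y‖ ^ 2) * α (‖y‖ ^ 2)) * ((∑ i, y i * η i k) * (y l * η l k)
          + (∑ i, y i * η i l) * (y k * η k l)) := by
    intro l k
    rw [hanti k l]
    ring
  simp only [h1, Finset.sum_add_distrib, ← Finset.mul_sum]
  rw [Finset.sum_comm (f := fun l k => (∑ i, y i * η i k) * (y l * η l k))]
  simp only [← Finset.mul_sum, ← pow_two]
  ring

/-- Positivity of the curvature of a rotationally symmetric metric away from the origin. -/
theorem hasPosCurvatureAt (h : IsRotMetric G α β) {y : EuclideanSpace ℝ (Fin m)} (hy : y ≠ 0)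
    (hA : 0 < rotA α β (‖y‖ ^ 2))
    (hAB : 0 < rotA α β (‖y‖ ^ 2) + ‖y‖ ^ 2 * rotB α β (‖y‖ ^ 2)) :
    HasPosCurvatureAt G y := by
  intro η hη hη0
  have hs : 0 < ‖y‖ ^ 2 := by positivity
  have hα := h.α_pos _ hs
  rw [h.curvatureForm_eq hy hη]
  have hanti : ∀ i j, η i j = -η j i := fun i j => by
    have := congrFun (congrFun hη j) i
    simpa using this
  have hys : ∑ i, y i ^ 2 = ‖y‖ ^ 2 := (EuclideanSpace.real_norm_sq_eq y).symm
  set ν : Fin m → ℝ := fun j => ∑ i, y i * η i j with hν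
  have hνy : ∑ j, y j * ν j = 0 := by
    have h1 : ∑ j, y j * ν j = ∑ j, ∑ i, y j * y i * η i j := by
      simp only [hν, Finset.mul_sum, mul_assoc]
    have h2 : ∑ j, ∑ i, y j * y i * η i j = -∑ j, ∑ i, y j * y i * η i j := by
      conv_lhs => rw [Finset.sum_comm]
      rw [← Finset.sum_neg_distrib]
      refine Finset.sum_congr rfl fun i _ => ?_
      rw [← Finset.sum_neg_distrib]
      refine Finset.sum_congr rfl fun j _ => ?_
      rw [hanti i j]; ring
    rw [h1]; linarith
  have hE : 0 < ∑ i, ∑ j, η i j ^ 2 := by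
    obtain ⟨i, j, hij⟩ : ∃ i j, η i j ≠ 0 := by
      by_contra hcon
      push Not at hcon
      exact hη0 (by ext i j; exact hcon i j)
    refine Finset.sum_pos' (fun i _ => Finset.sum_nonneg fun j _ => sq_nonneg _)
      ⟨i, Finset.mem_univ _, Finset.sum_pos' (fun j _ => sq_nonneg _)
        ⟨j, Finset.mem_univ _, by positivity⟩⟩
  have hV : 0 ≤ ∑ j, ν j ^ 2 := Finset.sum_nonneg fun j _ => sq_nonneg _
  -- The part of `η` orthogonal to the position vector has nonnegative square norm.
  have hperp : 2 * ∑ j, ν j ^ 2 ≤ ‖y‖ ^ 2 * ∑ i, ∑ j, η i j ^ 2 := by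
    have h1 : 0 ≤ ∑ i, ∑ j, (‖y‖ ^ 2 * η i j - y i * ν j + ν i * y j) ^ 2 :=
      Finset.sum_nonneg fun i _ => Finset.sum_nonneg fun j _ => sq_nonneg _
    have hterm : ∀ i j, (‖y‖ ^ 2 * η i j - y i * ν j + ν i * y j) ^ 2
        = (‖y‖ ^ 2) ^ 2 * η i j ^ 2 - 2 * ‖y‖ ^ 2 * (ν j * (y i * η i j))
          - 2 * ‖y‖ ^ 2 * (ν i * (y j * η j i)) + y i ^ 2 * ν j ^ 2 + ν i ^ 2 * y j ^ 2
          - 2 * ((y i * ν i) * (y j * ν j)) := by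
      intro i j
      rw [hanti j i]; ring
    simp only [hterm, Finset.sum_add_distrib, Finset.sum_sub_distrib, ← Finset.mul_sum] at h1
    rw [Finset.sum_comm (f := fun i j => ν j * (y i * η i j))] at h1
    simp only [← Finset.mul_sum, ← Finset.sum_mul, hνy, hys] at h1
    have h2 : ∑ i, ν i * ∑ j, y j * η j i = ∑ i, ν i ^ 2 :=
      Finset.sum_congr rfl fun i _ => (pow_two (ν i)).symm
    rw [h2] at h1
    have h3 : 0 ≤ ‖y‖ ^ 2 * (‖y‖ ^ 2 * ∑ i, ∑ j, η i j ^ 2 - 2 * ∑ j, ν j ^ 2) := by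
      linarith
    by_contra hcon
    have := mul_pos hs (sub_pos.mpr (not_le.mp hcon))
    linarith
  generalize ∑ i, ∑ j, η i j ^ 2 = X at *
  change 0 < _ + _ * ∑ j, ν j ^ 2
  generalize ∑ j, ν j ^ 2 = V at *
  generalize rotA α β (‖y‖ ^ 2) = A at *
  generalize rotB α β (‖y‖ ^ 2) = B at *
  generalize α (‖y‖ ^ 2) = a at *
  generalize ‖y‖ ^ 2 = s at *
  have key : 0 < A * (s * X - 2 * V) + 2 * (A + s * B) * V := by
    rcases hV.lt_or_eq with h1 | h1
    · have := mul_pos hAB h1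
      have := mul_nonneg hA.le (sub_nonneg.mpr hperp)
      linarith
    · rw [← h1]
      have := mul_pos hA (mul_pos hs hE)
      linarith
  have key2 : 0 < s * (2 * (A * a) * X + 4 * (B * a) * V) := by
    have := mul_pos hα key
    linarith
  exact pos_of_mul_pos_right key2 hs.le

end IsRotMetric

/-! ### Rotationally symmetric solitons as warped products -/

namespace IsRotMetric

variable {n : ℕ} {G : EuclideanSpace ℝ (Fin (n + 1)) → Matrix (Fin (n + 1)) (Fin (n + 1)) ℝ}
  {α β : ℝ → ℝ}

/-- The two components of the soliton equation, in the radial and in the tangential directions. -/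
theorem soliton_components (h : IsRotMetric G α β) (hn : 2 ≤ n) {lam : ℝ}
    {F : EuclideanSpace ℝ (Fin (n + 1)) → ℝ} {P : ℝ → ℝ} (hP : ∀ s, 0 < s → ContDiffAt ℝ ∞ P s)
    (hF : ∀ z, z ≠ 0 → F z = P (‖z‖ ^ 2))
    (hsol : ∀ z i j, ricci G i j z + hessian G F i j z - lam * G z i j = 0) {s : ℝ} (hs : 0 < s) :
    n * (rotA α β s + s * rotB α β s) + 4 * s * deriv (deriv P) s + 2 * deriv P s
        - 2 * deriv P s * s * (2 * rotP α s + rotQ α β s + s * rotH α β s)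
      = lam * (α s + s * β s) ∧
    n * rotA α β s + s * rotC α β s + 2 * deriv P s * (1 - s * rotQ α β s) = lam * α s := by
  set y : EuclideanSpace ℝ (Fin (n + 1)) := EuclideanSpace.single 0 (Real.sqrt s) with hy
  have hsq : Real.sqrt s * Real.sqrt s = s := Real.mul_self_sqrt hs.le
  have hnorm : ‖y‖ ^ 2 = s := by
    rw [hy, PiLp.norm_single, Real.norm_eq_abs, sq_abs, pow_two, hsq]
  have hy0 : y ≠ 0 := by
    intro h0
    rw [h0] at hnorm
    simp at hnorm
    linarith
  have hy00 : y 0 = Real.sqrt s := by simp [hy]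
  have h01 : (⟨1, by omega⟩ : Fin (n + 1)) ≠ 0 := by
    intro h0
    simpa using congrArg Fin.val h0
  have hy1 : y ⟨1, by omega⟩ = 0 := by simp [hy, h01]
  have e0 := hsol y 0 0
  have e1 := hsol y ⟨1, by omega⟩ ⟨1, by omega⟩
  rw [h.ricci_eq hy0, h.hessian_eq hy0 hP hF, h.entry_eq hy0, hnorm] at e0 e1
  rw [hy00, hsq] at e0
  rw [hy1] at e1
  simp only [if_true] at e0 e1
  push_cast at e0 e1
  constructor
  · linear_combination e0
  · linear_combination e1

/-- The profile of a rotationally symmetric soliton along a ray solves the warped product soliton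
equation; the parameter is `t` with `|z|² = 4 e^{2t}`. -/
theorem warpedSoliton (h : IsRotMetric G α β) (hn : 2 ≤ n) {lam : ℝ}
    {F : EuclideanSpace ℝ (Fin (n + 1)) → ℝ} {P : ℝ → ℝ} (hP : ∀ s, 0 < s → ContDiffAt ℝ ∞ P s)
    (hF : ∀ z, z ≠ 0 → F z = P (‖z‖ ^ 2))
    (hsol : ∀ z i j, ricci G i j z + hessian G F i j z - lam * G z i j = 0)
    {S : ℝ → ℝ} (hS : ∀ t, 0 < S t) (hS' : ∀ t, HasDerivAt S (2 * S t) t) :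
    WarpedSoliton n lam (fun t => Real.sqrt (S t * α (S t)))
      (fun t => S t * (α (S t) + S t * deriv α (S t)) / (Real.sqrt (S t * α (S t))
        * Real.sqrt (S t * (α (S t) + S t * β (S t)))))
      (fun t => (rotA α β (S t) + S t * rotB α β (S t)) / (α (S t) + S t * β (S t)))
      (fun t => rotA α β (S t) / α (S t))
      (fun t => 2 * S t * deriv P (S t) / Real.sqrt (S t * (α (S t) + S t * β (S t))))
      (fun t => Real.sqrt (S t * (α (S t) + S t * β (S t)))) := by
  have hα : ∀ t, HasDerivAt (fun t => α (S t)) (deriv α (S t) * (2 * S t)) t := fun t =>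
    (h.hasDerivAt_α (hS t)).comp t (hS' t)
  have hα1 : ∀ t, HasDerivAt (fun t => deriv α (S t)) (deriv (deriv α) (S t) * (2 * S t)) t :=
    fun t => HasDerivAt.comp t (h₂ := deriv α) (((contDiffAt_deriv
      (h.smooth_α _ (hS t))).differentiableAt (by simp)).hasDerivAt) (hS' t)
  have hR : ∀ t, HasDerivAt (fun t => α (S t) + S t * β (S t))
      ((deriv α (S t) + (β (S t) + S t * deriv β (S t))) * (2 * S t)) t := fun t =>
    HasDerivAt.comp t (h₂ := fun s => α s + s * β s) (h.hasDerivAt_radial (hS t)) (hS' t)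
  have hP1 : ∀ t, HasDerivAt (fun t => deriv P (S t)) (deriv (deriv P) (S t) * (2 * S t)) t :=
    fun t => HasDerivAt.comp t (h₂ := deriv P) (((contDiffAt_deriv
      (hP _ (hS t))).differentiableAt (by simp)).hasDerivAt) (hS' t)
  have hw0 : ∀ t, 0 < S t * α (S t) := fun t => mul_pos (hS t) (h.α_pos _ (hS t))
  have hN0 : ∀ t, 0 < S t * (α (S t) + S t * β (S t)) := fun t =>
    mul_pos (hS t) (h.radial_pos _ (hS t))
  have hw : ∀ t, HasDerivAt (fun t => Real.sqrt (S t * α (S t))) (S t * (α (S t)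
      + S t * deriv α (S t)) / Real.sqrt (S t * α (S t))) t := fun t => by
    refine (((hS' t).mul (hα t)).sqrt (hw0 t).ne').congr_deriv ?_
    have := (Real.sqrt_pos.mpr (hw0 t)).ne'
    simp only [Pi.mul_apply]
    field_simp
  have hN : ∀ t, HasDerivAt (fun t => Real.sqrt (S t * (α (S t) + S t * β (S t))))
      (S t * ((α (S t) + S t * β (S t)) + S t * (deriv α (S t) + (β (S t) + S t * deriv β (S t))))
        / Real.sqrt (S t * (α (S t) + S t * β (S t)))) t := fun t => by
    refine (((hS' t).mul (hR t)).sqrt (hN0 t).ne').congr_deriv ?_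
    have := (Real.sqrt_pos.mpr (hN0 t)).ne'
    simp only [Pi.mul_apply]
    field_simp
  have hM : ∀ t, HasDerivAt (fun t => S t * (α (S t) + S t * deriv α (S t)))
      (2 * S t * (α (S t) + S t * deriv α (S t)) + S t * (2 * S t * (2 * deriv α (S t)
        + S t * deriv (deriv α) (S t)))) t := fun t => by
    refine ((hS' t).mul ((hα t).add ((hS' t).mul (hα1 t)))).congr_deriv ?_
    simp only [Pi.mul_apply, Pi.add_apply]
    ring
  refine ⟨by exact_mod_cast hn, fun t => Real.sqrt_pos.mpr (hw0 t),
    fun t => Real.sqrt_pos.mpr (hN0 t), ?_, ?_, ?_, ?_, ?_, ?_⟩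
  · exact continuous_iff_continuousAt.mpr fun t => (hN t).continuousAt
  · intro t
    refine (hw t).congr_deriv ?_
    have h1 := (Real.sqrt_pos.mpr (hw0 t)).ne'
    have h2 := (Real.sqrt_pos.mpr (hN0 t)).ne'
    field_simp
  · intro t
    have h1 := Real.sqrt_pos.mpr (hw0 t)
    have h2 := Real.sqrt_pos.mpr (hN0 t)
    refine ((hM t).div ((hw t).mul (hN t)) (mul_pos h1 h2).ne').congr_deriv ?_
    have q1 := Real.sq_sqrt (hw0 t).le
    have q2 := Real.sq_sqrt (hN0 t).le
    have r1 := h.rotP_mul (hS t)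
    have r2 := h.rotQ_mul (hS t)
    have r3 := h.rotH_mul (hS t)
    have r4 := h.deriv_rotP_mul (hS t)
    have k1 := hS t
    have k2 := h.α_pos _ (hS t)
    have k3 := h.radial_pos _ (hS t)
    simp only [Pi.mul_apply, rotA, rotB]
    generalize Real.sqrt (S t * α (S t)) = w at *
    generalize Real.sqrt (S t * (α (S t) + S t * β (S t))) = N at *
    generalize S t = s at *
    generalize deriv (rotP α) s = p1 at *
    generalize rotP α s = p at *
    generalize rotQ α β s = q at *
    generalize rotH α β s = k at *
    generalize deriv (deriv α) s = a2 at *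
    generalize deriv β s = b1 at *
    generalize deriv α s = a1 at *
    generalize α s = a at *
    generalize β s = b at *
    subst r1
    have r4 : a2 = p1 * a + p * (p * a) := r4.symm
    subst r4
    have e2 : b1 = k * (a + s * b) + 2 * p * b := by linarith
    subst e2
    have ha : a = w ^ 2 / s := by field_simp; linarith
    have hb : b = (N ^ 2 - w ^ 2) / s ^ 2 := by field_simp; linarith
    have hq : q = (b - p * a) / (a + s * b) := eq_div_of_mul_eq k3.ne' r2
    have hR : a + s * b = N ^ 2 / s := by field_simp; linarith
    rw [hR] at hq ⊢
    clear q1 q2 r2 r3 k2 k3 hR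
    subst hq hb ha
    field_simp
    ring
  · intro t
    have h2 := Real.sqrt_pos.mpr (hN0 t)
    refine ((((hS' t).const_mul 2).mul (hP1 t)).div (hN t) h2.ne').congr_deriv ?_
    have q2 := Real.sq_sqrt (hN0 t).le
    have E0 := (h.soliton_components hn hP hF hsol (hS t)).1
    have r1 := h.rotP_mul (hS t)
    have r2 := h.rotQ_mul (hS t)
    have r3 := h.rotH_mul (hS t)
    have k1 := hS t
    have k3 := h.radial_pos _ (hS t)
    simp only [Pi.mul_apply]
    generalize Real.sqrt (S t * (α (S t) + S t * β (S t))) = N at *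
    generalize S t = s at *
    generalize rotA α β s + s * rotB α β s = AB at *
    generalize rotP α s = p at *
    generalize rotQ α β s = q at *
    generalize rotH α β s = k at *
    generalize deriv (deriv P) s = P2 at *
    generalize deriv P s = P1 at *
    generalize deriv β s = b1 at *
    generalize deriv α s = a1 at *
    generalize α s = a at *
    generalize β s = b at *
    subst r1
    have e2 : b1 = k * (a + s * b) + 2 * p * b := by linarith
    subst e2
    have hb : b = (N ^ 2 / s - a) / s := by field_simp; linarith
    have hq : q = (b - p * a) / (a + s * b) := eq_div_of_mul_eq k3.ne' r2
    have hl : lam - n * (AB / (a + s * b)) = (4 * s * P2 + 2 * P1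
        - 2 * P1 * s * (2 * p + q + s * k)) / (a + s * b) := by
      rw [eq_div_iff k3.ne', sub_mul, mul_assoc, div_mul_cancel₀ _ k3.ne']
      linarith
    have hR : a + s * b = N ^ 2 / s := by field_simp; linarith
    rw [hl]
    rw [hR] at hq ⊢
    clear hl q2 r2 r3 k3 hR E0
    subst hq hb
    field_simp
    ring
  · intro t
    have h1 := Real.sqrt_pos.mpr (hw0 t)
    have h2 := Real.sqrt_pos.mpr (hN0 t)
    have q1 := Real.sq_sqrt (hw0 t).le
    have q2 := Real.sq_sqrt (hN0 t).le
    have r1 := h.rotP_mul (hS t)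
    have r2 := h.rotQ_mul (hS t)
    have k1 := hS t
    have k2 := h.α_pos _ (hS t)
    have k3 := h.radial_pos _ (hS t)
    simp only [rotA]
    generalize Real.sqrt (S t * α (S t)) = w at *
    generalize Real.sqrt (S t * (α (S t) + S t * β (S t))) = N at *
    generalize S t = s at *
    generalize rotP α s = p at *
    generalize rotQ α β s = q at *
    generalize deriv α s = a1 at *
    generalize α s = a at *
    generalize β s = b at *
    subst r1
    have ha : a = w ^ 2 / s := by field_simp; linarith
    have hb : b = (N ^ 2 - w ^ 2) / s ^ 2 := by field_simp; linarith
    have hq : q = (b - p * a) / (a + s * b) := eq_div_of_mul_eq k3.ne' r2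
    have hR : a + s * b = N ^ 2 / s := by field_simp; linarith
    rw [hR] at hq
    clear q1 q2 r2 k2 k3 hR
    subst hq hb ha
    field_simp
    ring
  · intro t
    have h1 := Real.sqrt_pos.mpr (hw0 t)
    have h2 := Real.sqrt_pos.mpr (hN0 t)
    have q1 := Real.sq_sqrt (hw0 t).le
    have q2 := Real.sq_sqrt (hN0 t).le
    have E1 := (h.soliton_components hn hP hF hsol (hS t)).2
    have r1 := h.rotP_mul (hS t)
    have r2 := h.rotQ_mul (hS t)
    have r3 := h.rotC_mul (hS t)
    have k1 := hS t
    have k2 := h.α_pos _ (hS t)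
    have k3 := h.radial_pos _ (hS t)
    generalize Real.sqrt (S t * α (S t)) = w at *
    generalize Real.sqrt (S t * (α (S t) + S t * β (S t))) = N at *
    generalize S t = s at *
    generalize rotA α β s = A at *
    generalize rotB α β s = B at *
    generalize rotC α β s = C at *
    generalize rotP α s = p at *
    generalize rotQ α β s = q at *
    generalize deriv P s = P1 at *
    generalize deriv α s = a1 at *
    generalize α s = a at *
    generalize β s = b at *
    subst r1
    have ha : a = w ^ 2 / s := by field_simp; linarith
    have hb : b = (N ^ 2 - w ^ 2) / s ^ 2 := by field_simp; linarith
    have hq : q = (b - p * a) / (a + s * b) := eq_div_of_mul_eq k3.ne' r2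
    have hR : a + s * b = N ^ 2 / s := by field_simp; linarith
    have hC : C = (B * a - A * b) / (a + s * b) := eq_div_of_mul_eq k3.ne' r3
    have hl : lam = (n * A + s * C + 2 * P1 * (1 - s * q)) / a := by field_simp; linarith
    rw [hl, hC]
    rw [hR] at hq ⊢
    clear hl hC q1 q2 r2 r3 k2 k3 hR E1
    subst hq hb ha
    field_simp
    ring

end IsRotMetric

/-! ### Metrics on coordinate space that are invariant under rotations -/

/-- The composition of the reflections in the hyperplanes orthogonal to `b` and to `a`. For nonzero
`a` and `b` this is a rotation. -/
def doubleReflection {E : Type*} [NormedAddCommGroup E] [InnerProductSpace ℝ E] (a b : E) :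
    E ≃ₗᵢ[ℝ] E :=
  (Submodule.reflection (Submodule.span ℝ {b})ᗮ).trans
    (Submodule.reflection (Submodule.span ℝ {a})ᗮ)

theorem doubleReflection_apply {E : Type*} [NormedAddCommGroup E] [InnerProductSpace ℝ E]
    (a b z : E) : doubleReflection a b z = Submodule.reflection (Submodule.span ℝ {a})ᗮ
      (Submodule.reflection (Submodule.span ℝ {b})ᗮ z) := rfl

theorem reflection_of_inner_eq_zero {E : Type*} [NormedAddCommGroup E] [InnerProductSpace ℝ E]
    {a z : E} (h : ⟪a, z⟫ = 0) : Submodule.reflection (Submodule.span ℝ {a})ᗮ z = z :=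
  Submodule.reflection_mem_subspace_eq_self
    (Submodule.mem_orthogonal_singleton_iff_inner_right.mpr h)

variable {n : ℕ}

/-- A metric `G` on coordinate space which is invariant under rotations, together with a function
`F` such that `G` satisfies the gradient soliton equation with potential `F ∘ B` for every
rotation `B`. -/
structure IsInvariantSoliton (G : EuclideanSpace ℝ (Fin (n + 1)) →
    Matrix (Fin (n + 1)) (Fin (n + 1)) ℝ) (F : EuclideanSpace ℝ (Fin (n + 1)) → ℝ) (lam : ℝ) :
    Prop where
  isMetricAt : ∀ z, IsMetricAt G z
  invariant : ∀ a b, a ≠ 0 → b ≠ 0 → ∀ z u v, matrixForm (G (doubleReflection a b z))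
    (doubleReflection a b u) (doubleReflection a b v) = matrixForm (G z) u v
  smooth : ContDiff ℝ ∞ F
  soliton : ∀ z i j, ricci G i j z + hessian G F i j z - lam * G z i j = 0
  soliton_comp : ∀ a b, a ≠ 0 → b ≠ 0 → ∀ z i j, ricci G i j z
    + hessian G (fun z => F (doubleReflection a b z)) i j z - lam * G z i j = 0

/-- A function with vanishing Hessian and a critical point is constant, because its differential
solves a linear ordinary differential equation along lines. -/
theorem eq_of_hessian_eq_zero {m : ℕ} {G : EuclideanSpace ℝ (Fin m) → Matrix (Fin m) (Fin m) ℝ}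
    {f : EuclideanSpace ℝ (Fin m) → ℝ} (hG : ∀ z, IsMetricAt G z) (hf : ContDiff ℝ ∞ f)
    (h : ∀ z i j, hessian G f i j z = 0) {y : EuclideanSpace ℝ (Fin m)} (hy : fderiv ℝ f y = 0)
    (z z' : EuclideanSpace ℝ (Fin m)) : f z = f z' := by
  have hd : Differentiable ℝ (fderiv ℝ f) :=
    (hf.fderiv_right (m := ∞) (by simp)).differentiable (by simp)
  have hB : ∀ z, fderiv ℝ (fderiv ℝ f) z
      = (ContinuousLinearMap.compL ℝ _ _ _ (fderiv ℝ f z)).comp (connection G z) := by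
    intro z
    refine bilin_ext fun i j => ?_
    have h1 := h z i j
    rw [hessian_eq hf.contDiffAt] at h1
    simpa using sub_eq_zero.mp h1
  have hcont : Continuous (connection G) :=
    continuous_iff_continuousAt.mpr fun z => (contDiffAt_connection (hG z)).continuousAt
  refine is_const_of_fderiv_eq_zero (𝕜 := ℝ) (hf.differentiable (by simp)) (fun x => ?_) z z'
  set v := x - y with hv
  have hline : ∀ τ : ℝ, HasDerivAt (fun τ : ℝ => y + τ • v) v τ := fun τ => by
    simpa using ((hasDerivAt_id τ).smul_const v).const_add y
  have hcl : Continuous fun τ : ℝ => y + τ • v :=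
    continuous_const.add (continuous_id.smul continuous_const)
  obtain ⟨C, hC⟩ := isCompact_Icc.exists_bound_of_continuousOn (s := Set.Icc (0 : ℝ) 1)
    ((hcont.comp hcl).clm_apply continuous_const : Continuous fun τ : ℝ =>
      connection G (y + τ • v) v).continuousOn
  have hp : ∀ τ : ℝ, HasDerivAt (fun τ : ℝ => fderiv ℝ f (y + τ • v))
      (fderiv ℝ (fderiv ℝ f) (y + τ • v) v) τ := fun τ =>
    (hd (y + τ • v)).hasFDerivAt.comp_hasDerivAt τ (hline τ)
  have hbound : ∀ τ ∈ Set.Ico (0 : ℝ) 1, ‖fderiv ℝ (fderiv ℝ f) (y + τ • v) v‖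
      ≤ C * ‖fderiv ℝ f (y + τ • v)‖ + 0 := by
    intro τ hτ
    rw [hB, add_zero, mul_comm]
    exact (ContinuousLinearMap.opNorm_comp_le _ _).trans
      (mul_le_mul_of_nonneg_left (hC τ ⟨hτ.1, hτ.2.le⟩) (norm_nonneg _))
  have h1 := norm_le_gronwallBound_of_norm_deriv_right_le (δ := 0)
    (fun τ _ => (hp τ).continuousAt.continuousWithinAt)
    (fun τ _ => (hp τ).hasDerivWithinAt) (by simp [hy]) hbound 1 ⟨zero_le_one, le_rfl⟩
  rw [gronwallBound_ε0_δ0] at h1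
  have h2 := norm_le_zero_iff.mp h1
  simpa [hv] using h2

/-- The transition map between the stereographic projections from two antipodal points. -/
def inversion (y : EuclideanSpace ℝ (Fin (n + 1))) : EuclideanSpace ℝ (Fin (n + 1)) :=
  (4 / ‖y‖ ^ 2) • y

theorem norm_inversion (y : EuclideanSpace ℝ (Fin (n + 1))) : ‖inversion y‖ = 4 / ‖y‖ := by
  rw [inversion, norm_smul, Real.norm_of_nonneg (by positivity)]
  rcases eq_or_ne ‖y‖ 0 with h | h
  · simp [h]
  · field_simp

theorem inversion_ne_zero {y : EuclideanSpace ℝ (Fin (n + 1))} (hy : y ≠ 0) : inversion y ≠ 0 := by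
  rw [← norm_pos_iff, norm_inversion]
  positivity

theorem inversion_inversion {y : EuclideanSpace ℝ (Fin (n + 1))} (hy : y ≠ 0) :
    inversion (inversion y) = y := by
  have h1 : ‖y‖ ≠ 0 := norm_ne_zero_iff.mpr hy
  rw [inversion, norm_inversion, inversion, smul_smul]
  have : 4 / (4 / ‖y‖) ^ 2 * (4 / ‖y‖ ^ 2) = 1 := by field_simp
  rw [this, one_smul]

theorem map_inversion (B : EuclideanSpace ℝ (Fin (n + 1)) ≃ₗᵢ[ℝ] EuclideanSpace ℝ (Fin (n + 1)))
    (y : EuclideanSpace ℝ (Fin (n + 1))) : inversion (B y) = B (inversion y) := by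
  simp [inversion]

/-- The value `α(s)` of the metric in the directions orthogonal to the radius. -/
def profileα (hn : 2 ≤ n) (G : EuclideanSpace ℝ (Fin (n + 1)) →
    Matrix (Fin (n + 1)) (Fin (n + 1)) ℝ) (s : ℝ) : ℝ :=
  G (EuclideanSpace.single 0 (Real.sqrt s)) ⟨1, by omega⟩ ⟨1, by omega⟩

/-- The coefficient `β(s)` of the square of the radial covector in the metric. -/
def profileβ (hn : 2 ≤ n) (G : EuclideanSpace ℝ (Fin (n + 1)) →
    Matrix (Fin (n + 1)) (Fin (n + 1)) ℝ) (s : ℝ) : ℝ :=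
  (G (EuclideanSpace.single 0 (Real.sqrt s)) 0 0 - profileα hn G s) / s

theorem norm_single_sqrt {s : ℝ} (hs : 0 < s) (i : Fin (n + 1)) :
    ‖(EuclideanSpace.single i (Real.sqrt s) : EuclideanSpace ℝ (Fin (n + 1)))‖ ^ 2 = s := by
  rw [PiLp.norm_single, Real.norm_eq_abs, sq_abs, Real.sq_sqrt hs.le]

/-- The rotations act transitively on spheres. -/
theorem exists_doubleReflection (hn : 2 ≤ n) {z z' : EuclideanSpace ℝ (Fin (n + 1))}
    (h : ‖z‖ = ‖z'‖) (hz : z' ≠ 0) : ∃ a b, a ≠ 0 ∧ b ≠ 0 ∧ doubleReflection a b z = z' := by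
  -- A nonzero vector orthogonal to `z'` can be used for the second reflection.
  obtain ⟨b, hb0, hb⟩ : ∃ b : EuclideanSpace ℝ (Fin (n + 1)), b ≠ 0 ∧ ⟪b, z'⟫ = 0 := by
    have hne : (Submodule.span ℝ {z'})ᗮ ≠ ⊥ := by
      intro hbot
      have h1 := Submodule.finrank_add_finrank_orthogonal (Submodule.span ℝ {z'})
      rw [hbot, finrank_span_singleton hz, finrank_euclideanSpace_fin] at h1
      simp at h1
      omega
    obtain ⟨b, hb, hb0⟩ := Submodule.exists_mem_ne_zero_of_ne_bot hne
    exact ⟨b, hb0, Submodule.mem_orthogonal_singleton_iff_inner_left.mp hb⟩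
  by_cases hzz : z = z'
  · refine ⟨b, b, hb0, hb0, ?_⟩
    rw [doubleReflection_apply, hzz, reflection_of_inner_eq_zero hb,
      reflection_of_inner_eq_zero hb]
  · refine ⟨b, z - z', hb0, sub_ne_zero.mpr hzz, ?_⟩
    rw [doubleReflection_apply, Submodule.reflection_sub h, reflection_of_inner_eq_zero hb]

namespace IsInvariantSoliton

variable {G G₁ G₂ : EuclideanSpace ℝ (Fin (n + 1)) → Matrix (Fin (n + 1)) (Fin (n + 1)) ℝ}
  {F F₁ F₂ : EuclideanSpace ℝ (Fin (n + 1)) → ℝ} {lam : ℝ}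

/-- If the difference between the potential and its rotation has a maximum, it vanishes. -/
theorem comp_eq_of_isMax (h : IsInvariantSoliton G F lam) {a b : EuclideanSpace ℝ (Fin (n + 1))}
    (ha : a ≠ 0) (hb : b ≠ 0) {y : EuclideanSpace ℝ (Fin (n + 1))}
    (hy : ∀ z, F z - F (doubleReflection a b z) ≤ F y - F (doubleReflection a b y))
    (z : EuclideanSpace ℝ (Fin (n + 1))) : F (doubleReflection a b z) = F z := by
  set F' : EuclideanSpace ℝ (Fin (n + 1)) → ℝ := fun z => F (doubleReflection a b z) with hF'
  have hsm' : ContDiff ℝ ∞ F' := h.smooth.comp (doubleReflection a b).contDiff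
  have hsm : ContDiff ℝ ∞ fun z => F z - F' z := h.smooth.sub hsm'
  have hd : ∀ z, fderiv ℝ (fun z => F z - F' z) z = fderiv ℝ F z - fderiv ℝ F' z := fun z =>
    fderiv_fun_sub (h.smooth.differentiable (by simp) z) (hsm'.differentiable (by simp) z)
  have hd2 : ∀ z, fderiv ℝ (fderiv ℝ (fun z => F z - F' z)) z
      = fderiv ℝ (fderiv ℝ F) z - fderiv ℝ (fderiv ℝ F') z := fun z => by
    have e : fderiv ℝ (fun z => F z - F' z) = fun z => fderiv ℝ F z - fderiv ℝ F' z := funext hd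
    rw [e]
    exact fderiv_fun_sub ((h.smooth.fderiv_right (m := ∞) (by simp)).differentiable (by simp) z)
      ((hsm'.fderiv_right (m := ∞) (by simp)).differentiable (by simp) z)
  have hhess : ∀ z i j, hessian G (fun z => F z - F' z) i j z = 0 := by
    intro z i j
    have h1 := h.soliton z i j
    have h2 := h.soliton_comp a b ha hb z i j
    rw [hessian_eq h.smooth.contDiffAt] at h1
    rw [hessian_eq hsm'.contDiffAt] at h2
    rw [hessian_eq hsm.contDiffAt, hd2, hd]
    simp only [sub_apply]
    linarith
  have hcrit : fderiv ℝ (fun z => F z - F' z) y = 0 :=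
    (IsLocalMax.fderiv_eq_zero (Filter.Eventually.of_forall hy))
  have := eq_of_hessian_eq_zero h.isMetricAt hsm hhess hcrit z 0
  simp only [hF', map_zero, sub_self] at this
  linarith

/-- The potential is invariant under rotations: the difference between it and its rotation has a
maximum, by compactness of the sphere. -/
theorem comp_eq (h₁ : IsInvariantSoliton G₁ F₁ lam) (h₂ : IsInvariantSoliton G₂ F₂ lam)
    (hF : ∀ y, y ≠ 0 → F₂ y = F₁ (inversion y)) {a b : EuclideanSpace ℝ (Fin (n + 1))}
    (ha : a ≠ 0) (hb : b ≠ 0) (z : EuclideanSpace ℝ (Fin (n + 1))) :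
    F₁ (doubleReflection a b z) = F₁ z := by
  set B := doubleReflection a b with hB
  have hc : ∀ {G F}, IsInvariantSoliton (n := n) G F lam → Continuous fun z => F z - F (B z) :=
    fun h => h.smooth.continuous.sub (h.smooth.continuous.comp B.continuous)
  obtain ⟨y₁, hy₁, hmax₁⟩ := (isCompact_closedBall (0 : EuclideanSpace ℝ (Fin (n + 1)))
    2).exists_isMaxOn ⟨0, by simp⟩ (hc h₁).continuousOn
  obtain ⟨y₂, hy₂, hmax₂⟩ := (isCompact_closedBall (0 : EuclideanSpace ℝ (Fin (n + 1)))
    2).exists_isMaxOn ⟨0, by simp⟩ (hc h₂).continuousOn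
  have hF' : ∀ y, y ≠ 0 → F₁ y = F₂ (inversion y) := fun y hy => by
    rw [hF _ (inversion_ne_zero hy), inversion_inversion hy]
  have hBne : ∀ y, y ≠ 0 → B y ≠ 0 := fun y hy => by simpa using hy
  have hbig : ∀ y : EuclideanSpace ℝ (Fin (n + 1)), y ∉ Metric.closedBall 0 2 →
      y ≠ 0 ∧ inversion y ∈ Metric.closedBall (0 : EuclideanSpace ℝ (Fin (n + 1))) 2 := by
    intro y hy
    rw [mem_closedBall_zero_iff, not_le] at hy
    refine ⟨by rintro rfl; norm_num at hy, ?_⟩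
    rw [mem_closedBall_zero_iff, norm_inversion, div_le_iff₀ (by linarith)]
    linarith
  rcases le_total (F₂ y₂ - F₂ (B y₂)) (F₁ y₁ - F₁ (B y₁)) with hle | hle
  · refine h₁.comp_eq_of_isMax ha hb (y := y₁) (fun x => ?_) z
    by_cases hx : x ∈ Metric.closedBall (0 : EuclideanSpace ℝ (Fin (n + 1))) 2
    · exact hmax₁ hx
    · obtain ⟨hx0, hx'⟩ := hbig x hx
      rw [hF' x hx0, hF' _ (hBne x hx0), map_inversion]
      exact (hmax₂ hx').trans hle
  · have key := h₂.comp_eq_of_isMax ha hb (y := y₂) (fun x => by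
      by_cases hx : x ∈ Metric.closedBall (0 : EuclideanSpace ℝ (Fin (n + 1))) 2
      · exact hmax₂ hx
      · obtain ⟨hx0, hx'⟩ := hbig x hx
        rw [hF x hx0, hF _ (hBne x hx0), map_inversion]
        exact (hmax₁ hx').trans hle)
    rcases eq_or_ne z 0 with rfl | hz
    · simp
    · rw [hF' z hz, hF' _ (hBne z hz), map_inversion]
      exact key _

/-- On the first coordinate axis the matrix of the metric is diagonal, with equal entries in the
directions orthogonal to the axis. -/
theorem entry_zero_eq (h : IsInvariantSoliton G F lam) (hn : 2 ≤ n) (r : ℝ) (i j : Fin (n + 1)) :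
    G (EuclideanSpace.single 0 r) i j = if i = j then
      (if i = 0 then G (EuclideanSpace.single 0 r) 0 0
      else G (EuclideanSpace.single 0 r) ⟨1, by omega⟩ ⟨1, by omega⟩) else 0 := by
  set e : Fin (n + 1) → EuclideanSpace ℝ (Fin (n + 1)) := fun i => EuclideanSpace.single i 1 with he
  have hin : ∀ i j, ⟪e i, e j⟫ = if i = j then 1 else 0 := fun i j => by
    simp only [he]
    rw [EuclideanSpace.inner_single_right]
    simp [eq_comm]
  have hne : ∀ i, e i ≠ 0 := fun i h0 => by
    have := hin i i
    rw [h0] at this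
    simp at this
  have hnorm : ∀ i, ‖e i‖ = 1 := fun i => by simp [he]
  have hself : ∀ i, Submodule.reflection (Submodule.span ℝ {e i})ᗮ (e i) = -e i := fun i =>
    Submodule.reflection_orthogonalComplement_singleton_eq_neg _
  have hort : ∀ i j, i ≠ j → Submodule.reflection (Submodule.span ℝ {e i})ᗮ (e j) = e j :=
    fun i j hij => reflection_of_inner_eq_zero (by rw [hin, if_neg hij])
  have hr : (EuclideanSpace.single 0 r : EuclideanSpace ℝ (Fin (n + 1))) = r • e 0 := by
    ext i
    simp [he]
  have hG : ∀ i j, G (EuclideanSpace.single 0 r) i j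
      = matrixForm (G (r • e 0)) (e i) (e j) := fun i j => by
    rw [← hr, matrixForm_single]
  have hsym : ∀ i j, matrixForm (G (r • e 0)) (e i) (e j)
      = matrixForm (G (r • e 0)) (e j) (e i) :=
    fun i j => matrixForm_symm (h.isMetricAt _).2 _ _
  -- Reflecting two orthogonal directions different from the radial one.
  have h0 : ∀ i, i ≠ 0 → matrixForm (G (r • e 0)) (e 0) (e i) = 0 := by
    intro i hi
    obtain ⟨j, hj0, hji⟩ : ∃ j : Fin (n + 1), j ≠ 0 ∧ j ≠ i := by
      by_contra hcon
      push Not at hcon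
      have h1 := hcon ⟨1, by omega⟩ (by simp [Fin.ext_iff])
      have h2 := hcon ⟨2, by omega⟩ (by simp [Fin.ext_iff])
      rw [← h2] at h1
      simp [Fin.ext_iff] at h1
    have h1 := h.invariant (e i) (e j) (hne i) (hne j) (r • e 0) (e 0) (e i)
    simp only [doubleReflection_apply, map_smul] at h1
    rw [hort j 0 hj0, hort i 0 hi, hort j i hji, hself i, map_neg] at h1
    linarith
  -- A rotation by a right angle in a plane orthogonal to the radial direction.
  have hij : ∀ i j, i ≠ 0 → j ≠ 0 → i ≠ j → matrixForm (G (r • e 0)) (e i) (e j) = 0 ∧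
      matrixForm (G (r • e 0)) (e i) (e i) = matrixForm (G (r • e 0)) (e j) (e j) := by
    intro i j hi hj hij
    have hd : e i - e j ≠ 0 := by
      intro h0
      have := hin i j
      rw [sub_eq_zero.mp h0, hin, if_pos rfl, if_neg hij] at this
      norm_num at this
    have s1 : Submodule.reflection (Submodule.span ℝ {e i - e j})ᗮ (e i) = e j :=
      Submodule.reflection_sub (by rw [hnorm, hnorm])
    have s2 : Submodule.reflection (Submodule.span ℝ {e i - e j})ᗮ (e j) = e i := by
      have := congrArg (Submodule.reflection (Submodule.span ℝ {e i - e j})ᗮ) s1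
      rw [Submodule.reflection_reflection] at this
      exact this.symm
    have s0 : Submodule.reflection (Submodule.span ℝ {e i - e j})ᗮ (e 0) = e 0 :=
      reflection_of_inner_eq_zero (by
        rw [inner_sub_left, hin, hin, if_neg hi, if_neg hj, sub_zero])
    have h1 := h.invariant (e i - e j) (e j) hd (hne j) (r • e 0) (e i) (e j)
    have h2 := h.invariant (e i - e j) (e j) hd (hne j) (r • e 0) (e i) (e i)
    simp only [doubleReflection_apply, map_smul] at h1 h2
    rw [hort j 0 hj, s0, hort j i hij.symm, s1] at h1 h2
    rw [hself j, map_neg, s2, map_neg, hsym j i] at h1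
    exact ⟨by linarith, h2.symm⟩
  have h1ne : (⟨1, by omega⟩ : Fin (n + 1)) ≠ 0 := by simp [Fin.ext_iff]
  simp only [hG]
  by_cases hi : i = j
  · subst hi
    rw [if_pos rfl]
    split_ifs with hi0
    · rw [hi0]
    · by_cases hi1 : i = ⟨1, by omega⟩
      · rw [hi1]
      · exact (hij i _ hi0 h1ne hi1).2
  · rw [if_neg hi]
    by_cases hi0 : i = 0
    · rw [hi0]
      exact h0 j (fun hj => hi (by rw [hi0, hj]))
    · by_cases hj0 : j = 0
      · rw [hj0, hsym]
        exact h0 i hi0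
      · exact (hij i j hi0 hj0 hi).1

/-- At the origin the invariance forces the metric to be a multiple of the Euclidean one. -/
theorem entry_origin (h : IsInvariantSoliton G F lam) (hn : 2 ≤ n) (i j : Fin (n + 1)) :
    G 0 i i = G 0 j j := by
  obtain ⟨a, b, ha, hb, hab⟩ := exists_doubleReflection hn
    (z := (EuclideanSpace.single i 1 : EuclideanSpace ℝ (Fin (n + 1))))
    (z' := EuclideanSpace.single j 1) (by simp) (by simp)
  have h1 := h.invariant a b ha hb 0 (EuclideanSpace.single i 1) (EuclideanSpace.single i 1)
  rwa [hab, map_zero, matrixForm_single, matrixForm_single, eq_comm] at h1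

end IsInvariantSoliton

/-! ### Invariant metrics as functions of the radius -/

theorem continuousAt_curvatureTensor {m : ℕ}
    {G : EuclideanSpace ℝ (Fin m) → Matrix (Fin m) (Fin m) ℝ} {y : EuclideanSpace ℝ (Fin m)}
    (h : IsMetricAt G y) (a b c d : EuclideanSpace ℝ (Fin m)) :
    ContinuousAt (fun z => curvatureTensor G z a b c d) y := by
  have h1 : ContinuousAt (connection G) y := (contDiffAt_connection h).continuousAt
  have h2 : ContinuousAt (fderiv ℝ (connection G)) y :=
    ((contDiffAt_connection h).fderiv_right (m := ∞) (by simp)).continuousAt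
  have h3 : ContinuousAt (fun z => matrixForm (G z)) y := (contDiffAt_matrixForm h.1).continuousAt
  unfold curvatureTensor connectionCurvature
  fun_prop

theorem single_zero_eq_smul (r : ℝ) : (EuclideanSpace.single 0 r : EuclideanSpace ℝ (Fin (n + 1)))
    = r • EuclideanSpace.single 0 1 := by
  ext i
  simp

theorem contDiff_single_zero :
    ContDiff ℝ ∞ fun r : ℝ => (EuclideanSpace.single 0 r : EuclideanSpace ℝ (Fin (n + 1))) := by
  have h : (fun r : ℝ => (EuclideanSpace.single 0 r : EuclideanSpace ℝ (Fin (n + 1))))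
      = fun r => r • EuclideanSpace.single 0 1 := funext single_zero_eq_smul
  rw [h]
  exact contDiff_id.smul contDiff_const

theorem inner_single_one (i j : Fin (n + 1)) :
    ⟪(EuclideanSpace.single i (1 : ℝ) : EuclideanSpace ℝ (Fin (n + 1))),
      EuclideanSpace.single j 1⟫ = if i = j then 1 else 0 := by
  rw [EuclideanSpace.inner_single_right]
  simp [eq_comm]

theorem profileα_add (hn : 2 ≤ n) (G : EuclideanSpace ℝ (Fin (n + 1)) →
    Matrix (Fin (n + 1)) (Fin (n + 1)) ℝ) {s : ℝ} (hs : 0 < s) :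
    profileα hn G s + s * profileβ hn G s = G (EuclideanSpace.single 0 (Real.sqrt s)) 0 0 := by
  rw [profileβ, mul_div_cancel₀ _ hs.ne']
  ring

theorem eq_radial {F : EuclideanSpace ℝ (Fin (n + 1)) → ℝ} (hn : 2 ≤ n)
    (h : ∀ a b, a ≠ 0 → b ≠ 0 → ∀ z, F (doubleReflection a b z) = F z)
    (z : EuclideanSpace ℝ (Fin (n + 1))) (hz : z ≠ 0) :
    F z = F (EuclideanSpace.single 0 (Real.sqrt (‖z‖ ^ 2))) := by
  obtain ⟨a, b, ha, hb, hab⟩ := exists_doubleReflection hn (z := z)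
    (z' := EuclideanSpace.single 0 (Real.sqrt (‖z‖ ^ 2)))
    (by rw [PiLp.norm_single, Real.sqrt_sq (norm_nonneg z), norm_norm])
    (by simpa using hz)
  rw [← hab, h a b ha hb]

theorem tendsto_single_sqrt : Filter.Tendsto (fun s : ℝ =>
    (EuclideanSpace.single 0 (Real.sqrt s) : EuclideanSpace ℝ (Fin (n + 1))))
    (nhdsWithin 0 (Set.Ioi 0)) (nhds 0) := by
  have h : Continuous fun s : ℝ =>
      (EuclideanSpace.single 0 (Real.sqrt s) : EuclideanSpace ℝ (Fin (n + 1))) :=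
    contDiff_single_zero.continuous.comp Real.continuous_sqrt
  have h0 : (EuclideanSpace.single 0 (Real.sqrt 0) : EuclideanSpace ℝ (Fin (n + 1))) = 0 := by
    simp
  simpa only [h0] using (h.tendsto 0).mono_left nhdsWithin_le_nhds

/-- If `f` is smooth, then `s d/ds f(√s)` vanishes at zero to the order of `√s`. -/
theorem deriv_comp_sqrt {f : ℝ → ℝ} (hf : ContDiff ℝ ∞ f) {s : ℝ} (hs : 0 < s) :
    2 * s * deriv (fun s => f (Real.sqrt s)) s = Real.sqrt s * deriv f (Real.sqrt s) := by
  have h1 := ((hf.differentiable (by simp) (Real.sqrt s)).hasDerivAt.comp s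
    (Real.hasDerivAt_sqrt hs.ne')).deriv
  have h2 : deriv (fun s => f (Real.sqrt s)) s = _ := h1
  rw [h2]
  have h3 := Real.mul_self_sqrt hs.le
  have h4 := (Real.sqrt_pos.mpr hs).ne'
  field_simp
  linear_combination (-deriv f (Real.sqrt s)) * h3

/-- The square of the Euclidean radius as a function of the parameter `t`, normalized such that
the inversion becomes `t ↦ -t`. -/
def radiusSq (t : ℝ) : ℝ := 4 * Real.exp (2 * t)

theorem radiusSq_pos (t : ℝ) : 0 < radiusSq t := by unfold radiusSq; positivity

theorem hasDerivAt_radiusSq (t : ℝ) : HasDerivAt radiusSq (2 * radiusSq t) t := by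
  have h := (((hasDerivAt_id t).const_mul 2).exp).const_mul 4
  refine h.congr_deriv ?_
  simp only [radiusSq, id]
  ring

theorem tendsto_radiusSq :
    Filter.Tendsto radiusSq Filter.atBot (nhdsWithin 0 (Set.Ioi 0)) := by
  refine tendsto_nhdsWithin_iff.mpr ⟨?_, Filter.Eventually.of_forall radiusSq_pos⟩
  have h := (Real.tendsto_exp_atBot.comp
    (Filter.tendsto_id.const_mul_atBot (zero_lt_two' ℝ))).const_mul 4
  rw [mul_zero] at h
  exact h

theorem radiusSq_neg (t : ℝ) : radiusSq (-t) = 16 / radiusSq t := by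
  unfold radiusSq
  rw [mul_neg, Real.exp_neg]
  have := (Real.exp_pos (2 * t)).ne'
  field_simp
  norm_num

theorem tendsto_mul_deriv_comp_sqrt {f : ℝ → ℝ} (hf : ContDiff ℝ ∞ f) :
    Filter.Tendsto (fun s => s * deriv (fun s => f (Real.sqrt s)) s) (nhdsWithin 0 (Set.Ioi 0))
      (nhds 0) := by
  have h1 : Continuous fun s => Real.sqrt s * deriv f (Real.sqrt s) / 2 :=
    (Real.continuous_sqrt.mul ((hf.continuous_deriv (by simp)).comp Real.continuous_sqrt)).div_const
      2
  have h2 : Filter.Tendsto (fun s => Real.sqrt s * deriv f (Real.sqrt s) / 2)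
      (nhdsWithin 0 (Set.Ioi 0)) (nhds 0) := by
    have := (h1.tendsto 0).mono_left (nhdsWithin_le_nhds (s := Set.Ioi 0))
    simpa using this
  refine h2.congr' ?_
  filter_upwards [self_mem_nhdsWithin] with s hs
  rw [← deriv_comp_sqrt hf hs]
  ring

namespace IsInvariantSoliton

variable {G G₁ G₂ : EuclideanSpace ℝ (Fin (n + 1)) → Matrix (Fin (n + 1)) (Fin (n + 1)) ℝ}
  {F F₁ F₂ : EuclideanSpace ℝ (Fin (n + 1)) → ℝ} {lam : ℝ}

theorem smooth_entry (h : IsInvariantSoliton G F lam) (i j : Fin (n + 1)) :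
    ContDiff ℝ ∞ fun r : ℝ => G (EuclideanSpace.single 0 r) i j :=
  contDiff_iff_contDiffAt.mpr fun r =>
    ((h.isMetricAt _).1 i j).comp r contDiff_single_zero.contDiffAt

theorem entry_pos (h : IsInvariantSoliton G F lam) (z : EuclideanSpace ℝ (Fin (n + 1)))
    (i : Fin (n + 1)) : 0 < G z i i := by
  rw [← matrixForm_single (G z) i i]
  exact matrixForm_self_pos (h.isMetricAt z).2 (by simp)

/-- An invariant metric is determined by its values along one ray. -/
theorem isRotMetric (h : IsInvariantSoliton G F lam) (hn : 2 ≤ n) :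
    IsRotMetric G (profileα hn G) (profileβ hn G) where
  isMetricAt := h.isMetricAt
  smooth_α s hs :=
    ((h.smooth_entry _ _).contDiffAt).comp s (Real.contDiffAt_sqrt hs.ne')
  smooth_β s hs := by
    have h1 : ∀ i, ContDiffAt ℝ ∞ (fun s => G (EuclideanSpace.single 0 (Real.sqrt s)) i i) s :=
      fun i => ((h.smooth_entry i i).contDiffAt).comp s (Real.contDiffAt_sqrt hs.ne')
    exact ((h1 0).sub (h1 _)).div contDiffAt_id hs.ne'
  form z hz u v := by
    have hs : 0 < ‖z‖ ^ 2 := by positivity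
    set r : ℝ := Real.sqrt (‖z‖ ^ 2) with hr
    have hr' : r = ‖z‖ := Real.sqrt_sq (norm_nonneg z)
    have hr0 : r ≠ 0 := by rw [hr']; exact norm_ne_zero_iff.mpr hz
    obtain ⟨a, b, ha, hb, hab⟩ := exists_doubleReflection hn (z := z)
      (z' := EuclideanSpace.single 0 r) (by rw [PiLp.norm_single, hr', norm_norm])
      (by simpa using hr0)
    obtain ⟨I, hI⟩ : ∃ I : EuclideanSpace ℝ (Fin (n + 1)) →L[ℝ] EuclideanSpace ℝ (Fin (n + 1)) →L[ℝ]
        ℝ, ∀ u v, I u v = ⟪u, v⟫ := ⟨innerSL ℝ, fun _ _ => rfl⟩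
    have axis : matrixForm (G (EuclideanSpace.single 0 r)) = profileα hn G (‖z‖ ^ 2) • I
        + profileβ hn G (‖z‖ ^ 2) • (I (EuclideanSpace.single 0 r)).smulRight
          (I (EuclideanSpace.single 0 r)) := by
      refine bilin_ext fun i j => ?_
      have e1 : profileα hn G (‖z‖ ^ 2)
          = G (EuclideanSpace.single 0 r) ⟨1, by omega⟩ ⟨1, by omega⟩ := rfl
      have e2 := profileα_add hn G hs
      rw [← hr] at e2
      have e3 : ‖z‖ ^ 2 = r ^ 2 := by rw [hr']
      rw [matrixForm_single, h.entry_zero_eq hn, ← e1, ← e2, e3]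
      simp only [add_apply, smul_apply, ContinuousLinearMap.smulRight_apply, hI,
        inner_single_one, smul_eq_mul, single_zero_eq_smul r, real_inner_smul_left,
        eq_comm (a := (0 : Fin (n + 1)))]
      by_cases hij : i = j
      · subst hij
        simp only [if_true]
        split_ifs <;> ring
      · by_cases hi : i = 0
        · have hj : j ≠ 0 := fun hj => hij (hi.trans hj.symm)
          simp [hij, hj]
        · simp [hij, hi]
    rw [← h.invariant a b ha hb, hab, axis, ← (doubleReflection a b).inner_map_map u v,
      ← (doubleReflection a b).inner_map_map z u, ← (doubleReflection a b).inner_map_map z v, hab]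
    simp [hI]
  α_pos s _ := h.entry_pos _ _
  radial_pos s hs := by
    rw [profileα_add hn G hs]
    exact h.entry_pos _ _

/-- The potential as a function of the square of the radius. -/
theorem smooth_potential (h : IsInvariantSoliton G F lam) (s : ℝ) (hs : 0 < s) :
    ContDiffAt ℝ ∞ (fun s => F (EuclideanSpace.single 0 (Real.sqrt s))) s :=
  (h.smooth.contDiffAt.comp _ contDiff_single_zero.contDiffAt).comp s
    (Real.contDiffAt_sqrt hs.ne')

theorem tendsto_profileα (h : IsInvariantSoliton G F lam) (hn : 2 ≤ n) :
    Filter.Tendsto (profileα hn G) (nhdsWithin 0 (Set.Ioi 0)) (nhds (G 0 0 0)) := by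
  rw [h.entry_origin hn 0 ⟨1, by omega⟩]
  exact ((h.isMetricAt 0).1 _ _).continuousAt.tendsto.comp tendsto_single_sqrt

theorem tendsto_radial (h : IsInvariantSoliton G F lam) (hn : 2 ≤ n) :
    Filter.Tendsto (fun s => profileα hn G s + s * profileβ hn G s) (nhdsWithin 0 (Set.Ioi 0))
      (nhds (G 0 0 0)) := by
  refine (((h.isMetricAt 0).1 0 0).continuousAt.tendsto.comp tendsto_single_sqrt).congr' ?_
  filter_upwards [self_mem_nhdsWithin] with s hs
  exact (profileα_add hn G hs).symm

/-- The component of the curvature tensor along the first two coordinate directions gives both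
sectional curvatures near the origin. -/
theorem tendsto_curvature (h : IsInvariantSoliton G F lam) (hn : 2 ≤ n) : ∃ R : ℝ,
    Filter.Tendsto (fun s => rotA (profileα hn G) (profileβ hn G) s * profileα hn G s)
      (nhdsWithin 0 (Set.Ioi 0)) (nhds R) ∧
    Filter.Tendsto (fun s => (rotA (profileα hn G) (profileβ hn G) s
      + s * rotB (profileα hn G) (profileβ hn G) s) * profileα hn G s)
      (nhdsWithin 0 (Set.Ioi 0)) (nhds R) := by
  have hrot := h.isRotMetric hn
  have h10 : (⟨1, by omega⟩ : Fin (n + 1)) ≠ 0 := by simp [Fin.ext_iff]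
  have h20 : (⟨2, by omega⟩ : Fin (n + 1)) ≠ 0 := by simp [Fin.ext_iff]
  have h21 : (⟨2, by omega⟩ : Fin (n + 1)) ≠ ⟨1, by omega⟩ := by simp [Fin.ext_iff]
  set i : Fin (n + 1) := ⟨1, by omega⟩
  set j : Fin (n + 1) := ⟨2, by omega⟩
  have hc := continuousAt_curvatureTensor (h.isMetricAt 0) (EuclideanSpace.single 0 1)
    (EuclideanSpace.single i 1) (EuclideanSpace.single i 1) (EuclideanSpace.single 0 1)
  have hlim : ∀ k : Fin (n + 1), Filter.Tendsto (fun s : ℝ =>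
      (Real.sqrt s • EuclideanSpace.single k 1 : EuclideanSpace ℝ (Fin (n + 1))))
      (nhdsWithin 0 (Set.Ioi 0)) (nhds 0) := fun k => by
    have h1 : Continuous fun s : ℝ =>
        (Real.sqrt s • EuclideanSpace.single k 1 : EuclideanSpace ℝ (Fin (n + 1))) :=
      Real.continuous_sqrt.smul continuous_const
    have h0 : (Real.sqrt 0 • EuclideanSpace.single k 1 : EuclideanSpace ℝ (Fin (n + 1))) = 0 := by
      simp
    simpa only [h0] using (h1.tendsto 0).mono_left nhdsWithin_le_nhds
  have hnorm : ∀ (k : Fin (n + 1)) {s : ℝ}, 0 < s →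
      ‖(Real.sqrt s • EuclideanSpace.single k 1 : EuclideanSpace ℝ (Fin (n + 1)))‖ ^ 2 = s := by
    intro k s hs
    rw [norm_smul, PiLp.norm_single, norm_one, mul_one, Real.norm_eq_abs, sq_abs,
      Real.sq_sqrt hs.le]
  have hne : ∀ (k : Fin (n + 1)) {s : ℝ}, 0 < s →
      (Real.sqrt s • EuclideanSpace.single k 1 : EuclideanSpace ℝ (Fin (n + 1))) ≠ 0 := by
    intro k s hs h0
    have := hnorm k hs
    rw [h0] at this
    simp at this
    linarith
  refine ⟨_, (hc.tendsto.comp (hlim j)).congr' ?_, (hc.tendsto.comp (hlim 0)).congr' ?_⟩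
  · filter_upwards [self_mem_nhdsWithin] with s hs
    simp only [Function.comp_apply]
    rw [hrot.curvatureTensor_eq (hne j hs), hnorm j hs]
    simp [real_inner_smul_left, inner_single_one, h10, h10.symm, h20, h21]
  · filter_upwards [self_mem_nhdsWithin] with s hs
    simp only [Function.comp_apply]
    rw [hrot.curvatureTensor_eq (hne 0 hs), hnorm 0 hs]
    simp [real_inner_smul_left, inner_single_one, h10, h10.symm]
    linear_combination (rotB (profileα hn G) (profileβ hn G) s * profileα hn G s)
      * Real.mul_self_sqrt (le_of_lt hs)

/-- The behaviour of the warped product at a pole. -/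
theorem tendsto_pole (h : IsInvariantSoliton G F lam) (hn : 2 ≤ n) : ∃ k C : ℝ,
    Filter.Tendsto (fun t => radiusSq t * (profileα hn G (radiusSq t)
        + radiusSq t * deriv (profileα hn G) (radiusSq t)) /
        (Real.sqrt (radiusSq t * profileα hn G (radiusSq t)) * Real.sqrt (radiusSq t *
          (profileα hn G (radiusSq t) + radiusSq t * profileβ hn G (radiusSq t)))))
      Filter.atBot (nhds 1) ∧
    Filter.Tendsto (fun t => (rotA (profileα hn G) (profileβ hn G) (radiusSq t)
        + radiusSq t * rotB (profileα hn G) (profileβ hn G) (radiusSq t)) /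
        (profileα hn G (radiusSq t) + radiusSq t * profileβ hn G (radiusSq t)))
      Filter.atBot (nhds k) ∧
    Filter.Tendsto (fun t => rotA (profileα hn G) (profileβ hn G) (radiusSq t)
        / profileα hn G (radiusSq t)) Filter.atBot (nhds k) ∧
    (∀ᶠ t in Filter.atBot, |2 * radiusSq t * deriv (fun s => F (EuclideanSpace.single 0
        (Real.sqrt s))) (radiusSq t) / Real.sqrt (radiusSq t *
          (profileα hn G (radiusSq t) + radiusSq t * profileβ hn G (radiusSq t)))| ≤ C) ∧
    (0 < k → HasPosCurvatureAt G 0) := by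
  have hrot := h.isRotMetric hn
  obtain ⟨R, hR1, hR2⟩ := h.tendsto_curvature hn
  have hα := h.tendsto_profileα hn
  have hρ := h.tendsto_radial hn
  have ha0 : 0 < G 0 0 0 := h.entry_pos 0 0
  have hd : Filter.Tendsto (fun s => s * deriv (profileα hn G) s) (nhdsWithin 0 (Set.Ioi 0))
      (nhds 0) := tendsto_mul_deriv_comp_sqrt (h.smooth_entry _ _)
  have hF : ContDiff ℝ ∞ fun r : ℝ => F (EuclideanSpace.single 0 r) :=
    h.smooth.comp contDiff_single_zero
  refine ⟨R / (G 0 0 0) ^ 2, |deriv (fun r : ℝ => F (EuclideanSpace.single 0 r)) 0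
    / Real.sqrt (G 0 0 0)| + 1, ?_, ?_, ?_, ?_, ?_⟩
  · have h1 : Filter.Tendsto (fun s => (profileα hn G s + s * deriv (profileα hn G) s) /
        (Real.sqrt (profileα hn G s) * Real.sqrt (profileα hn G s + s * profileβ hn G s)))
        (nhdsWithin 0 (Set.Ioi 0)) (nhds 1) := by
      have h2 := (hα.add hd).div (hα.sqrt.mul hρ.sqrt)
        (mul_pos (Real.sqrt_pos.mpr ha0) (Real.sqrt_pos.mpr ha0)).ne'
      rwa [Real.mul_self_sqrt ha0.le, add_zero, div_self ha0.ne'] at h2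
    refine (h1.comp tendsto_radiusSq).congr fun t => ?_
    have hs := radiusSq_pos t
    simp only [Function.comp_apply]
    rw [Real.sqrt_mul hs.le, Real.sqrt_mul hs.le, mul_mul_mul_comm, Real.mul_self_sqrt hs.le,
      mul_div_mul_left _ _ hs.ne']
  · have h1 := hR2.div (hα.mul hρ) (mul_pos ha0 ha0).ne'
    rw [← pow_two] at h1
    refine (h1.comp tendsto_radiusSq).congr fun t => ?_
    have hs := radiusSq_pos t
    simp only [Function.comp_apply, Pi.div_apply]
    rw [mul_comm (_ + _) (profileα hn G _), mul_div_mul_left _ _ (hrot.α_pos _ hs).ne']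
  · have h1 := hR1.div (hα.mul hα) (mul_pos ha0 ha0).ne'
    rw [← pow_two] at h1
    refine (h1.comp tendsto_radiusSq).congr fun t => ?_
    have hs := radiusSq_pos t
    simp only [Function.comp_apply, Pi.div_apply]
    rw [mul_div_mul_right _ _ (hrot.α_pos _ hs).ne']
  · have h1 : Filter.Tendsto (fun s => deriv (fun r : ℝ => F (EuclideanSpace.single 0 r))
        (Real.sqrt s)) (nhdsWithin 0 (Set.Ioi 0))
        (nhds (deriv (fun r : ℝ => F (EuclideanSpace.single 0 r)) 0)) := by
      have := (((hF.continuous_deriv (by simp)).comp Real.continuous_sqrt).tendsto 0).mono_left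
        (nhdsWithin_le_nhds (s := Set.Ioi 0))
      simpa only [Function.comp_def, Real.sqrt_zero] using this
    have h2 := ((h1.div hρ.sqrt (Real.sqrt_pos.mpr ha0).ne').comp tendsto_radiusSq).abs
    filter_upwards [h2.eventually (gt_mem_nhds (lt_add_one _))] with t ht
    have hs := radiusSq_pos t
    rw [deriv_comp_sqrt hF hs, Real.sqrt_mul hs.le, mul_div_mul_left _ _ (Real.sqrt_pos.mpr hs).ne']
    exact ht.le
  · intro hk η hη hη0
    have hRpos : 0 < R := by
      by_contra hcon
      exact absurd hk (not_lt.mpr (div_nonpos_of_nonpos_of_nonneg (not_lt.mp hcon) (sq_nonneg _)))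
    have hB : Filter.Tendsto (fun s => s * rotB (profileα hn G) (profileβ hn G) s
        * profileα hn G s) (nhdsWithin 0 (Set.Ioi 0)) (nhds 0) := by
      have := hR2.sub hR1
      rw [sub_self] at this
      refine this.congr fun s => ?_
      ring
    have hc : ContinuousAt (fun z => ∑ l, ∑ k, (∑ i, ∑ j, curvatureTensor G z
        (EuclideanSpace.single i 1) (EuclideanSpace.single j 1) (EuclideanSpace.single k 1)
        (EuclideanSpace.single l 1) * η i j) * η l k) 0 :=
      tendsto_finsetSum _ fun l _ => tendsto_finsetSum _ fun k _ => Filter.Tendsto.mul_const _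
        (tendsto_finsetSum _ fun i _ => tendsto_finsetSum _ fun j _ => Filter.Tendsto.mul_const _
          (continuousAt_curvatureTensor (h.isMetricAt 0) _ _ _ _).tendsto)
    have h1 := hc.tendsto.comp tendsto_single_sqrt
    have h2 : Filter.Tendsto (fun s => 2 * (rotA (profileα hn G) (profileβ hn G) s
        * profileα hn G s) * (∑ i, ∑ j, η i j ^ 2) + 4 * (s * rotB (profileα hn G)
        (profileβ hn G) s * profileα hn G s) * ∑ j, (η 0 j) ^ 2) (nhdsWithin 0 (Set.Ioi 0))
        (nhds (2 * R * (∑ i, ∑ j, η i j ^ 2) + 4 * 0 * ∑ j, (η 0 j) ^ 2)) :=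
      ((hR1.const_mul 2).mul_const _).add ((hB.const_mul 4).mul_const _)
    have h3 := tendsto_nhds_unique_of_eventuallyEq h1 h2 (by
      filter_upwards [self_mem_nhdsWithin] with s hs
      have hnorm := norm_single_sqrt (n := n) hs 0
      have hne : (EuclideanSpace.single 0 (Real.sqrt s) : EuclideanSpace ℝ (Fin (n + 1))) ≠ 0 := by
        intro h0
        rw [h0] at hnorm
        simp at hnorm
        exact hs.ne hnorm
      simp only [Function.comp_apply]
      rw [← LocalGeometry.curvatureForm_eq (h.isMetricAt _), hrot.curvatureForm_eq hne hη, hnorm]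
      have hsum : ∀ j, ∑ i, (EuclideanSpace.single 0 (Real.sqrt s) :
          EuclideanSpace ℝ (Fin (n + 1))) i * η i j = Real.sqrt s * η 0 j := fun j => by
        simp
      simp only [hsum, mul_pow, Real.sq_sqrt hs.le, ← Finset.mul_sum]
      ring)
    rw [LocalGeometry.curvatureForm_eq (h.isMetricAt _), h3, mul_zero, zero_mul, add_zero]
    have hpos : 0 < ∑ i, ∑ j, η i j ^ 2 := by
      obtain ⟨i, j, hij⟩ : ∃ i j, η i j ≠ 0 := by
        by_contra hcon
        push Not at hcon
        exact hη0 (by ext i j; exact hcon i j)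
      exact Finset.sum_pos' (fun i _ => Finset.sum_nonneg fun j _ => sq_nonneg _)
        ⟨i, Finset.mem_univ i, Finset.sum_pos' (fun j _ => sq_nonneg _)
          ⟨j, Finset.mem_univ j, by positivity⟩⟩
    positivity

end IsInvariantSoliton

/-! ### Two invariant solitons glued along the inversion -/

theorem inversion_eq : (inversion : EuclideanSpace ℝ (Fin (n + 1)) → _)
    = EuclideanGeometry.inversion 0 2 := by
  funext y
  rw [inversion, EuclideanGeometry.inversion, dist_zero_right, div_pow]
  simp
  norm_num

theorem contDiffAt_inversion {y : EuclideanSpace ℝ (Fin (n + 1))} (hy : y ≠ 0) :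
    ContDiffAt ℝ ∞ inversion y := by
  unfold inversion
  exact (contDiffAt_const.div (contDiff_norm_sq ℝ).contDiffAt (by positivity)).smul contDiffAt_id

theorem fderiv_inversion {y : EuclideanSpace ℝ (Fin (n + 1))} (hy : y ≠ 0)
    (u : EuclideanSpace ℝ (Fin (n + 1))) : fderiv ℝ inversion y u
      = (4 / ‖y‖ ^ 2) • Submodule.reflection (Submodule.span ℝ {y})ᗮ u := by
  rw [inversion_eq, (EuclideanGeometry.hasFDerivAt_inversion hy).fderiv, dist_zero_right, sub_zero,
    div_pow]
  norm_num

namespace IsInvariantSoliton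

variable {G G₁ G₂ : EuclideanSpace ℝ (Fin (n + 1)) → Matrix (Fin (n + 1)) (Fin (n + 1)) ℝ}
  {F F₁ F₂ : EuclideanSpace ℝ (Fin (n + 1)) → ℝ} {lam : ℝ}

/-- The effect of the inversion on the two functions which describe an invariant metric. -/
theorem profile_inversion (h₁ : IsInvariantSoliton G₁ F₁ lam) (h₂ : IsInvariantSoliton G₂ F₂ lam)
    (hn : 2 ≤ n) (hG : ∀ y, y ≠ 0 → matrixForm (G₂ y)
      = pullbackBilin (matrixForm (G₁ (inversion y))) (fderiv ℝ inversion y))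
    {s : ℝ} (hs : 0 < s) :
    profileα hn G₂ s = 16 / s ^ 2 * profileα hn G₁ (16 / s) ∧
    profileα hn G₂ s + s * profileβ hn G₂ s = 16 / s ^ 2 * (profileα hn G₁ (16 / s)
      + 16 / s * profileβ hn G₁ (16 / s)) := by
  have h10 : (⟨1, by omega⟩ : Fin (n + 1)) ≠ 0 := by simp [Fin.ext_iff]
  have hnorm := norm_single_sqrt (n := n) hs 0
  set y : EuclideanSpace ℝ (Fin (n + 1)) := EuclideanSpace.single 0 (Real.sqrt s) with hy
  have hy0 : y ≠ 0 := by
    intro h0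
    rw [h0] at hnorm
    simp at hnorm
    exact hs.ne hnorm
  have hy' : y = Real.sqrt s • EuclideanSpace.single 0 1 := single_zero_eq_smul _
  have hsq := Real.mul_self_sqrt hs.le
  have hi : ‖inversion y‖ ^ 2 = 16 / s := by
    rw [norm_inversion, div_pow, hnorm]
    norm_num
  have hiy : inversion y = (4 / s) • y := by rw [inversion, hnorm]
  have r0 : Submodule.reflection (Submodule.span ℝ {y})ᗮ (EuclideanSpace.single 0 1)
      = -EuclideanSpace.single 0 1 := by
    have h1 := Submodule.reflection_orthogonalComplement_singleton_eq_neg (𝕜 := ℝ) y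
    have h2 : EuclideanSpace.single 0 1 = (Real.sqrt s)⁻¹ • y := by
      rw [hy', smul_smul, inv_mul_cancel₀ (Real.sqrt_pos.mpr hs).ne', one_smul]
    rw [h2, map_smul, h1, smul_neg]
  have r1 : Submodule.reflection (Submodule.span ℝ {y})ᗮ (EuclideanSpace.single ⟨1, by omega⟩ 1)
      = EuclideanSpace.single ⟨1, by omega⟩ 1 := reflection_of_inner_eq_zero (by
    rw [hy', real_inner_smul_left, inner_single_one, if_neg h10.symm, mul_zero])
  have e : ∀ u v, matrixForm (G₂ y) u v = (4 / s) * ((4 / s) * matrixForm (G₁ (inversion y))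
      (Submodule.reflection (Submodule.span ℝ {y})ᗮ u)
      (Submodule.reflection (Submodule.span ℝ {y})ᗮ v)) := by
    intro u v
    rw [hG y hy0, pullbackBilin, ContinuousLinearMap.bilinearComp_apply, fderiv_inversion hy0,
      fderiv_inversion hy0, hnorm]
    simp
  have hrot₁ := (h₁.isRotMetric hn).form (inversion y) (inversion_ne_zero hy0)
  have hrot₂ := (h₂.isRotMetric hn).form y hy0
  have e1 := e (EuclideanSpace.single ⟨1, by omega⟩ 1) (EuclideanSpace.single ⟨1, by omega⟩ 1)
  have e0 := e (EuclideanSpace.single 0 1) (EuclideanSpace.single 0 1)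
  rw [r0, hrot₂, hrot₁, hnorm, hi, hiy, hy'] at e0
  rw [r1, hrot₂, hrot₁, hnorm, hi, hiy, hy'] at e1
  simp only [real_inner_smul_left, inner_single_one, inner_neg_left, inner_neg_right, if_true,
    if_neg h10.symm] at e0 e1
  constructor
  · linear_combination e1
  · have h3 : Real.sqrt s ^ 2 = s := Real.sq_sqrt hs.le
    have e0' : profileα hn G₂ s + s * profileβ hn G₂ s = (4 / s) * (4 / s) *
        (profileα hn G₁ (16 / s) + (4 / s) ^ 2 * s * profileβ hn G₁ (16 / s)) := by
      linear_combination e0 + (-profileβ hn G₂ s + (4 / s) ^ 4 * profileβ hn G₁ (16 / s)) * h3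
    rw [e0']
    field_simp
    ring

/-- Two rotationally symmetric solitons on coordinate space which are identified by the inversion
have positive curvature. -/
theorem hasPosCurvatureAt (h₁ : IsInvariantSoliton G₁ F₁ lam) (h₂ : IsInvariantSoliton G₂ F₂ lam)
    (hn : 2 ≤ n) (hlam : 0 < lam) (hF : ∀ y, y ≠ 0 → F₂ y = F₁ (inversion y))
    (hG : ∀ y, y ≠ 0 → matrixForm (G₂ y)
      = pullbackBilin (matrixForm (G₁ (inversion y))) (fderiv ℝ inversion y))
    (z : EuclideanSpace ℝ (Fin (n + 1))) : HasPosCurvatureAt G₁ z := by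
  have hF' : ∀ y, y ≠ 0 → F₁ y = F₂ (inversion y) := fun y hy => by
    rw [hF _ (inversion_ne_zero hy), inversion_inversion hy]
  have S₁ := (h₁.isRotMetric hn).warpedSoliton hn h₁.smooth_potential
    (eq_radial hn fun a b ha hb => h₁.comp_eq h₂ hF ha hb) h₁.soliton radiusSq_pos
    hasDerivAt_radiusSq
  have S₂ := (h₂.isRotMetric hn).warpedSoliton hn h₂.smooth_potential
    (eq_radial hn fun a b ha hb => h₂.comp_eq h₁ hF' ha hb) h₂.soliton radiusSq_pos
    hasDerivAt_radiusSq
  obtain ⟨k, C, hx, h0, h1, hφ, hk⟩ := h₁.tendsto_pole hn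
  obtain ⟨l, C', hx', h0', h1', hφ', -⟩ := h₂.tendsto_pole hn
  have hS : ∀ a t : ℝ, radiusSq t * (16 / radiusSq t ^ 2 * a) = radiusSq (-t) * a := fun a t => by
    rw [radiusSq_neg]
    have := (radiusSq_pos t).ne'
    field_simp
  have hw : (fun t => Real.sqrt (radiusSq t * profileα hn G₂ (radiusSq t)))
      = fun t => Real.sqrt (radiusSq (-t) * profileα hn G₁ (radiusSq (-t))) := by
    funext t
    rw [(h₁.profile_inversion h₂ hn hG (radiusSq_pos t)).1, hS, ← radiusSq_neg]
  have hN : (fun t => Real.sqrt (radiusSq t * (profileα hn G₂ (radiusSq t)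
        + radiusSq t * profileβ hn G₂ (radiusSq t))))
      = fun t => Real.sqrt (radiusSq (-t) * (profileα hn G₁ (radiusSq (-t))
        + radiusSq (-t) * profileβ hn G₁ (radiusSq (-t)))) := by
    funext t
    rw [(h₁.profile_inversion h₂ hn hG (radiusSq_pos t)).2, hS, ← radiusSq_neg]
  have S₃ := S₁.reverse
  rw [← hw, ← hN] at S₃
  obtain ⟨ex, e0, e1, eφ⟩ := S₂.eq_of_eq S₃
  have hpos := S₁.curvature_pos hlam (k := k) (l := l) (C := max C C') hx h0 h1
    (hφ.mono fun t ht => ht.trans (le_max_left _ _))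
    (by
      rw [ex] at hx'
      have := (hx'.comp Filter.tendsto_neg_atTop_atBot).neg
      simpa [Function.comp_def] using this)
    (by
      rw [e0] at h0'
      have := h0'.comp Filter.tendsto_neg_atTop_atBot
      simpa [Function.comp_def] using this)
    (by
      rw [e1] at h1'
      have := h1'.comp Filter.tendsto_neg_atTop_atBot
      simpa [Function.comp_def] using this)
    (by
      have hne := hx'.eventually (isOpen_ne.mem_nhds (one_ne_zero (α := ℝ)))
      have hev : ∀ᶠ t in Filter.atBot, _ := (hφ'.and hne)
      filter_upwards [Filter.tendsto_neg_atTop_atBot.eventually hev] with t ht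
      have h2 := ht.1
      rw [eφ _ ht.2, abs_neg, neg_neg] at h2
      exact h2.trans (le_max_right _ _))
  rcases eq_or_ne z 0 with rfl | hz
  · exact hk hpos.1
  · have hs : 0 < ‖z‖ ^ 2 := by positivity
    have ht : radiusSq (Real.log (‖z‖ ^ 2 / 4) / 2) = ‖z‖ ^ 2 := by
      rw [radiusSq, mul_div_cancel₀ _ (two_ne_zero' ℝ), Real.exp_log (by positivity)]
      ring
    obtain ⟨p0, p1⟩ := hpos.2 (Real.log (‖z‖ ^ 2 / 4) / 2)
    rw [ht] at p0 p1
    have hrot := h₁.isRotMetric hn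
    exact hrot.hasPosCurvatureAt hz ((div_pos_iff_of_pos_right (hrot.α_pos _ hs)).mp p1)
      ((div_pos_iff_of_pos_right (hrot.radial_pos _ hs)).mp p0)

end IsInvariantSoliton

end LocalGeometry

/-! ### The metric of a Riemannian manifold in local coordinates -/

section LocalCoordinates

variable {m : ℕ} {M : Type*} [TopologicalSpace M] [ChartedSpace (EuclideanSpace ℝ (Fin m)) M]
  [IsManifold (𝓡 m) ∞ M]

open LocalGeometry

theorem matrixForm_metricInChart (g : SmoothMetric m M)
    (e : OpenPartialHomeomorph M (EuclideanSpace ℝ (Fin m))) (y u v : EuclideanSpace ℝ (Fin m)) :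
    matrixForm (metricInChart g e y) u v = g.inner (e.symm y)
      (mfderiv (𝓡 m) (𝓡 m) e.symm y u) (mfderiv (𝓡 m) (𝓡 m) e.symm y v) := by
  let A : EuclideanSpace ℝ (Fin m) →L[ℝ] EuclideanSpace ℝ (Fin m) :=
    mfderiv (𝓡 m) (𝓡 m) e.symm y
  let B : EuclideanSpace ℝ (Fin m) →L[ℝ] EuclideanSpace ℝ (Fin m) →L[ℝ] ℝ := g.inner (e.symm y)
  have h : matrixForm (metricInChart g e y) = pullbackBilin B A := by
    refine bilin_ext fun i j => ?_
    rw [matrixForm_single]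
    rfl
  rw [h]
  rfl

theorem contDiffAt_metricInChart (g : SmoothMetric m M)
    {e : OpenPartialHomeomorph M (EuclideanSpace ℝ (Fin m))}
    (he : e ∈ IsManifold.maximalAtlas (𝓡 m) ∞ M) {y : EuclideanSpace ℝ (Fin m)}
    (hy : y ∈ e.target) (i j : Fin m) : ContDiffAt ℝ ∞ (fun z => metricInChart g e z i j) y := by
  have hsymm : ContMDiffOn (𝓡 m) (𝓡 m) ∞ e.symm e.target :=
    contMDiffOn_symm_of_mem_maximalAtlas he
  have hT := hsymm.contMDiffOn_tangentMapWithin (m := ∞) (by simp) e.open_target.uniqueMDiffOn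
  have hvec : ∀ k : Fin m, ContMDiffAt (𝓡 m) (𝓡 m).tangent ∞
      (fun z => (⟨e.symm z, mfderiv (𝓡 m) (𝓡 m) e.symm z (EuclideanSpace.single k (1 : ℝ))⟩ :
        TangentBundle (𝓡 m) M)) y := by
    intro k
    have hconst : ContMDiffAt (𝓡 m) (𝓡 m).tangent ∞ (fun z : EuclideanSpace ℝ (Fin m) =>
        (⟨z, EuclideanSpace.single k (1 : ℝ)⟩ : TangentBundle (𝓡 m) (EuclideanSpace ℝ (Fin m)))) y :=
      contMDiffWithinAt_vectorSpace_iff_contDiffWithinAt.mpr contDiffWithinAt_const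
    have h1 := ContMDiffAt.comp y (hT.contMDiffAt ((e.open_target.preimage
      (FiberBundle.continuous_proj _ _)).mem_nhds hy)) hconst
    refine h1.congr_of_eventuallyEq ?_
    filter_upwards [e.open_target.mem_nhds hy] with z hz
    simp only [Function.comp_apply, tangentMapWithin]
    rw [mfderivWithin_of_isOpen e.open_target hz]
  have h : ContMDiffAt (𝓡 m) ((𝓡 m).prod 𝓘(ℝ, ℝ)) ∞ (fun z => Bundle.TotalSpace.mk' ℝ
      (E := Bundle.Trivial M ℝ) (e.symm z) (metricInChart g e z i j)) y := by
    apply ContMDiffAt.clm_bundle_apply₂ (F₁ := EuclideanSpace ℝ (Fin m))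
      (F₂ := EuclideanSpace ℝ (Fin m)) (E₁ := fun p : M => TangentSpace (𝓡 m) p)
      (E₂ := fun p : M => TangentSpace (𝓡 m) p)
    · exact g.contMDiff.contMDiffAt.comp y (hsymm.contMDiffAt (e.open_target.mem_nhds hy))
    · exact hvec i
    · exact hvec j
  rw [Bundle.contMDiffAt_totalSpace] at h
  exact h.2.contDiffAt

theorem isMetricAt_metricInChart (g : SmoothMetric m M)
    {e : OpenPartialHomeomorph M (EuclideanSpace ℝ (Fin m))}
    (he : e ∈ IsManifold.maximalAtlas (𝓡 m) ∞ M) {y : EuclideanSpace ℝ (Fin m)}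
    (hy : y ∈ e.target) : IsMetricAt (metricInChart g e) y := by
  refine ⟨contDiffAt_metricInChart g he hy, ?_⟩
  have hd : e.symm.MDifferentiable (𝓡 m) (𝓡 m) :=
    ⟨(contMDiffOn_symm_of_mem_maximalAtlas he).mdifferentiableOn (by simp),
      (contMDiffOn_of_mem_maximalAtlas he).mdifferentiableOn (by simp)⟩
  refine Matrix.PosDef.of_dotProduct_mulVec_pos ?_ ?_
  · ext i j
    exact g.symm _ _ _
  · intro x hx
    have h1 := matrixForm_metricInChart g e y (WithLp.toLp 2 x) (WithLp.toLp 2 x)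
    have h2 : mfderiv (𝓡 m) (𝓡 m) e.symm y (WithLp.toLp 2 x) ≠ 0 := fun h0 => by
      have h3 := hd.mfderiv_injective hy (h0.trans (map_zero _).symm)
      exact hx (congrArg WithLp.ofLp h3)
    refine (g.pos _ _ h2).trans_eq ?_
    rw [← h1]
    simp only [matrixForm_apply, dotProduct, Matrix.mulVec, Finset.mul_sum]
    refine Finset.sum_congr rfl fun i _ => Finset.sum_congr rfl fun j _ => ?_
    simp
    ring

/-- The transformation rule for the components of the metric. -/
theorem metricInChart_eq_pullback (g : SmoothMetric m M)
    {e e' : OpenPartialHomeomorph M (EuclideanSpace ℝ (Fin m))}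
    {ψ : EuclideanSpace ℝ (Fin m) → EuclideanSpace ℝ (Fin m)} {y : EuclideanSpace ℝ (Fin m)}
    (h : ∀ᶠ z in nhds y, e.symm z = e'.symm (ψ z)) (hψ : DifferentiableAt ℝ ψ y)
    (he' : e' ∈ IsManifold.maximalAtlas (𝓡 m) ∞ M) (hy : ψ y ∈ e'.target) :
    matrixForm (metricInChart g e y)
      = pullbackBilin (matrixForm (metricInChart g e' (ψ y))) (fderiv ℝ ψ y) := by
  have hd' : MDifferentiableAt (𝓡 m) (𝓡 m) e'.symm (ψ y) :=
    (contMDiffAt_symm_of_mem_maximalAtlas he' hy).mdifferentiableAt (by simp)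
  have hD := (hd'.hasMFDerivAt.comp y hψ.hasFDerivAt.hasMFDerivAt).congr_of_eventuallyEq h
  have hcast : ∀ {p q : M} (_ : p = q) (a b : EuclideanSpace ℝ (Fin m)),
      g.inner p a b = g.inner q a b := by
    rintro p _ rfl a b
    rfl
  ext u v
  rw [matrixForm_metricInChart, pullbackBilin, ContinuousLinearMap.bilinearComp_apply,
    matrixForm_metricInChart, hD.mfderiv]
  exact hcast h.self_of_nhds _ _

theorem metricInChart_eq_pullbackForm (g : SmoothMetric m M)
    {e : OpenPartialHomeomorph M (EuclideanSpace ℝ (Fin m))} {Ψ : M → M}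
    {σ : EuclideanSpace ℝ (Fin m) → M} (h : ⇑e.symm = Ψ ∘ σ) {y : EuclideanSpace ℝ (Fin m)}
    (hΨ : MDifferentiableAt (𝓡 m) (𝓡 m) Ψ (σ y)) (hσ : MDifferentiableAt (𝓡 m) (𝓡 m) σ y)
    (i j : Fin m) :
    metricInChart g e y i j = pullbackForm g Ψ (σ y)
      (mfderiv (𝓡 m) (𝓡 m) σ y (EuclideanSpace.single i (1 : ℝ)))
      (mfderiv (𝓡 m) (𝓡 m) σ y (EuclideanSpace.single j (1 : ℝ))) := by
  simp only [metricInChart, Matrix.of_apply]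
  rw [h, mfderiv_comp y hΨ hσ]
  rfl

theorem transOpenPartialHomeomorph_mem_maximalAtlas (D : M ≃ₘ^∞⟮𝓡 m, 𝓡 m⟯ M)
    {τ : OpenPartialHomeomorph M (EuclideanSpace ℝ (Fin m))}
    (hτ : τ ∈ IsManifold.maximalAtlas (𝓡 m) ∞ M) :
    D.toHomeomorph.transOpenPartialHomeomorph τ ∈ IsManifold.maximalAtlas (𝓡 m) ∞ M := by
  refine OpenPartialHomeomorph.mem_maximalAtlas_of_contMDiffOn _ ?_ ?_
  · exact (contMDiffOn_of_mem_maximalAtlas hτ).comp D.contMDiff.contMDiffOn fun x hx => hx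
  · exact D.symm.contMDiff.comp_contMDiffOn (contMDiffOn_symm_of_mem_maximalAtlas hτ)

theorem transHomeomorph_mem_maximalAtlas
    (B : EuclideanSpace ℝ (Fin m) ≃ₗᵢ[ℝ] EuclideanSpace ℝ (Fin m))
    {τ : OpenPartialHomeomorph M (EuclideanSpace ℝ (Fin m))}
    (hτ : τ ∈ IsManifold.maximalAtlas (𝓡 m) ∞ M) :
    τ.transHomeomorph B.toHomeomorph ∈ IsManifold.maximalAtlas (𝓡 m) ∞ M := by
  refine OpenPartialHomeomorph.mem_maximalAtlas_of_contMDiffOn _ ?_ ?_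
  · exact B.contDiff.contMDiff.comp_contMDiffOn (contMDiffOn_of_mem_maximalAtlas hτ)
  · exact (contMDiffOn_symm_of_mem_maximalAtlas hτ).comp
      B.symm.contDiff.contMDiff.contMDiffOn fun x hx => hx

end LocalCoordinates

/-! ### Stereographic coordinates on the sphere -/

section Sphere

open LocalGeometry

variable {n : ℕ}

/-- The map of the sphere induced by a linear isometry, as a diffeomorphism. -/
def sphereDiffeomorph
    (A : EuclideanSpace ℝ (Fin (n + 1 + 1)) ≃ₗᵢ[ℝ] EuclideanSpace ℝ (Fin (n + 1 + 1))) :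
    UnitSphere n ≃ₘ^∞⟮𝓡 (n + 1), 𝓡 (n + 1)⟯ UnitSphere n where
  toFun := sphereMap A
  invFun := sphereMap A.symm
  left_inv p := Subtype.ext (A.symm_apply_apply p)
  right_inv p := Subtype.ext (A.apply_symm_apply p)
  contMDiff_toFun :=
    (A.contDiff.contMDiff.comp contMDiff_coe_sphere).codRestrict_sphere fun p => by simp
  contMDiff_invFun :=
    (A.symm.contDiff.contMDiff.comp contMDiff_coe_sphere).codRestrict_sphere fun p => by simp

/-- A rotationally symmetric soliton satisfies the hypotheses of the local theorem in every global
chart of a punctured sphere in which the rotations about the axis act linearly. -/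
theorem isInvariantSoliton {g : SmoothMetric (n + 1) (UnitSphere n)}
    {Φ : UnitSphere n ≃ₘ^∞⟮𝓡 (n + 1), 𝓡 (n + 1)⟯ UnitSphere n}
    (hΦ : ∀ A : EuclideanSpace ℝ (Fin (n + 1 + 1)) ≃ₗᵢ[ℝ] EuclideanSpace ℝ (Fin (n + 1 + 1)),
      LinearMap.det (A.toLinearEquiv : EuclideanSpace ℝ (Fin (n + 1 + 1)) →ₗ[ℝ]
        EuclideanSpace ℝ (Fin (n + 1 + 1))) = 1 →
      A (EuclideanSpace.single 0 1) = EuclideanSpace.single 0 1 →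
      ∀ (p : UnitSphere n) (u v : TangentSpace (𝓡 (n + 1)) p),
        pullbackForm g (fun q => Φ (sphereMap A q)) p u v = pullbackForm g Φ p u v)
    {τ : OpenPartialHomeomorph (UnitSphere n) (EuclideanSpace ℝ (Fin (n + 1)))}
    (hτ : τ ∈ IsManifold.maximalAtlas (𝓡 (n + 1)) ∞ (UnitSphere n)) (hτ' : τ.target = Set.univ)
    (hrot : ∀ a b, a ≠ 0 → b ≠ 0 →
      ∃ A : EuclideanSpace ℝ (Fin (n + 1 + 1)) ≃ₗᵢ[ℝ] EuclideanSpace ℝ (Fin (n + 1 + 1)),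
        LinearMap.det (A.toLinearEquiv : EuclideanSpace ℝ (Fin (n + 1 + 1)) →ₗ[ℝ]
          EuclideanSpace ℝ (Fin (n + 1 + 1))) = 1 ∧
        A (EuclideanSpace.single 0 1) = EuclideanSpace.single 0 1 ∧
        ∀ z, τ.symm (doubleReflection a b z) = sphereMap A (τ.symm z))
    {f : UnitSphere n → ℝ} (hf : ContMDiff (𝓡 (n + 1)) 𝓘(ℝ, ℝ) ∞ f) {c : ℝ}
    (hsol : GradientSolitonEquation g f c) :
    IsInvariantSoliton (metricInChart g (Φ.symm.toHomeomorph.transOpenPartialHomeomorph τ))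
      (fun z => f (Φ (τ.symm z))) c := by
  set e := Φ.symm.toHomeomorph.transOpenPartialHomeomorph τ with he
  have hea : e ∈ IsManifold.maximalAtlas (𝓡 (n + 1)) ∞ (UnitSphere n) :=
    transOpenPartialHomeomorph_mem_maximalAtlas Φ.symm hτ
  have hsymm : ⇑e.symm = Φ ∘ τ.symm := rfl
  have het : e.target = Set.univ := hτ'
  have hσ : ContMDiff (𝓡 (n + 1)) (𝓡 (n + 1)) ∞ τ.symm := by
    have := contMDiffOn_symm_of_mem_maximalAtlas hτ
    rwa [hτ', contMDiffOn_univ] at this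
  -- Composing the chart with a rotation does not change the components of the metric.
  have key : ∀ a b, a ≠ 0 → b ≠ 0 →
      metricInChart g (e.transHomeomorph (doubleReflection a b).symm.toHomeomorph)
        = metricInChart g e := by
    intro a b ha hb
    obtain ⟨A, hdet, hfix, hA⟩ := hrot a b ha hb
    have h1 : ⇑(e.transHomeomorph (doubleReflection a b).symm.toHomeomorph).symm
        = (fun q => Φ (sphereMap A q)) ∘ τ.symm := by
      funext z
      exact congrArg Φ (hA z)
    funext y
    ext i j
    have hσy := (hσ y).mdifferentiableAt (by simp)
    have hΦA : ContMDiff (𝓡 (n + 1)) (𝓡 (n + 1)) ∞ fun q => Φ (sphereMap A q) :=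
      Φ.contMDiff.comp (sphereDiffeomorph A).contMDiff
    rw [metricInChart_eq_pullbackForm g h1 ((hΦA _).mdifferentiableAt (by simp)) hσy,
      metricInChart_eq_pullbackForm g hsymm ((Φ.contMDiff _).mdifferentiableAt (by simp)) hσy]
    exact hΦ A hdet hfix _ _ _
  have hea' : ∀ a b, e.transHomeomorph (doubleReflection a b).symm.toHomeomorph
      ∈ IsManifold.maximalAtlas (𝓡 (n + 1)) ∞ (UnitSphere n) := fun a b =>
    transHomeomorph_mem_maximalAtlas _ hea
  refine ⟨fun z => isMetricAt_metricInChart g hea (by rw [het]; trivial), ?_, ?_, ?_, ?_⟩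
  · intro a b ha hb z u v
    have h1 := metricInChart_eq_pullback g (e := e.transHomeomorph
      (doubleReflection a b).symm.toHomeomorph) (e' := e) (ψ := doubleReflection a b) (y := z)
      (Filter.Eventually.of_forall fun z => rfl)
      ((doubleReflection a b).contDiff.differentiable (n := 1) (by simp) z) hea
      (by rw [het]; trivial)
    have h2 : fderiv ℝ (doubleReflection a b) z = (doubleReflection a b : _ →L[ℝ] _) :=
      (doubleReflection a b).fderiv
    rw [key a b ha hb, h2] at h1
    rw [h1]
    rfl
  · exact (hf.comp (Φ.contMDiff.comp hσ)).contDiff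
  · intro z i j
    exact hsol e hea z (by rw [het]; trivial) i j
  · intro a b ha hb z i j
    have h1 := hsol _ (hea' a b) z (by
      change (doubleReflection a b) z ∈ e.target
      rw [het]; trivial) i j
    rw [key a b ha hb] at h1
    exact h1

/-- The point of the sphere on the axis of rotation. -/
def axisPole (n : ℕ) : UnitSphere n := ⟨EuclideanSpace.single 0 1, by simp⟩

/-- The stereographic projection from `axisPole`. -/
abbrev axisStereographic (n : ℕ) :
    OpenPartialHomeomorph (UnitSphere n) (EuclideanSpace ℝ (Fin (n + 1))) :=
  stereographic' (n + 1) (axisPole n)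

theorem axisStereographic_target : (axisStereographic n).target = Set.univ :=
  stereographic'_target _

/-- The identification of the coordinate space of the stereographic projection from the pole with
the hyperplane orthogonal to the axis. -/
def equatorEmbedding (n : ℕ) :
    EuclideanSpace ℝ (Fin (n + 1)) →ₗᵢ[ℝ] EuclideanSpace ℝ (Fin (n + 1 + 1)) :=
  (Submodule.subtypeₗᵢ (Submodule.span ℝ
    {(axisPole n : EuclideanSpace ℝ (Fin (n + 1 + 1)))})ᗮ).comp
    (OrthonormalBasis.fromOrthogonalSpanSingleton (𝕜 := ℝ) (n + 1)
      (ne_zero_of_mem_unit_sphere (axisPole n))).repr.symm.toLinearIsometry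

theorem inner_equatorEmbedding (x : EuclideanSpace ℝ (Fin (n + 1))) :
    ⟪equatorEmbedding n x, EuclideanSpace.single 0 1⟫ = 0 :=
  Submodule.mem_orthogonal_singleton_iff_inner_left.mp (Submodule.coe_mem _)

theorem stereographic_symm_eq (x : EuclideanSpace ℝ (Fin (n + 1))) :
    ((axisStereographic n).symm x : EuclideanSpace ℝ (Fin (n + 1 + 1)))
      = (‖x‖ ^ 2 + 4)⁻¹ • ((4 : ℝ) • equatorEmbedding n x
        + (1 * (‖x‖ ^ 2 - 4)) • EuclideanSpace.single 0 1) := by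
  have h : ‖equatorEmbedding n x‖ = ‖x‖ := (equatorEmbedding n).norm_map x
  rw [stereographic'_symm_apply, ← h, smul_add, one_mul]
  rfl

theorem map_reflection {E V : Type*} [NormedAddCommGroup E] [InnerProductSpace ℝ E]
    [NormedAddCommGroup V] [InnerProductSpace ℝ V] (L : E →ₗᵢ[ℝ] V) (a z : E) :
    Submodule.reflection (Submodule.span ℝ {L a})ᗮ (L z)
      = L (Submodule.reflection (Submodule.span ℝ {a})ᗮ z) := by
  simp [Submodule.reflection_orthogonal_apply, Submodule.reflection_singleton_apply,
    L.inner_map_map, L.norm_map]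

theorem det_doubleReflection {V : Type*} [NormedAddCommGroup V] [InnerProductSpace ℝ V]
    [FiniteDimensional ℝ V] {a b : V} (ha : a ≠ 0) (hb : b ≠ 0) :
    LinearMap.det ((doubleReflection a b).toLinearEquiv : V →ₗ[ℝ] V) = 1 := by
  have h : ∀ {c : V}, c ≠ 0 → LinearMap.det
      (Submodule.reflection (Submodule.span ℝ {c})ᗮ).toLinearMap = -1 := fun {c} hc => by
    rw [Submodule.det_reflection, Submodule.orthogonal_orthogonal, finrank_span_singleton hc,
      pow_one]
  have h2 : ((doubleReflection a b).toLinearEquiv : V →ₗ[ℝ] V)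
      = (Submodule.reflection (Submodule.span ℝ {a})ᗮ).toLinearMap ∘ₗ
        (Submodule.reflection (Submodule.span ℝ {b})ᗮ).toLinearMap := rfl
  rw [h2, LinearMap.det_comp, h ha, h hb]
  norm_num

/-- In stereographic coordinates from either pole the rotations about the axis act as rotations of
the coordinate space. -/
theorem exists_rotation {τ : OpenPartialHomeomorph (UnitSphere n) (EuclideanSpace ℝ (Fin (n + 1)))}
    {ε : ℝ} (hτ : ∀ x, (τ.symm x : EuclideanSpace ℝ (Fin (n + 1 + 1)))
      = (‖x‖ ^ 2 + 4)⁻¹ • ((4 : ℝ) • equatorEmbedding n x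
        + (ε * (‖x‖ ^ 2 - 4)) • EuclideanSpace.single 0 1))
    {a b : EuclideanSpace ℝ (Fin (n + 1))} (ha : a ≠ 0) (hb : b ≠ 0) :
    ∃ A : EuclideanSpace ℝ (Fin (n + 1 + 1)) ≃ₗᵢ[ℝ] EuclideanSpace ℝ (Fin (n + 1 + 1)),
      LinearMap.det (A.toLinearEquiv : EuclideanSpace ℝ (Fin (n + 1 + 1)) →ₗ[ℝ]
        EuclideanSpace ℝ (Fin (n + 1 + 1))) = 1 ∧
      A (EuclideanSpace.single 0 1) = EuclideanSpace.single 0 1 ∧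
      ∀ z, τ.symm (doubleReflection a b z) = sphereMap A (τ.symm z) := by
  have hL : ∀ {c : EuclideanSpace ℝ (Fin (n + 1))}, c ≠ 0 → equatorEmbedding n c ≠ 0 :=
    fun hc h0 => hc ((equatorEmbedding n).injective (h0.trans (map_zero _).symm))
  have hfix : doubleReflection (equatorEmbedding n a) (equatorEmbedding n b)
      (EuclideanSpace.single 0 1) = EuclideanSpace.single 0 1 := by
    rw [doubleReflection_apply, reflection_of_inner_eq_zero (inner_equatorEmbedding b),
      reflection_of_inner_eq_zero (inner_equatorEmbedding a)]
  refine ⟨doubleReflection (equatorEmbedding n a) (equatorEmbedding n b),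
    det_doubleReflection (hL ha) (hL hb), hfix, fun z => Subtype.ext ?_⟩
  change (τ.symm (doubleReflection a b z) : EuclideanSpace ℝ (Fin (n + 1 + 1)))
    = doubleReflection (equatorEmbedding n a) (equatorEmbedding n b) (τ.symm z)
  rw [hτ, hτ, map_smul, map_add, map_smul, map_smul, hfix, LinearIsometryEquiv.norm_map,
    doubleReflection_apply, doubleReflection_apply, map_reflection, map_reflection]

/-- The stereographic projection from the pole opposite to `axisPole`, in coordinates which differ
from those of the projection from `axisPole` by the inversion. -/
def oppositeStereographic (n : ℕ) :
    OpenPartialHomeomorph (UnitSphere n) (EuclideanSpace ℝ (Fin (n + 1))) :=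
  (sphereDiffeomorph (Submodule.reflection (Submodule.span ℝ
    {(axisPole n : EuclideanSpace ℝ (Fin (n + 1 + 1)))})ᗮ)).toHomeomorph.transOpenPartialHomeomorph
    (axisStereographic n)

theorem oppositeStereographic_symm_eq (x : EuclideanSpace ℝ (Fin (n + 1))) :
    ((oppositeStereographic n).symm x : EuclideanSpace ℝ (Fin (n + 1 + 1)))
      = (‖x‖ ^ 2 + 4)⁻¹ • ((4 : ℝ) • equatorEmbedding n x
        + (-1 * (‖x‖ ^ 2 - 4)) • EuclideanSpace.single 0 1) := by
  have h1 : ((oppositeStereographic n).symm x : EuclideanSpace ℝ (Fin (n + 1 + 1)))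
      = Submodule.reflection (Submodule.span ℝ
        {(EuclideanSpace.single 0 1 : EuclideanSpace ℝ (Fin (n + 1 + 1)))})ᗮ
        ((axisStereographic n).symm x) := rfl
  have h2 : ⟪(EuclideanSpace.single 0 1 : EuclideanSpace ℝ (Fin (n + 1 + 1))),
      equatorEmbedding n x⟫ = 0 := by
    rw [real_inner_comm]
    exact inner_equatorEmbedding x
  rw [h1, stereographic_symm_eq, map_smul, map_add, map_smul, map_smul,
    reflection_of_inner_eq_zero h2, Submodule.reflection_orthogonalComplement_singleton_eq_neg]
  module

theorem oppositeStereographic_symm_inversion {y : EuclideanSpace ℝ (Fin (n + 1))} (hy : y ≠ 0) :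
    (oppositeStereographic n).symm y = (axisStereographic n).symm (inversion y) := by
  refine Subtype.ext ?_
  rw [oppositeStereographic_symm_eq, stereographic_symm_eq, norm_inversion, inversion, map_smul]
  have h : ‖y‖ ≠ 0 := norm_ne_zero_iff.mpr hy
  have h1 : ((4 / ‖y‖) ^ 2 + 4)⁻¹ = ‖y‖ ^ 2 / 4 * (‖y‖ ^ 2 + 4)⁻¹ := by
    have : ‖y‖ ^ 2 + 4 ≠ 0 := by positivity
    field_simp
    ring
  rw [h1]
  simp only [smul_add, smul_smul]
  congr 2
  · field_simp
  · field_simp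
    ring

theorem stereographic_mem_maximalAtlas : axisStereographic n
    ∈ IsManifold.maximalAtlas (𝓡 (n + 1)) ∞ (UnitSphere n) :=
  StructureGroupoid.subset_maximalAtlas _ ⟨axisPole n, rfl⟩

theorem oppositeStereographic_mem_maximalAtlas : oppositeStereographic n
    ∈ IsManifold.maximalAtlas (𝓡 (n + 1)) ∞ (UnitSphere n) :=
  transOpenPartialHomeomorph_mem_maximalAtlas _ stereographic_mem_maximalAtlas

theorem mem_source_stereographic (q : UnitSphere n) :
    q ∈ (axisStereographic n).source ∨ q ∈ (oppositeStereographic n).source := by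
  by_cases hq : q = axisPole n
  · right
    change sphereMap _ q ∈ (axisStereographic n).source
    rw [stereographic'_source, hq, Set.mem_compl_iff, Set.mem_singleton_iff, Subtype.ext_iff]
    change Submodule.reflection (Submodule.span ℝ
      {(axisPole n : EuclideanSpace ℝ (Fin (n + 1 + 1)))})ᗮ
        (axisPole n : EuclideanSpace ℝ (Fin (n + 1 + 1))) ≠ _
    rw [Submodule.reflection_orthogonalComplement_singleton_eq_neg]
    intro h
    have h1 := congrArg (fun x : EuclideanSpace ℝ (Fin (n + 1 + 1)) => x 0) h
    norm_num [axisPole] at h1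
  · left
    simpa using hq

end Sphere

/-! ### Passage to arbitrary charts -/

section Charts

open LocalGeometry

/-- Positivity of the curvature operator at a point can be checked in any chart. -/
theorem hasPosCurvatureAt_of_chart {m : ℕ} {M : Type*} [TopologicalSpace M]
    [ChartedSpace (EuclideanSpace ℝ (Fin m)) M] [IsManifold (𝓡 m) ∞ M] {g : SmoothMetric m M}
    {e e' : OpenPartialHomeomorph M (EuclideanSpace ℝ (Fin m))}
    (he : e ∈ IsManifold.maximalAtlas (𝓡 m) ∞ M) (he' : e' ∈ IsManifold.maximalAtlas (𝓡 m) ∞ M)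
    {y : EuclideanSpace ℝ (Fin m)} (hy : y ∈ e.target) (hy' : e.symm y ∈ e'.source)
    (h : HasPosCurvatureAt (metricInChart g e') (e' (e.symm y))) :
    HasPosCurvatureAt (metricInChart g e) y := by
  have hU : ∀ᶠ z in nhds y, z ∈ e.target ∧ e.symm z ∈ e'.source :=
    (e.open_target.eventually_mem hy).and
      ((e.continuousAt_symm hy).eventually (e'.open_source.eventually_mem hy'))
  have hψ : ∀ᶠ z in nhds y, ContDiffAt ℝ ∞ (e' ∘ e.symm) z := by
    filter_upwards [hU] with z hz
    have h1 : ContMDiffAt (𝓡 m) (𝓡 m) ∞ (e' ∘ e.symm) z :=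
      (contMDiffAt_of_mem_maximalAtlas he' hz.2).comp z
        (contMDiffAt_symm_of_mem_maximalAtlas he hz.1)
    exact h1.contDiffAt
  refine HasPosCurvatureAt.of_pullback (ψ := e' ∘ e.symm) ?_ ?_ hψ ?_ h
  · filter_upwards [hU] with z hz
    exact isMetricAt_metricInChart g he hz.1
  · filter_upwards [e'.open_target.eventually_mem (e'.map_source hy')] with z hz
    exact isMetricAt_metricInChart g he' hz
  · filter_upwards [hU.eventually_nhds, hψ] with z hz hz'
    refine metricInChart_eq_pullback g ?_ (hz'.differentiableAt (by simp)) he'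
      (e'.map_source hz.self_of_nhds.2)
    filter_upwards [hz] with x hx
    exact (e'.left_inv hx.2).symm

end Charts

end

theorem mainTheorem2 (n : ℕ) (hn : 2 ≤ n) (g : SmoothMetric (n + 1) (UnitSphere n))
    (hrot : IsRotationallySymmetric g) (hsol : IsShrinkingSoliton g) :
    HasPositiveCurvatureOperator g := by
  obtain ⟨Φ, hΦ⟩ := hrot
  obtain ⟨f, hf, c, hc, hsol⟩ := hsol
  have ht₁ : (axisStereographic n).target = Set.univ := axisStereographic_target
  have ht₂ : (oppositeStereographic n).target = Set.univ := ht₁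
  have h₁ := isInvariantSoliton hΦ stereographic_mem_maximalAtlas ht₁
    (fun a b ha hb => exists_rotation stereographic_symm_eq ha hb) hf hsol
  have h₂ := isInvariantSoliton hΦ oppositeStereographic_mem_maximalAtlas ht₂
    (fun a b ha hb => exists_rotation oppositeStereographic_symm_eq ha hb) hf hsol
  have a₁ := transOpenPartialHomeomorph_mem_maximalAtlas Φ.symm
    (stereographic_mem_maximalAtlas (n := n))
  have a₂ := transOpenPartialHomeomorph_mem_maximalAtlas Φ.symm
    (oppositeStereographic_mem_maximalAtlas (n := n))
  have i₂ := fun (y : EuclideanSpace ℝ (Fin (n + 1))) (hy : y ≠ 0) =>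
    oppositeStereographic_symm_inversion hy
  have i₁ : ∀ y : EuclideanSpace ℝ (Fin (n + 1)), y ≠ 0 →
      (axisStereographic n).symm y
        = (oppositeStereographic n).symm (LocalGeometry.inversion y) := fun y hy => by
    rw [i₂ _ (LocalGeometry.inversion_ne_zero hy), LocalGeometry.inversion_inversion hy]
  have p₁ := h₁.hasPosCurvatureAt h₂ hn hc (fun y hy => congrArg (fun q => f (Φ q)) (i₂ y hy))
    (fun y hy => metricInChart_eq_pullback g
      (by filter_upwards [isOpen_ne.mem_nhds hy] with z hz using congrArg Φ (i₂ z hz))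
      ((LocalGeometry.contDiffAt_inversion hy).differentiableAt (by simp)) a₁
      (ht₁.symm ▸ Set.mem_univ _))
  have p₂ := h₂.hasPosCurvatureAt h₁ hn hc (fun y hy => congrArg (fun q => f (Φ q)) (i₁ y hy))
    (fun y hy => metricInChart_eq_pullback g
      (by filter_upwards [isOpen_ne.mem_nhds hy] with z hz using congrArg Φ (i₁ z hz))
      ((LocalGeometry.contDiffAt_inversion hy).differentiableAt (by simp)) a₂
      (ht₂.symm ▸ Set.mem_univ _))
  intro e he y hy
  rcases mem_source_stereographic (Φ.symm (e.symm y)) with hq | hq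
  · exact hasPosCurvatureAt_of_chart he a₁ hy hq (p₁ _)
  · exact hasPosCurvatureAt_of_chart he a₂ hy hq (p₂ _)
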